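/- **Setting.** Let $A$ be a finite-dimensional real alternative algebra with unit $1\neq 0$ ($\mathbb R$ being identified with $\mathbb R 1$) and with a $^*$-involution $x\mapsto x^c$ (a real linear map with $(x^c)^c=x$, $(xy)^c=y^cx^c$, $r^c=r$ for $r\in\mathbb R$). Put $t(x)=x+x^c$, $n(x)=xx^c$, $\mathbb S_A=\{x\in A: t(x)=0,\ n(x)=1\}$ and $Q_A=\mathbb R\cup\{x\in A: t(x),n(x)\in\mathbb R,\ t(x)^2<4n(x)\}$. Assume that $\mathbb S_A\neq\emptyset$ and that $A$ carries a norm $\|\cdot\|$ with $\|x\|^2=n(x)$ for all $x\in Q_A$. For $J\in\mathbb S_A$ let $\mathbb C_J=\{\alpha+\beta J:\alpha,\beta\in\mathbb R\}$; then $Q_A=\bigcup_{J}\mathbb C_J$. For $y=\alpha+\beta J\in Q_A$ let $\mathbb S_y=\alpha+\beta\,\mathbb S_A$. For $E\subseteq\mathbb C$ let $\Omega_E=\{\alpha+\beta J: \alpha+i\beta\in E,\ J\in\mathbb S_A\}$; sets of this form are called circular. "Open" for circular sets means open in $Q_A$. Let $A_{\mathbb C}=A\oplus\imath A$ with $(x+\imath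 y)(x'+\imath y')=xx'-yy'+\imath(xy'+yx')$. Let $D\subseteq\mathbb C$ be nonempty and invariant under conjugation. A stem function on $D$ is $F=F_1+\imath F_2:D\to A_{\mathbb C}$ with $F_1(\bar z)=F_1(z)$, $F_2(\bar z)=-F_2(z)$; it induces the slice function $\mathcal I(F):\Omega_D\to A$, $\alpha+\beta J\mapsto F_1(\alpha+i\beta)+JF_2(\alpha+i\beta)$. The slice product is $\mathcal I(F)\cdot\mathcal I(G)=\mathcal I(FG)$. If $\Omega_D$ is open, $\mathcal I(F)$ is slice regular when $F$ is $C^1$ and $\frac{\partial F}{\partial\alpha}+\imath\frac{\partial F}{\partial\beta}=0$; $\mathcal{SR}(\Omega)$ denotes the set of slice regular functions on $\Omega$. Let $\Delta_y(x)=x^2-x\,t(y)+n(y)$, let $(x-y)^{\bullet n}$ ($n\in\mathbb Z$) be the powers of $x-y$ for the slice product, where $(x-y)^{-\bullet}=\Delta_y(x)^{-1}(x-y^c)$, and let $\mathscr S_{y,2k}=\Delta_y^k$, $\mathscr S_{y,2k+1}=\Delta_y(x)^k(x-y)$ for $k\in\mathbb Z$. Put $\mathrm{Re}(x)=(x+x^c)/2$,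 $\mathrm{Im}(x)=(x-x^c)/2$. Let $\sigma(x,y)=\tau(x,y)=\|x-y\|$ if $x,y$ lie in a common $\mathbb C_J$, and otherwise $\sigma(x,y)^2=\|\mathrm{Re}(x)-\mathrm{Re}(y)\|^2+(\|\mathrm{Im}(x)\|+\|\mathrm{Im}(y)\|)^2$ and $\tau(x,y)^2=\|\mathrm{Re}(x)-\mathrm{Re}(y)\|^2+(\|\mathrm{Im}(x)\|-\|\mathrm{Im}(y)\|)^2$ (with $\sigma,\tau\ge 0$). Let $f\in\mathcal{SR}(\Omega)$ and $w\in Q_A$. * $w$ is a singularity for $f$ if $\Sigma(w,0,R)=\{x\in Q_A:\tau(x,w)>0,\ \sigma(x,w)<R\}\subseteq\Omega$ for some $R>0$. The Laurent expansion of $f$ at $w$ is the expansion $f(x)=\sum_{n\in\mathbb Z}(x-w)^{\bullet n}\cdot a_n$ valid in such a $\Sigma(w,0,R)$. If there is $m\in\mathbb N$ with $a_{-k}=0$ for all $k>m$, then $w$ is a pole and $\mathrm{ord}_f(w)$ is the least such $m$; otherwise $w$ is an essential singularity and $\mathrm{ord}_f(w)=+\infty$. The singularity $w$ is removable if $f$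 extends to a slice regular function on a circular open set containing $\Omega$ and $w$. * The spherical expansion of $f$ at $w$ is the expansion $f(x)=\sum_{n\in\mathbb Z}\mathscr S_{w,n}(x)\cdot c_n$ valid in some $\{x\in Q_A: 0<\|\Delta_w(x)\|^{1/2}<r\}\subseteq\Omega$, $r>0$; $\mathrm{ord}_f(\mathbb S_w)$ is the least even $m\in\mathbb N$ with $c_n=0$ for all $n<-m$, and $+\infty$ if there is none. **Theorem.** Let $\widetilde\Omega$ be a circular open subset of $Q_A$, $y\in\widetilde\Omega\setminus\mathbb R$, $\Omega=\widetilde\Omega\setminus\mathbb S_y$ and $f\in\mathcal{SR}(\Omega)$. Let $J\in\mathbb S_A$ be such that $y\in\mathbb C_J$, and put $\Omega_J=\Omega\cap\mathbb C_J$, $\widetilde\Omega_J=\widetilde\Omega\cap\mathbb C_J$. Every $w\in\mathbb S_y$ is a singularity for $f$, at which $f$ has a unique Laurent expansion, and $f$ has a unique spherical expansion at $y$. Exactly one of the following assertions 1, 2, 3 holds. 1. Every point of $\mathbb S_y$ is a removable singularity for $f$. This is equivalent to each of the following: * 1a. $\mathrm{ord}_f(\mathbb S_y)=0$. * 1b.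 $\mathrm{ord}_f(y)=0=\mathrm{ord}_f(y^c)$. * 1c. There is a neighborhood $U_J$ of $\{y,y^c\}$ in $\widetilde\Omega_J$ such that $\|f\|$ is bounded in $U_J\setminus\{y,y^c\}$. * 1d. There is a neighborhood $U$ of $\mathbb S_y$ in $\widetilde\Omega$ such that $\|f\|$ is bounded in $U\setminus\mathbb S_y$. 2. Every point of $\mathbb S_y$ is a pole for $f$ that is not removable. This is equivalent to each of the following: * 2a. $\mathrm{ord}_f(\mathbb S_y)$ is finite and positive. * 2b. $\mathrm{ord}_f(y),\mathrm{ord}_f(y^c)$ are finite and at least one of them is positive. * 2c. There is an integer $k\ge1$ such that $z\mapsto (z-y)^k(z-y^c)^kf(z)$ on $\Omega_J$ extends to a continuous function $g_J:\widetilde\Omega_J\to A$ with $g_J(y)\ne0$ or $g_J(y^c)\neq0$. * 2d. There is an integer $k\ge1$ such that $x\mapsto\Delta_y(x)^kf(x)$ on $\Omega$ extends to some $g\in\mathcal{SR}(\widetilde\Omega)$ that does not vanish identically in $\mathbb S_y$. Moreover, for any $k\ge1$ and any continuous extension $g_J$ as in 2c: if $g_J(y)\neq0$ then $\lim_{\Omega_J\ni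 x\to y}\|f(x)\|=+\infty$, and if $g_J(y^c)\neq0$ then $\lim_{\Omega_J\ni x\to y^c}\|f(x)\|=+\infty$. For any $k,g$ as in 2d: for all $w\in\mathbb S_y$ with $g(w)\neq0$ we have $2k=\mathrm{ord}_f(\mathbb S_y)=2\,\mathrm{ord}_f(w)$ and $\lim_{\Omega\ni x\to w}\|f(x)\|=+\infty$; for all $w\in\mathbb S_y$ with $g(w)=0$ we have $\mathrm{ord}_f(w)<k$. 3. For every $I\in\mathbb S_A$, the set $\mathbb S_y\cap\mathbb C_I$ includes an essential singularity for $f$. This is equivalent to each of the following: * 3a. $\mathrm{ord}_f(\mathbb S_y)=+\infty$. * 3b. $\mathrm{ord}_f(y),\mathrm{ord}_f(y^c)$ are not both finite. * 3c. For all neighborhoods $U_J$ of $y$ in $\widetilde\Omega_J$ with $y^c\notin U_J$ and all $k\in\mathbb N$, $\sup_{z\in U_J\setminus\{y\}}\|(z-y)^kf(z)\|=+\infty$; or the same holds with $y$ and $y^c$ swapped. * 3d. For all neighborhoods $U$ of $\mathbb S_y$ in $\widetilde\Omega$ and all $k\in\mathbb N$, $\sup_{x\in U\setminus\mathbb S_y}\|\Delta_y(x)^kf(x)\|=+\infty$.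 -/

import Mathlib

open Filter Topology Set

/-- A real vector space norm and a (not necessarily associative) unital ring structure sharing the
same addition.  No compatibility between the norm and the product is assumed. -/
class NormedNonAssocRing (A : Type*) extends NormedAddCommGroup A, NonAssocRing A

namespace SliceAlg

noncomputable section

section Real

variable {A : Type*} [NormedNonAssocRing A] [NormedSpace ℝ A]

/-- The real number `r` with `x = r • 1`, when `x` lies in the real subalgebra generated by `1`
(and `0` otherwise). -/
def realOf (x : A) : ℝ :=
  open Classical in if h : ∃ r : ℝ, x = r • (1 : A) then h.choose else 0

theorem realOf_smul_one [Nontrivial A] (r : ℝ) : realOf (r • (1 : A)) = r := by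
  have h : ∃ s : ℝ, r • (1 : A) = s • (1 : A) := ⟨r, rfl⟩
  have h1 : realOf (r • (1 : A)) = h.choose := by
    unfold realOf
    exact dif_pos h
  rw [h1]
  have h2 := h.choose_spec
  exact (smul_left_injective ℝ (one_ne_zero (α := A)) h2).symm

end Real

section Algebra

variable {A : Type*} [NormedNonAssocRing A] [NormedSpace ℝ A] [StarRing A]

/-- The trace `t(x) = x + x^c`, an element of `A`. -/
def tr (x : A) : A := x + star x

/-- The (squared) norm `n(x) = x x^c`, an element of `A`. -/
def nm (x : A) : A := x * star x

variable (A) in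
/-- `𝕊_A = {x | t(x) = 0, n(x) = 1}`. -/
def unitSphere : Set A := {x | tr x = 0 ∧ nm x = 1}

variable (A) in
/-- The real line inside `A`. -/
def realLine : Set A := {x | ∃ r : ℝ, x = r • (1 : A)}

variable (A) in
/-- The quadratic cone `Q_A = ℝ ∪ {x | t(x) ∈ ℝ, n(x) ∈ ℝ, t(x)² < 4 n(x)}`. -/
def quadraticCone : Set A :=
  realLine A ∪ {x | ∃ t n : ℝ, tr x = t • (1 : A) ∧ nm x = n • (1 : A) ∧ t ^ 2 < 4 * n}

/-- The point `α + β J` of `A` associated with `z = α + i β`. -/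
def sl (J : A) (z : ℂ) : A := z.re • (1 : A) + z.im • J

/-- The slice `ℂ_J = {α + β J}`. -/
def slice (J : A) : Set A := range (sl J)

/-- The circularization `Ω_E` of `E ⊆ ℂ`. -/
def circularization (E : Set ℂ) : Set A := {x | ∃ z ∈ E, ∃ J ∈ unitSphere A, x = sl J z}

/-- Circular subsets of the quadratic cone. -/
def IsCircular (Ω : Set A) : Prop := ∃ E : Set ℂ, Ω = circularization E

/-- Relatively open subsets of the quadratic cone. -/
def IsOpenInCone (Ω : Set A) : Prop := ∃ U : Set A, IsOpen U ∧ Ω = U ∩ quadraticCone A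

/-- The sphere `𝕊_y = α + β 𝕊_A` through `y = α + β J`. -/
def sphere (y : A) : Set A :=
  {w | ∃ z : ℂ, ∃ J ∈ unitSphere A, ∃ I ∈ unitSphere A, y = sl J z ∧ w = sl I z}

/-- Powers in `A` (which are unambiguous when `A` is alternative). -/
def apow (x : A) : ℕ → A
  | 0 => 1
  | k + 1 => x * apow x k

/-- `Δ_y(x) = x² - x t(y) + n(y)`. -/
def Delta (y x : A) : A := x * x - x * tr y + nm y

/-! ### Stem functions, slice functions, slice regular functions

Elements `p + ι q` of the complexification `A_ℂ` are represented by pairs `(p, q) : A × A`. -/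

/-- The product of `A_ℂ`. -/
def cmul (p q : A × A) : A × A := (p.1 * q.1 - p.2 * q.2, p.1 * q.2 + p.2 * q.1)

/-- Powers in `A_ℂ`. -/
def cpow (p : A × A) : ℕ → A × A
  | 0 => (1, 0)
  | k + 1 => cmul p (cpow p k)

/-- The inclusion of `ℂ = ℝ + ι ℝ` into `A_ℂ`. -/
def ofC (w : ℂ) : A × A := (w.re • (1 : A), w.im • (1 : A))

/-- The map `A_ℂ → A`, `p + ι q ↦ p + J q`. -/
def ev (J : A) (p : A × A) : A := p.1 + J * p.2

/-- `D ⊆ ℂ` is invariant under complex conjugation. -/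
def ConjInvariant (D : Set ℂ) : Prop := ∀ z ∈ D, (starRingEnd ℂ) z ∈ D

/-- `F = F₁ + ι F₂` is a stem function on `D`. -/
def IsStemOn (D : Set ℂ) (F : ℂ → A × A) : Prop :=
  ∀ z ∈ D, (F ((starRingEnd ℂ) z)).1 = (F z).1 ∧ (F ((starRingEnd ℂ) z)).2 = -(F z).2

/-- `f` is the slice function induced on `Ω_D` by `F`. -/
def InducedOn (D : Set ℂ) (F : ℂ → A × A) (f : A → A) : Prop :=
  ∀ z ∈ D, ∀ J ∈ unitSphere A, f (sl J z) = ev J (F z)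

/-- `∂F/∂α + ι ∂F/∂β = 0` on `D`. -/
def CauchyRiemannOn (D : Set ℂ) (F : ℂ → A × A) : Prop :=
  ∀ z ∈ D, (fderiv ℝ F z 1).1 = (fderiv ℝ F z Complex.I).2 ∧
    (fderiv ℝ F z 1).2 = -(fderiv ℝ F z Complex.I).1

/-- `f` (restricted to `Ω`) is slice regular: `Ω = Ω_D` is open in the quadratic cone and `f` is
induced by a stem function of class `C¹` on `D` with `∂F/∂z̄ = 0`. -/
def SliceRegularOn (Ω : Set A) (f : A → A) : Prop :=
  IsOpenInCone Ω ∧ ∃ D : Set ℂ, D.Nonempty ∧ ConjInvariant D ∧ Ω = circularization D ∧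
    ∃ F : ℂ → A × A, IsStemOn D F ∧ ContDiffOn ℝ 1 F D ∧ CauchyRiemannOn D F ∧ InducedOn D F f

/-! ### Laurent expansions -/

/-- The value at `z` of `Δ_y`, as a slice preserving stem function `z ↦ z² - z t(y) + n(y)`. -/
def deltaStem (y : A) (z : ℂ) : ℂ := z ^ 2 - z * (realOf (tr y) : ℂ) + (realOf (nm y) : ℂ)

/-- The stem function `α + iβ ↦ (α - y) + ι β` of `x - y`. -/
def linStem (y : A) (z : ℂ) : A × A := (z.re • (1 : A) - y, z.im • (1 : A))

/-- The stem function of the slice inverse `(x - y)^{-•} = Δ_y(x)⁻¹ (x - y^c)`. -/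
def linInvStem (y : A) (z : ℂ) : A × A := cmul (ofC (deltaStem y z)⁻¹) (linStem (star y) z)

/-- The stem function of the slice power `(x - y)^{• n}`, `n ∈ ℤ`. -/
def linPowStem (y : A) (z : ℂ) : ℤ → A × A
  | Int.ofNat k => cpow (linStem y z) k
  | Int.negSucc k => cpow (linInvStem y z) (k + 1)

/-- The stem function of `𝒮_{y,2k} = Δ_y^k`, `𝒮_{y,2k+1} = Δ_y^k (x - y)`, `k ∈ ℤ`. -/
def sphPowStem (y : A) (z : ℂ) (n : ℤ) : A × A :=
  if Even n then ofC (deltaStem y z ^ (n / 2))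
  else cmul (ofC (deltaStem y z ^ (n / 2))) (linStem y z)

/-- Real part `(x + x^c)/2`. -/
def rePart (x : A) : A := (1 / 2 : ℝ) • (x + star x)

/-- Imaginary part `(x - x^c)/2`. -/
def imPart (x : A) : A := (1 / 2 : ℝ) • (x - star x)

/-- `x` and `y` lie in a common slice. -/
def SameSlice (x y : A) : Prop := ∃ J ∈ unitSphere A, x ∈ slice J ∧ y ∈ slice J

/-- The distance `σ_A`. -/
def sigmaDist (x y : A) : ℝ :=
  open Classical in
  if SameSlice x y then ‖x - y‖
  else Real.sqrt (‖rePart x - rePart y‖ ^ 2 + (‖imPart x‖ + ‖imPart y‖) ^ 2)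

/-- The pseudodistance `τ_A`. -/
def tauDist (x y : A) : ℝ :=
  open Classical in
  if SameSlice x y then ‖x - y‖
  else Real.sqrt (‖rePart x - rePart y‖ ^ 2 + (‖imPart x‖ - ‖imPart y‖) ^ 2)

/-- `Σ(y, R₁, R₂) = {x ∈ Q_A | τ_A(x,y) > R₁, σ_A(x,y) < R₂}`. -/
def sigmaShell (y : A) (R₁ R₂ : ℝ) : Set A :=
  {x ∈ quadraticCone A | R₁ < tauDist x y ∧ sigmaDist x y < R₂}

/-- The Cassini pseudodistance `u(x, y) = √‖Δ_y(x)‖`. -/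
def cassini (x y : A) : ℝ := Real.sqrt ‖Delta y x‖

/-- The Cassini shell `U(y, r₁, r₂)`. -/
def cassiniShell (y : A) (r₁ r₂ : ℝ) : Set A :=
  {x ∈ quadraticCone A | r₁ < cassini x y ∧ cassini x y < r₂}

/-- `y` is a singularity for slice regular functions on `Ω`. -/
def IsSingularity (Ω : Set A) (y : A) : Prop :=
  y ∈ quadraticCone A ∧ ∃ R : ℝ, 0 < R ∧ sigmaShell y 0 R ⊆ Ω

/-- `f(x) = ∑_{n ∈ ℤ} (x - y)^{• n} · a_n` is the Laurent expansion of `f : Ω → A` at `y`: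
it holds in some `Σ(y, 0, R) ⊆ Ω`, `R > 0`. -/
def IsLaurentExpansion (Ω : Set A) (f : A → A) (y : A) (a : ℤ → A) : Prop :=
  ∃ R : ℝ, 0 < R ∧ sigmaShell y 0 R ⊆ Ω ∧
    ∀ J ∈ unitSphere A, ∀ z : ℂ, sl J z ∈ sigmaShell y 0 R →
      HasSum (fun n : ℤ => ev J (cmul (linPowStem y z n) (a n, 0))) (f (sl J z))

/-- `f(x) = ∑_{n ∈ ℤ} 𝒮_{y,n}(x) · c_n` is the spherical Laurent expansion of `f : Ω → A` at `y`:
it holds in some Cassini shell `U(y, 0, r) ⊆ Ω`, `r > 0`. -/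
def IsSphericalExpansion (Ω : Set A) (f : A → A) (y : A) (c : ℤ → A) : Prop :=
  ∃ r : ℝ, 0 < r ∧ cassiniShell y 0 r ⊆ Ω ∧
    ∀ J ∈ unitSphere A, ∀ z : ℂ, sl J z ∈ cassiniShell y 0 r →
      HasSum (fun n : ℤ => ev J (cmul (sphPowStem y z n) (c n, 0))) (f (sl J z))

/-- `y` is a pole of order at most `m` for `f : Ω → A`. -/
def IsPoleOfOrderLE (Ω : Set A) (f : A → A) (y : A) (m : ℕ) : Prop :=
  ∃ a : ℤ → A, IsLaurentExpansion Ω f y a ∧ ∀ k : ℕ, m < k → a (-(k : ℤ)) = 0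

/-- `y` is a pole for `f : Ω → A`. -/
def IsPole (Ω : Set A) (f : A → A) (y : A) : Prop := ∃ m : ℕ, IsPoleOfOrderLE Ω f y m

/-- `y` is an essential singularity for `f : Ω → A`. -/
def IsEssential (Ω : Set A) (f : A → A) (y : A) : Prop :=
  IsSingularity Ω y ∧ (∃ a : ℤ → A, IsLaurentExpansion Ω f y a) ∧ ¬ IsPole Ω f y

/-- `y` is a removable singularity for `f : Ω → A`. -/
def IsRemovable (Ω : Set A) (f : A → A) (y : A) : Prop :=
  IsSingularity Ω y ∧ ∃ (Ω' : Set A) (g : A → A), IsCircular Ω' ∧ IsOpenInCone Ω' ∧ y ∈ Ω' ∧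
    Ω ⊆ Ω' ∧ SliceRegularOn Ω' g ∧ EqOn g f Ω

/-- The order `ord_f(y) ∈ ℕ ∪ {+∞}`: the least `m` such that `a_{-k} = 0` for all `k > m`, and
`+∞` if there is none. -/
def ord (Ω : Set A) (f : A → A) (y : A) : ℕ∞ :=
  ⨅ (m : ℕ) (_ : IsPoleOfOrderLE Ω f y m), (m : ℕ∞)

/-- The spherical order `ord_f(𝕊_y) ∈ ℕ ∪ {+∞}`: the least even natural number `m` such that
`c_n = 0` for all `n < -m`, and `+∞` if there is none. -/
def sphericalOrd (Ω : Set A) (f : A → A) (y : A) : ℕ∞ :=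
  ⨅ (m : ℕ) (_ : Even m ∧ ∃ c : ℤ → A, IsSphericalExpansion Ω f y c ∧
    ∀ n : ℤ, n < -(m : ℤ) → c n = 0), (m : ℕ∞)

/-- `U` is a neighborhood of `S` in `X`. -/
def IsNhdIn (X S U : Set A) : Prop := U ⊆ X ∧ ∃ V : Set A, IsOpen V ∧ S ⊆ V ∧ V ∩ X ⊆ U

/-! ### The three types of spheres of singularities -/

/-- Every point of `𝕊_y` is a removable singularity. -/
def AllRemovable (Ω : Set A) (f : A → A) (y : A) : Prop :=
  ∀ w ∈ sphere y, IsRemovable Ω f w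

/-- Every point of `𝕊_y` is a non removable pole. -/
def AllNonremovablePoles (Ω : Set A) (f : A → A) (y : A) : Prop :=
  ∀ w ∈ sphere y, IsPole Ω f w ∧ ¬ IsRemovable Ω f w

/-- For every `I ∈ 𝕊_A`, the intersection `𝕊_y ∩ ℂ_I` includes an essential singularity. -/
def EssentialInEverySlice (Ω : Set A) (f : A → A) (y : A) : Prop :=
  ∀ I ∈ unitSphere A, ∃ w ∈ sphere y ∩ slice I, IsEssential Ω f w

/-- `g` is, on `X`, a continuous extension of `z ↦ (z - y)^k (z - y^c)^k f(z)` from `X \ 𝕊_y`. -/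
def IsContinuousExtension (X : Set A) (f : A → A) (y : A) (k : ℕ) (g : A → A) : Prop :=
  ContinuousOn g X ∧
    ∀ z ∈ X \ sphere y, g z = (apow (z - y) k * apow (z - star y) k) * f z

/-- `g` is a slice regular extension to `X` of `x ↦ Δ_y(x)^k f(x)` from `X \ 𝕊_y`, and `g` does not
vanish identically in `𝕊_y`. -/
def IsRegularExtension (X : Set A) (f : A → A) (y : A) (k : ℕ) (g : A → A) : Prop :=
  SliceRegularOn X g ∧ (∀ x ∈ X \ sphere y, g x = apow (Delta y x) k * f x) ∧
    ∃ w ∈ sphere y, g w ≠ 0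

end Algebra

end

end SliceAlg

open SliceAlg

/-!
The stem function `F = F₁ + ι F₂` of `f` is holomorphic for the complex structure of `A_ℂ` given by
`ι`, so that it is an ordinary holomorphic function with values in a finite-dimensional complex
vector space (`IsHolStem`; `Coord A` is `A_ℂ` in coordinates). Write `y = α₀ + β₀ J` and
`z₀ = α₀ + i β₀`. Then `F` has isolated singularities at `z₀` and `z̄₀`, and every assertion of the
theorem is a statement about the order of its pole at `z₀` (`PoleLE F z₀ m`: at most `m`).

* For an imaginary unit `I`, left multiplication by `I` makes `A` a complex vector space, because
  `I (I a) = -a` in an alternative algebra, and `p + ι q ↦ p + I q` is complex-linear for it. On the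
  slice of `I` the slice power `(x - y)^{• n}`, with `y = α₀ + β₀ I`, is `(z - z₀) ^ n`. Near a
  non-real point, the shells `Σ(y, 0, R)` lie in one slice. The Laurent expansion of `f` at
  `α₀ + β₀ I` is therefore the classical one of `z ↦ F₁ z + I F₂ z` at `z₀`, and its order is
  described by `SlicePoleLE F I z₀ m` (`isPoleOfOrderLE_iff`).
* The idempotents `(1 ∓ ι I) / 2` split `A_ℂ` into two complex subspaces, on which the evaluations
  at `I` and at `-I` are isomorphisms onto `A`. Thus the pole order of `F` is the maximum of the
  orders of `f` at the two points `α₀ ± β₀ I` (`poleLE_iff_slicePoleLE`), for every `I`.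
* The map `z ↦ ζ = (z - z₀) (z - z̄₀)`, which is `Δ_y` on a slice, is two-to-one near `ζ = 0` with
  one root near `z₀` and one near `z̄₀`. Interpolation gives `F z = U ζ + z V ζ` with `U`, `V`
  holomorphic for small `ζ ≠ 0` (`exists_split`). The spherical expansion of `f` amounts to the
  Laurent expansions of `U` and `V` at `ζ = 0`; hence it exists and is unique, and its order is
  twice the pole order of `F` (`exists_isSphericalExpansion_iff_poleLE`).
* If `F` has a pole of order at most `m`, then `ζ ^ m F` extends to a holomorphic stem function
  (`exists_extension`). With `m = 0` this removes the singularity on the whole sphere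
  (`isRemovable_iff`), and with `m` the exact order it gives the extensions of case 2. The order of
  `f` at a point of the sphere is `m` or less than `m` according to whether the extension is
  non-zero there or not (`le_of_slicePoleLE`, `slicePoleLE_pred`).
* The neighbourhoods of the sphere `𝕊_y` correspond to neighbourhoods of `z₀` and `z̄₀`, because the
  sets `‖Δ_y‖ < ρ` are neighbourhoods of the sphere, and the evaluations at imaginary units are
  uniformly bounded. This turns the conditions of boundedness into bounds for the pole order
  (`exists_bound_sphere_iff`, `exists_bound_slice_iff`, `forall_not_bddAbove_slice_iff`).

The three cases are then: `F` is bounded near `z₀`, has a pole of positive order at `z₀`, or has an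
essential singularity at `z₀`.
-/

set_option linter.unusedSectionVars false

namespace SliceAlg

noncomputable section

/-! ### Laurent series of vector-valued holomorphic functions -/

section Laurent

open Metric Complex

variable {E : Type*} [NormedAddCommGroup E] [NormedSpace ℂ E]

/-- `a` is the family of coefficients of a Laurent series centred at `c` that converges
unconditionally to `g` in some punctured neighbourhood of `c`. -/
def HasLaurentAt (g : ℂ → E) (c : ℂ) (a : ℤ → E) : Prop :=
  ∀ᶠ z in 𝓝[≠] c, HasSum (fun n : ℤ => (z - c) ^ n • a n) (g z)

/-- `g` has at worst a pole of order `m` at `c`, expressed as boundedness of `(z - c) ^ m • g z`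
near `c`. -/
def PoleLE (g : ℂ → E) (c : ℂ) (m : ℕ) : Prop :=
  (fun z => (z - c) ^ m • g z) =O[𝓝[≠] c] (fun _ => (1 : ℝ))

theorem eventually_nhdsNE_iff {c : ℂ} {p : ℂ → Prop} :
    (∀ᶠ z in 𝓝[≠] c, p z) ↔ ∃ R : ℝ, 0 < R ∧ ∀ z, 0 < ‖z - c‖ → ‖z - c‖ < R → p z := by
  rw [eventually_nhdsWithin_iff, Metric.eventually_nhds_iff]
  refine ⟨fun ⟨R, hR, h⟩ => ⟨R, hR, fun z h0 hz => h (by rwa [dist_eq_norm]) ?_⟩,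
    fun ⟨R, hR, h⟩ => ⟨R, hR, fun z hz h0 => h z ?_ (by rwa [← dist_eq_norm])⟩⟩
  · simpa [sub_eq_zero] using h0
  · simpa [sub_eq_zero] using h0

/-- Termwise integration over a circle of a normally convergent series. -/
theorem hasSum_circleIntegral_of_summable {ι : Type*} [Countable ι] {F : ι → ℂ → E} {g : ℂ → E}
    {c : ℂ} {r : ℝ} (hr : 0 ≤ r) {b : ι → ℝ} (hF : ∀ i, ContinuousOn (F i) (Metric.sphere c r))
    (hb : Summable b) (hFb : ∀ i, ∀ z ∈ Metric.sphere c r, ‖F i z‖ ≤ b i)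
    (hg : ∀ z ∈ Metric.sphere c r, HasSum (fun i => F i z) (g z)) :
    HasSum (fun i => ∮ z in C(c, r), F i z) (∮ z in C(c, r), g z) := by
  have hmem : ∀ θ, circleMap c r θ ∈ Metric.sphere c r := circleMap_mem_sphere c hr
  refine intervalIntegral.hasSum_integral_of_dominated_convergence
    (fun i _ => r * b i) (fun i => ?_) (fun i => ?_) ?_ ?_ ?_
  · have h1 : Continuous fun θ => F i (circleMap c r θ) :=
      (hF i).comp_continuous (continuous_circleMap c r) hmem
    have h2 : Continuous fun θ => deriv (circleMap c r) θ := by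
      simp only [deriv_circleMap]
      fun_prop
    exact (h2.smul h1).aestronglyMeasurable
  · refine Eventually.of_forall fun θ _ => ?_
    simp only [deriv_circleMap, norm_smul, norm_mul, norm_circleMap_zero, norm_I, mul_one,
      abs_of_nonneg hr]
    exact mul_le_mul_of_nonneg_left (hFb i _ (hmem θ)) hr
  · exact Eventually.of_forall fun _ _ => hb.mul_left _
  · exact intervalIntegrable_const
  · exact Eventually.of_forall fun θ _ => (hg _ (hmem θ)).const_smul _

/-- The coefficients of a convergent Laurent series are given by Cauchy's integrals. -/
theorem circleIntegral_zpow_smul_of_hasSum [FiniteDimensional ℝ E] {g : ℂ → E} {c : ℂ} {r : ℝ}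
    (hr : 0 < r) {a : ℤ → E}
    (h : ∀ z ∈ Metric.sphere c r, HasSum (fun n : ℤ => (z - c) ^ n • a n) (g z)) (m : ℤ) :
    (∮ z in C(c, r), (z - c) ^ (-m - 1) • g z) = (2 * Real.pi * I : ℂ) • a m := by
  have : CompleteSpace E := FiniteDimensional.complete ℝ E
  have hne : ∀ z ∈ Metric.sphere c r, z - c ≠ 0 := fun z hz =>
    sub_ne_zero.2 (ne_of_mem_sphere hz hr.ne')
  have hnorm : ∀ z ∈ Metric.sphere c r, ‖z - c‖ = r := fun z hz => mem_sphere_iff_norm.1 hz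
  have h0 : c + r ∈ Metric.sphere c r := by simp [abs_of_pos hr]
  have hsum : Summable fun n : ℤ => r ^ (-m - 1) * ‖(r : ℂ) ^ n • a n‖ := by
    have := (h _ h0).summable.norm
    simp only [add_sub_cancel_left] at this
    exact this.mul_left _
  have key := hasSum_circleIntegral_of_summable (c := c) (g := fun z => (z - c) ^ (-m - 1) • g z)
    (F := fun n z => (z - c) ^ (-m - 1) • (z - c) ^ n • a n) hr.le
    (fun n => by
      have : ∀ k : ℤ, ContinuousOn (fun z => (z - c) ^ k) (Metric.sphere c r) := fun k =>
        ContinuousOn.zpow₀ (by fun_prop) k fun z hz => Or.inl (hne z hz)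
      exact (this _).smul ((this _).smul continuousOn_const)) hsum
    (fun n z hz => by
      simp [norm_smul, norm_zpow, hnorm z hz, abs_of_pos hr])
    (fun z hz => (h z hz).const_smul _)
  have hterm : ∀ n : ℤ, (∮ z in C(c, r), (z - c) ^ (-m - 1) • (z - c) ^ n • a n)
      = (∮ z in C(c, r), (z - c) ^ (n - m - 1)) • a n := by
    intro n
    rw [← circleIntegral.integral_smul_const]
    refine circleIntegral.integral_congr hr.le fun z hz => ?_
    rw [smul_smul, ← zpow_add₀ (hne z hz)]
    congr 2
    ring
  simp only [hterm] at key
  have hs := hasSum_single (f := fun n : ℤ => (∮ z in C(c, r), (z - c) ^ (n - m - 1)) • a n) m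
    (fun n hn => by
      rw [circleIntegral.integral_sub_zpow_of_ne (by omega), zero_smul])
  rw [key.unique hs]
  congr 1
  rw [← circleIntegral.integral_sub_center_inv c hr.ne']
  refine circleIntegral.integral_congr hr.le fun z _ => ?_
  simp

/-- The coefficients of a Laurent series are Cauchy integrals of its sum. -/
theorem HasLaurentAt.unique [FiniteDimensional ℝ E] {g : ℂ → E} {c : ℂ} {a b : ℤ → E}
    (ha : HasLaurentAt g c a) (hb : HasLaurentAt g c b) : a = b := by
  obtain ⟨R, hR, h⟩ := eventually_nhdsNE_iff.1 (ha.and hb)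
  have hr : 0 < R / 2 := by positivity
  have hs : ∀ z ∈ Metric.sphere c (R / 2), 0 < ‖z - c‖ ∧ ‖z - c‖ < R := fun z hz => by
    rw [mem_sphere_iff_norm.1 hz]
    constructor <;> linarith
  funext m
  have h1 := circleIntegral_zpow_smul_of_hasSum hr
    (fun z hz => (h z (hs z hz).1 (hs z hz).2).1) m
  rw [circleIntegral_zpow_smul_of_hasSum hr (fun z hz => (h z (hs z hz).1 (hs z hz).2).2) m] at h1
  exact (smul_right_injective E two_pi_I_ne_zero h1).symm

/-- Cauchy's integral formula for an annulus, obtained by applying Cauchy's theorem to the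
divided difference `dslope g w`. -/
theorem circleIntegral_annulus_sub [CompleteSpace E] {g : ℂ → E} {c w : ℂ} {r ρ R : ℝ}
    (hr : 0 < r) (hrw : r < ‖w - c‖) (hwρ : ‖w - c‖ < ρ) (hρ : ρ < R)
    (hg : DifferentiableOn ℂ g (ball c R \ {c})) :
    (∮ z in C(c, ρ), (z - w)⁻¹ • g z) - (∮ z in C(c, r), (z - w)⁻¹ • g z)
      = (2 * Real.pi * I : ℂ) • g w := by
  have hopen : IsOpen (ball c R \ {c}) := isOpen_ball.sdiff isClosed_singleton
  have hw : w ∈ ball c R \ {c} := by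
    refine ⟨mem_ball_iff_norm.2 (hwρ.trans hρ), ?_⟩
    rintro rfl
    simp at hrw
    linarith
  have hd : DifferentiableOn ℂ (dslope g w) (ball c R \ {c}) :=
    (Complex.differentiableOn_dslope (hopen.mem_nhds hw)).2 hg
  have hsub : closedBall c ρ \ ball c r ⊆ ball c R \ {c} := by
    rintro z ⟨h1, h2⟩
    refine ⟨closedBall_subset_ball hρ h1, ?_⟩
    rintro rfl
    exact h2 (mem_ball_self hr)
  have hrρ : r ≤ ρ := (hrw.trans hwρ).le
  have hCG := circleIntegral_eq_of_differentiable_on_annulus_off_countable hr hrρ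
    countable_empty (hd.continuousOn.mono hsub) (fun z hz => by
      have : z ∈ ball c R \ {c} := hsub ⟨ball_subset_closedBall hz.1.1,
        fun h => hz.1.2 (ball_subset_closedBall h)⟩
      exact hd.differentiableAt (hopen.mem_nhds this))
  have hcirc : ∀ s, 0 < s → s < R → s ≠ ‖w - c‖ →
      (∮ z in C(c, s), dslope g w z)
        = (∮ z in C(c, s), (z - w)⁻¹ • g z) - (∮ z in C(c, s), (z - w)⁻¹) • g w := by
    intro s hs hsR hsw
    have hne : ∀ z ∈ Metric.sphere c s, z ≠ w := by
      rintro z hz rfl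
      exact hsw (mem_sphere_iff_norm.1 hz).symm
    have hinv : ContinuousOn (fun z : ℂ => (z - w)⁻¹) (Metric.sphere c s) :=
      ContinuousOn.inv₀ (by fun_prop) fun z hz => sub_ne_zero.2 (hne z hz)
    have hgc : ContinuousOn g (Metric.sphere c s) := hg.continuousOn.mono fun z hz =>
      ⟨sphere_subset_ball hsR hz, ne_of_mem_sphere hz hs.ne'⟩
    rw [← circleIntegral.integral_smul_const, ← circleIntegral.integral_sub
      (f := fun z => (z - w)⁻¹ • g z) (g := fun z => (z - w)⁻¹ • g w)
      (ContinuousOn.circleIntegrable hs.le (hinv.smul hgc))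
      (ContinuousOn.circleIntegrable hs.le (hinv.smul continuousOn_const))]
    refine circleIntegral.integral_congr hs.le fun z hz => ?_
    rw [dslope_of_ne _ (hne z hz), slope_def_module, smul_sub]
  rw [hcirc ρ (hr.trans_le hrρ) hρ hwρ.ne', hcirc r hr (hrρ.trans_lt hρ) hrw.ne,
    circleIntegral.integral_sub_inv_of_mem_ball (mem_ball_iff_norm.2 hwρ)] at hCG
  have hz : (∮ z in C(c, r), (z - w)⁻¹) = 0 := by
    have hne : ∀ z ∈ closedBall c r, z - w ≠ 0 := by
      intro z hz h
      rw [sub_eq_zero.1 h] at hz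
      exact absurd (mem_closedBall_iff_norm.1 hz) (not_le.2 hrw)
    refine Complex.circleIntegral_eq_zero_of_differentiable_on_off_countable hr.le
      countable_empty (ContinuousOn.inv₀ (by fun_prop) hne) fun z hz => ?_
    exact DifferentiableAt.inv (by fun_prop) (hne z (ball_subset_closedBall hz.1))
  rw [hz, zero_smul, sub_zero] at hCG
  rw [← hCG]
  abel

/-- The Cauchy integral over a circle, expanded outside of the circle. -/
theorem hasSum_circleIntegral_of_lt_norm {g : ℂ → E} {c w : ℂ} {r : ℝ} (hr : 0 < r)
    (hrw : r < ‖w - c‖) (hg : ContinuousOn g (Metric.sphere c r)) :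
    HasSum (fun n : ℕ => ∮ z in C(c, r), ((w - c) ^ (n + 1))⁻¹ • (z - c) ^ n • g z)
      (-∮ z in C(c, r), (z - w)⁻¹ • g z) := by
  have hw0 : 0 < ‖w - c‖ := hr.trans hrw
  have hwc : w - c ≠ 0 := norm_pos_iff.1 hw0
  have hnorm : ∀ z ∈ Metric.sphere c r, ‖z - c‖ = r := fun z hz => mem_sphere_iff_norm.1 hz
  obtain ⟨C, hC⟩ := (isCompact_sphere c r).exists_bound_of_continuousOn hg
  have hq : r / ‖w - c‖ < 1 := (div_lt_one hw0).2 hrw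
  have hint : -(∮ z in C(c, r), (z - w)⁻¹ • g z) = ∮ z in C(c, r), -((z - w)⁻¹ • g z) := by
    simp [circleIntegral, intervalIntegral.integral_neg]
  rw [hint]
  refine hasSum_circleIntegral_of_summable hr.le
    (b := fun n => (r / ‖w - c‖) ^ n * (‖w - c‖⁻¹ * C)) (fun n => ?_)
    ((summable_geometric_of_lt_one (by positivity) hq).mul_right _) (fun n z hz => ?_)
    fun z hz => ?_
  · fun_prop
  · rw [norm_smul, norm_smul, norm_inv, norm_pow, norm_pow, hnorm z hz, div_pow, pow_succ]
    have : ‖g z‖ ≤ C := hC z hz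
    calc (‖w - c‖ ^ n * ‖w - c‖)⁻¹ * (r ^ n * ‖g z‖)
        ≤ (‖w - c‖ ^ n * ‖w - c‖)⁻¹ * (r ^ n * C) := by gcongr
      _ = r ^ n / ‖w - c‖ ^ n * (‖w - c‖⁻¹ * C) := by field_simp
  · have hlt : ‖(z - c) / (w - c)‖ < 1 := by rw [norm_div, hnorm z hz]; exact hq
    have hs := ((hasSum_geometric_of_norm_lt_one hlt).mul_left (w - c)⁻¹).smul_const (g z)
    have hzw : z - w ≠ 0 := by
      intro h
      rw [sub_eq_zero.1 h] at hz
      exact hrw.ne (hnorm w hz).symm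
    have hwz : w - z ≠ 0 := by rwa [← neg_ne_zero, neg_sub]
    convert hs using 1
    · funext n
      rw [smul_smul, div_pow, pow_succ]
      congr 1
      field_simp
    · rw [← neg_smul]
      congr 1
      have : 1 - (z - c) / (w - c) = (w - z) / (w - c) := by field_simp; ring
      rw [this, inv_div, ← neg_sub w z, inv_neg, neg_neg]
      field_simp

/-- A function that is holomorphic in a punctured neighbourhood of `c` has a Laurent expansion at
`c`: by Cauchy's formula for an annulus it is the difference of a Cauchy integral over a large
circle, which gives the terms of degree `≥ 0`, and of one over a small circle, which gives the
others. -/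
theorem exists_hasLaurentAt [CompleteSpace E] {g : ℂ → E} {c : ℂ}
    (hg : ∀ᶠ z in 𝓝[≠] c, DifferentiableAt ℂ g z) : ∃ a, HasLaurentAt g c a := by
  obtain ⟨R, hR, h⟩ := eventually_nhdsNE_iff.1 hg
  have hd : DifferentiableOn ℂ g (ball c R \ {c}) := fun z hz =>
    (h z (norm_pos_iff.2 (sub_ne_zero.2 hz.2)) (mem_ball_iff_norm.1 hz.1)).differentiableWithinAt
  have hopen : IsOpen (ball c R \ {c}) := isOpen_ball.sdiff isClosed_singleton
  have hgc : ∀ s, 0 < s → s < R → ContinuousOn g (Metric.sphere c s) := fun s hs hsR =>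
    hd.continuousOn.mono fun z hz => ⟨sphere_subset_ball hsR hz, ne_of_mem_sphere hz hs.ne'⟩
  set a : ℤ → E := fun n =>
    (2 * Real.pi * I : ℂ)⁻¹ • ∮ z in C(c, R / 2), (z - c) ^ (-n - 1) • g z with ha
  -- the coefficients do not depend on the radius of the circle
  have hrad : ∀ (n : ℤ) (s : ℝ), 0 < s → s < R →
      (∮ z in C(c, s), (z - c) ^ (-n - 1) • g z) = (2 * Real.pi * I : ℂ) • a n := by
    intro n
    have key : ∀ s t : ℝ, 0 < s → s ≤ t → t < R →
        (∮ z in C(c, t), (z - c) ^ (-n - 1) • g z) = ∮ z in C(c, s), (z - c) ^ (-n - 1) • g z := by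
      intro s t hs hst ht
      have hdd : DifferentiableOn ℂ (fun z => (z - c) ^ (-n - 1) • g z) (ball c R \ {c}) :=
        DifferentiableOn.smul (fun z hz => ((by fun_prop : DifferentiableAt ℂ (fun z => z - c) z).zpow
          (Or.inl (sub_ne_zero.2 hz.2))).differentiableWithinAt) hd
      have hsub : closedBall c t \ ball c s ⊆ ball c R \ {c} := by
        rintro z ⟨h1, h2⟩
        refine ⟨closedBall_subset_ball ht h1, ?_⟩
        rintro rfl
        exact h2 (mem_ball_self hs)
      exact circleIntegral_eq_of_differentiable_on_annulus_off_countable hs hst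
        countable_empty (hdd.continuousOn.mono hsub) fun z hz =>
          hdd.differentiableAt (hopen.mem_nhds (hsub ⟨ball_subset_closedBall hz.1.1,
            fun h => hz.1.2 (ball_subset_closedBall h)⟩))
    intro s hs hsR
    rw [ha, smul_inv_smul₀ two_pi_I_ne_zero]
    rcases le_total s (R / 2) with hle | hle
    · exact (key s (R / 2) hs hle (by linarith)).symm
    · exact key (R / 2) s (by positivity) hle hsR
  refine ⟨a, eventually_nhdsNE_iff.2 ⟨R, hR, fun w hw0 hwR => ?_⟩⟩
  obtain ⟨r, hr, hrw⟩ := exists_between hw0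
  obtain ⟨ρ, hwρ, hρ⟩ := exists_between hwR
  have hρ0 := hw0.trans hwρ
  have hrR := hrw.trans hwR
  have hwc : w - c ≠ 0 := norm_pos_iff.1 hw0
  have hpos := hasSum_two_pi_I_cauchyPowerSeries_integral
    ((hgc ρ hρ0 hρ).circleIntegrable hρ0.le) hwρ
  have hneg := hasSum_circleIntegral_of_lt_norm hr hrw (hgc r hr hrR)
  have hposterm : ∀ n : ℕ, (∮ z in C(c, ρ), ((w - c) / (z - c)) ^ n • (z - c)⁻¹ • g z)
      = (2 * Real.pi * I : ℂ) • (w - c) ^ (n : ℤ) • a n := by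
    intro n
    rw [smul_comm, ← hrad n ρ hρ0 hρ, ← circleIntegral.integral_smul]
    refine circleIntegral.integral_congr hρ0.le fun z hz => ?_
    have hz0 : z - c ≠ 0 := sub_ne_zero.2 (ne_of_mem_sphere hz hρ0.ne')
    simp only [smul_smul]
    congr 1
    rw [zpow_sub₀ hz0, zpow_neg, zpow_one, zpow_natCast, zpow_natCast, div_pow]
    field_simp
  have hnegterm : ∀ n : ℕ, (∮ z in C(c, r), ((w - c) ^ (n + 1))⁻¹ • (z - c) ^ n • g z)
      = (2 * Real.pi * I : ℂ) • (w - c) ^ (-((n : ℤ) + 1)) • a (-((n : ℤ) + 1)) := by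
    intro n
    rw [smul_comm, ← hrad _ r hr hrR, ← circleIntegral.integral_smul]
    refine circleIntegral.integral_congr hr.le fun z hz => ?_
    have e1 : (w - c) ^ (-((n : ℤ) + 1)) = ((w - c) ^ (n + 1))⁻¹ := by
      rw [zpow_neg]; norm_cast
    have e2 : (z - c) ^ (-(-((n : ℤ) + 1)) - 1) = (z - c) ^ n := by
      rw [← zpow_natCast]; congr 1; ring
    simp only [e1, e2]
  simp only [hposterm] at hpos
  simp only [hnegterm] at hneg
  rw [add_sub_cancel] at hpos
  -- both families of terms belong to one series over `ℤ`, scaled by `2πi`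
  have hsum := HasSum.of_nat_of_neg_add_one (f := fun n : ℤ =>
    (2 * Real.pi * I : ℂ) • (w - c) ^ n • a n) hpos hneg
  rw [← sub_eq_add_neg, circleIntegral_annulus_sub hr hrw hwρ hρ hd] at hsum
  simpa only [inv_smul_smul₀ two_pi_I_ne_zero] using hsum.const_smul (2 * Real.pi * I : ℂ)⁻¹

end Laurent

/-! ### Poles and removable singularities of vector-valued functions -/

section Pole

open Complex

variable {E : Type*} [NormedAddCommGroup E] [NormedSpace ℂ E]

theorem PoleLE.mono {g : ℂ → E} {c : ℂ} {m n : ℕ} (h : PoleLE g c m) (hmn : m ≤ n) :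
    PoleLE g c n := by
  obtain ⟨k, rfl⟩ := Nat.exists_eq_add_of_le hmn
  have h1 : (fun z : ℂ => (z - c) ^ k) =O[𝓝[≠] c] (fun _ => (1 : ℝ)) := by
    have : Continuous fun z : ℂ => (z - c) ^ k := by fun_prop
    exact (this.continuousAt.tendsto.mono_left nhdsWithin_le_nhds).isBigO_one ℝ
  have := h1.smul h
  simp only [smul_eq_mul, mul_one] at this
  refine this.congr_left fun z => ?_
  rw [smul_smul, ← pow_add, add_comm]

/-- Riemann's theorem on removable singularities. -/
theorem exists_differentiableOn_extension [CompleteSpace E] {g : ℂ → E} {s : Set ℂ} {c : ℂ}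
    (hs : s ∈ 𝓝 c) (hd : DifferentiableOn ℂ g (s \ {c}))
    (hb : g =O[𝓝[≠] c] (fun _ => (1 : ℝ))) :
    ∃ G : ℂ → E, DifferentiableOn ℂ G s ∧ ∀ z, z ≠ c → G z = g z := by
  refine ⟨_, Complex.differentiableOn_update_limUnder_of_isLittleO hs hd
    (IsBoundedUnder.isLittleO_sub_self_inv ?_), fun z hz => Function.update_of_ne hz _ _⟩
  have h1 : (fun z => g z - g c) =O[𝓝[≠] c] (fun _ => (1 : ℝ)) :=
    hb.sub (Asymptotics.isBigO_const_const _ one_ne_zero _)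
  exact (Asymptotics.isBigO_one_iff ℝ).1 h1

/-- Boundedness of `(z - c) ^ m • g z` near `c` is the vanishing of the Laurent coefficients of `g`
in degrees below `-m`. -/
theorem HasLaurentAt.poleLE_iff [FiniteDimensional ℝ E] {g : ℂ → E} {c : ℂ} {a : ℤ → E}
    (ha : HasLaurentAt g c a) (hg : ∀ᶠ z in 𝓝[≠] c, DifferentiableAt ℂ g z) (m : ℕ) :
    PoleLE g c m ↔ ∀ k : ℕ, m < k → a (-(k : ℤ)) = 0 := by
  have : CompleteSpace E := FiniteDimensional.complete ℝ E
  constructor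
  · intro h k hk
    obtain ⟨R, hR, hdR⟩ := eventually_nhdsNE_iff.1 hg
    have hd : DifferentiableOn ℂ (fun z => (z - c) ^ m • g z) (Metric.ball c R \ {c}) := by
      intro z hz
      have := hdR z (norm_pos_iff.2 (sub_ne_zero.2 hz.2)) (mem_ball_iff_norm.1 hz.1)
      exact (DifferentiableAt.smul (by fun_prop) this).differentiableWithinAt
    obtain ⟨G, hG, hGe⟩ := exists_differentiableOn_extension (Metric.ball_mem_nhds c hR) hd h
    obtain ⟨p, hp⟩ := (hG.analyticAt (Metric.ball_mem_nhds c hR))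
    have hp' := (hasFPowerSeriesAt_iff').1 hp
    -- the Taylor series `p` of the extension of `(z - c) ^ m • g z`, shifted by `m`, is a Laurent
    -- series of `g`
    set b : ℤ → E := fun j => if 0 ≤ j + m then p.coeff (j + m).toNat else 0 with hb
    have hinj : Function.Injective fun n : ℕ => (n : ℤ) - m := fun x y h => by
      simpa using h
    have hL : HasLaurentAt g c b := by
      filter_upwards [hp'.filter_mono nhdsWithin_le_nhds, self_mem_nhdsWithin] with z hz hzc
      have hzc' : z - c ≠ 0 := sub_ne_zero.2 hzc
      rw [← hinj.hasSum_iff]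
      · rw [hGe z hzc] at hz
        have h2 := hz.const_smul ((z - c) ^ m)⁻¹
        rw [inv_smul_smul₀ (pow_ne_zero _ hzc')] at h2
        refine h2.congr_fun fun n => ?_
        simp only [Function.comp, hb, sub_add_cancel, Int.natCast_nonneg, if_true, Int.toNat_natCast,
          smul_smul]
        rw [zpow_sub₀ hzc', zpow_natCast, zpow_natCast, div_eq_inv_mul]
      · intro j hj
        rw [hb]
        simp only
        rw [if_neg, smul_zero]
        intro h0
        exact hj ⟨(j + m).toNat, by simp only; omega⟩
    rw [ha.unique hL, hb]
    simp only
    rw [if_neg (by omega)]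
  · intro h
    obtain ⟨R, hR, hs⟩ := eventually_nhdsNE_iff.1 ha
    set r := R / 2 with hr
    have hr0 : 0 < r := by positivity
    have hS := (hs (c + r) (by simp [hr0.ne']) (by simp [abs_of_pos hr0]; linarith)).summable.norm
    -- on a disc of radius `r`, the exponents `m + n ≥ 0` make the terms of the series at most those
    -- at `c + r`
    refine Asymptotics.IsBigO.of_bound (r ^ m * ∑' n : ℤ, ‖(c + r - c : ℂ) ^ n • a n‖) ?_
    refine eventually_nhdsNE_iff.2 ⟨r, hr0, fun z hz0 hzr => ?_⟩
    have hz := (hs z hz0 (by linarith)).const_smul ((z - c) ^ m)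
    rw [norm_one, mul_one]
    refine hz.norm_le_of_bounded (hS.hasSum.mul_left (r ^ m)) fun n => ?_
    rcases lt_or_ge n (-(m : ℤ)) with hn | hn
    · have := h n.natAbs (by omega)
      rw [show (-(n.natAbs : ℤ)) = n by omega] at this
      simp [this]
    · rw [add_sub_cancel_left, norm_smul, norm_smul, norm_smul, norm_pow, norm_zpow, norm_zpow,
        ← mul_assoc, ← mul_assoc, norm_real, Real.norm_eq_abs, abs_of_pos hr0]
      refine mul_le_mul_of_nonneg_right ?_ (norm_nonneg _)
      obtain ⟨k, hk⟩ := Int.eq_ofNat_of_zero_le (by omega : 0 ≤ (m : ℤ) + n)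
      rw [← zpow_natCast, ← zpow_natCast, ← zpow_add₀ hz0.ne', ← zpow_add₀ hr0.ne', hk,
        zpow_natCast, zpow_natCast]
      exact pow_le_pow_left₀ (norm_nonneg _) hzr.le k

end Pole

/-! ### Slices of the quadratic cone -/

section Cone

open ComplexConjugate

variable {A : Type*} [NormedNonAssocRing A] [NormedSpace ℝ A] [StarRing A]

variable (A) in
/-- The two properties of the algebra on which the analysis relies: left multiplication is
alternative, and the norm of `A` restricts to `√n(x)` on the quadratic cone. -/
structure AltNormed : Prop where
  left_alt : ∀ x y : A, (x * x) * y = x * (x * y)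
  norm_sq : ∀ x ∈ quadraticCone A, nm x = (‖x‖ ^ 2) • (1 : A)

theorem star_of_mem_unitSphere {I : A} (hI : I ∈ unitSphere A) : star I = -I :=
  eq_neg_of_add_eq_zero_right hI.1

theorem mul_self_of_mem_unitSphere {I : A} (hI : I ∈ unitSphere A) : I * I = -1 := by
  have h := hI.2
  rw [nm, star_of_mem_unitSphere hI, mul_neg] at h
  rw [← h, neg_neg]

theorem neg_mem_unitSphere {I : A} (hI : I ∈ unitSphere A) : -I ∈ unitSphere A := by
  refine ⟨?_, ?_⟩
  · rw [tr, star_neg, ← neg_add]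
    exact neg_eq_zero.2 hI.1
  · rw [nm, star_neg, neg_mul_neg]
    exact hI.2

/-- Left multiplication by an imaginary unit is a complex structure on `A`. -/
theorem mul_mul_self_of_mem_unitSphere (hA : AltNormed A) {I : A} (hI : I ∈ unitSphere A) (a : A) :
    I * (I * a) = -a := by
  rw [← hA.left_alt, mul_self_of_mem_unitSphere hI, neg_mul, one_mul]

theorem sl_neg (I : A) (z : ℂ) : sl (-I) z = sl I (conj z) := by
  simp [sl]

theorem sl_add (I : A) (z w : ℂ) : sl I (z + w) = sl I z + sl I w := by
  simp only [sl, Complex.add_re, Complex.add_im, add_smul]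
  abel

theorem sl_sub (I : A) (z w : ℂ) : sl I (z - w) = sl I z - sl I w := by
  simp only [sl, Complex.sub_re, Complex.sub_im, sub_smul]
  abel

theorem sl_zero (I : A) : sl I 0 = 0 := by simp [sl]

theorem sl_one (I : A) : sl I 1 = 1 := by simp [sl]

theorem sl_ofReal (I : A) (r : ℝ) : sl I r = r • (1 : A) := by simp [sl]

theorem continuous_sl (I : A) : Continuous (sl I) := by
  unfold sl
  exact (Complex.continuous_re.smul continuous_const).add
    (Complex.continuous_im.smul continuous_const)

variable [IsScalarTower ℝ A A] [SMulCommClass ℝ A A]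

theorem sl_mul {I : A} (hI : I ∈ unitSphere A) (z w : ℂ) :
    sl I (z * w) = sl I z * sl I w := by
  simp only [sl, add_mul, mul_add, smul_mul_assoc, mul_smul_comm, one_mul, mul_one,
    mul_self_of_mem_unitSphere hI, Complex.mul_re, Complex.mul_im]
  module

theorem sl_mul_mul (hA : AltNormed A) {I : A} (hI : I ∈ unitSphere A) (z w : ℂ) (a : A) :
    sl I z * (sl I w * a) = sl I (z * w) * a := by
  simp only [sl, add_mul, mul_add, smul_mul_assoc, mul_smul_comm, one_mul,
    mul_mul_self_of_mem_unitSphere hA hI, Complex.mul_re, Complex.mul_im]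
  module

theorem apow_sl {I : A} (hI : I ∈ unitSphere A) (z : ℂ) (k : ℕ) :
    apow (sl I z) k = sl I (z ^ k) := by
  induction k with
  | zero => simp [apow, sl_one]
  | succ k ih => rw [apow, ih, ← sl_mul hI, pow_succ']

theorem exists_norm_mul_le [FiniteDimensional ℝ A] :
    ∃ C : ℝ, 0 < C ∧ ∀ x y : A, ‖x * y‖ ≤ C * ‖x‖ * ‖y‖ := by
  set B := (LinearMap.mul ℝ A).toContinuousBilinearMap
  refine ⟨‖B‖ + 1, by positivity, fun x y => ?_⟩
  have h : ‖x * y‖ ≤ ‖B‖ * ‖x‖ * ‖y‖ := B.le_opNorm₂ x y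
  refine h.trans ?_
  gcongr
  linarith

theorem continuous_mul_of_finiteDimensional [FiniteDimensional ℝ A] :
    Continuous fun p : A × A => p.1 * p.2 :=
  (LinearMap.mul ℝ A).toContinuousBilinearMap.continuous₂

variable [StarModule ℝ A]

theorem star_sl {I : A} (hI : I ∈ unitSphere A) (z : ℂ) : star (sl I z) = sl I (conj z) := by
  simp [sl, star_of_mem_unitSphere hI]

theorem tr_sl {I : A} (hI : I ∈ unitSphere A) (z : ℂ) :
    tr (sl I z) = (2 * z.re) • (1 : A) := by
  rw [tr, star_sl hI, ← sl_add, Complex.add_conj]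
  simp only [sl]
  simp

theorem nm_sl {I : A} (hI : I ∈ unitSphere A) (z : ℂ) :
    nm (sl I z) = (Complex.normSq z) • (1 : A) := by
  rw [nm, star_sl hI, ← sl_mul hI, Complex.mul_conj, sl_ofReal]

theorem sl_mem_quadraticCone {I : A} (hI : I ∈ unitSphere A) (z : ℂ) :
    sl I z ∈ quadraticCone A := by
  by_cases h : z.im = 0
  · exact Or.inl ⟨z.re, by simp [sl, h]⟩
  · refine Or.inr ⟨_, _, tr_sl hI z, nm_sl hI z, ?_⟩
    rw [Complex.normSq_apply]
    have := mul_self_pos.2 h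
    nlinarith

theorem norm_sl [Nontrivial A] (hA : AltNormed A) {I : A} (hI : I ∈ unitSphere A) (z : ℂ) :
    ‖sl I z‖ = ‖z‖ := by
  have h := hA.norm_sq _ (sl_mem_quadraticCone hI z)
  rw [nm_sl hI] at h
  have h2 := smul_left_injective ℝ (one_ne_zero (α := A)) h
  rw [Complex.normSq_eq_norm_sq] at h2
  exact ((pow_left_inj₀ (norm_nonneg _) (norm_nonneg _) two_ne_zero).1 h2).symm

theorem norm_of_mem_unitSphere [Nontrivial A] (hA : AltNormed A) {I : A} (hI : I ∈ unitSphere A) :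
    ‖I‖ = 1 := by
  have := norm_sl hA hI Complex.I
  simpa [sl] using this

/-- The quadratic cone is the union of the slices: when `t = t(x)` and `n = n(x)` are real with
`t² < 4 n`, the element `x - t / 2` is `√(n - t² / 4)` times an imaginary unit. -/
theorem exists_sl_of_mem_quadraticCone (hne : (unitSphere A).Nonempty) {x : A}
    (hx : x ∈ quadraticCone A) : ∃ K ∈ unitSphere A, ∃ z : ℂ, x = sl K z := by
  rcases hx with ⟨r, rfl⟩ | ⟨t, n, ht, hn, htn⟩
  · obtain ⟨K, hK⟩ := hne
    exact ⟨K, hK, r, (sl_ofReal K r).symm⟩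
  · have hstar : star x = t • (1 : A) - x := by rw [← ht, tr]; abel
    have hxx : x * x = t • x - n • (1 : A) := by
      rw [← hn, nm, hstar, mul_sub, mul_smul_comm, mul_one]; abel
    have hD : 0 < n - t ^ 2 / 4 := by linarith
    set s := Real.sqrt (n - t ^ 2 / 4) with hs
    have hs0 : s ≠ 0 := (Real.sqrt_pos.2 hD).ne'
    have hss : s * s = n - t ^ 2 / 4 := Real.mul_self_sqrt hD.le
    have hstarK : star (s⁻¹ • (x - (t / 2) • (1 : A))) = -(s⁻¹ • (x - (t / 2) • (1 : A))) := by
      rw [star_smul, star_sub, star_smul, star_one, hstar]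
      simp only [star_trivial]
      module
    refine ⟨s⁻¹ • (x - (t / 2) • (1 : A)), ⟨?_, ?_⟩, ⟨t / 2, s⟩, ?_⟩
    · rw [tr, hstarK, add_neg_cancel]
    · rw [nm, hstarK]
      simp only [mul_neg, smul_mul_assoc, mul_smul_comm, sub_mul, mul_sub, one_mul, mul_one, hxx]
      have : (s * s) • (s⁻¹ • s⁻¹ • (1 : A)) = 1 := by
        rw [smul_smul, smul_smul]
        have : s * s * s⁻¹ * s⁻¹ = 1 := by field_simp
        rw [this, one_smul]
      rw [hss] at this
      refine Eq.trans ?_ this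
      module
    · simp only [sl]
      rw [smul_inv_smul₀ hs0]
      abel

variable [Nontrivial A]

theorem realOf_tr_sl {I : A} (hI : I ∈ unitSphere A) (z : ℂ) : realOf (tr (sl I z)) = 2 * z.re := by
  rw [tr_sl hI, realOf_smul_one]

theorem realOf_nm_sl {I : A} (hI : I ∈ unitSphere A) (z : ℂ) :
    realOf (nm (sl I z)) = Complex.normSq z := by
  rw [nm_sl hI, realOf_smul_one]

theorem deltaStem_sl {I : A} (hI : I ∈ unitSphere A) (z₀ z : ℂ) :
    deltaStem (sl I z₀) z = (z - z₀) * (z - conj z₀) := by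
  rw [deltaStem, realOf_tr_sl hI, realOf_nm_sl hI, ← Complex.mul_conj]
  have : ((2 * z₀.re : ℝ) : ℂ) = z₀ + conj z₀ := by rw [Complex.add_conj]
  rw [this]
  ring

theorem Delta_sl {I K : A} (hI : I ∈ unitSphere A) (hK : K ∈ unitSphere A) (z₀ z : ℂ) :
    Delta (sl I z₀) (sl K z) = sl K ((z - z₀) * (z - conj z₀)) := by
  have : (z - z₀) * (z - conj z₀) = z * z - z * ((2 * z₀.re : ℝ) : ℂ)
      + ((Complex.normSq z₀ : ℝ) : ℂ) := by
    rw [← Complex.mul_conj, ← Complex.add_conj]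
    ring
  rw [this, Delta, tr_sl hI, nm_sl hI, sl_add, sl_sub, sl_mul hK, sl_mul hK, sl_ofReal, sl_ofReal]

/-- A point of the cone determines its coordinates `(K, z)` up to simultaneous conjugation, and up
to the choice of `K` on the real line. -/
theorem sl_eq_sl (hA : AltNormed A) {I K : A} (hI : I ∈ unitSphere A) (hK : K ∈ unitSphere A)
    {z w : ℂ} (h : sl I z = sl K w) :
    (w = z ∧ (z.im ≠ 0 → K = I)) ∨ (w = conj z ∧ (z.im ≠ 0 → K = -I)) := by
  have hre : z.re = w.re := by
    have := congrArg tr h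
    rw [tr_sl hI, tr_sl hK] at this
    have := smul_left_injective ℝ (one_ne_zero (α := A)) this
    linarith
  have him : z.im • I = w.im • K := by
    simp only [sl, hre] at h
    exact add_left_cancel h
  have habs : |z.im| = |w.im| := by
    have := congrArg norm him
    rwa [norm_smul, norm_smul, norm_of_mem_unitSphere hA hI, norm_of_mem_unitSphere hA hK, mul_one,
      mul_one] at this
  rcases abs_eq_abs.1 habs with h1 | h1
  · refine Or.inl ⟨Complex.ext hre.symm h1.symm, fun h0 => ?_⟩
    rw [← h1] at him
    exact (smul_right_injective A h0 him).symm
  · refine Or.inr ⟨Complex.ext (by simp [hre]) (by simp [h1]), fun h0 => ?_⟩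
    rw [show w.im = -z.im by rw [h1, neg_neg], neg_smul, ← smul_neg] at him
    rw [smul_right_injective A h0 him, neg_neg]

theorem sl_injective (hA : AltNormed A) {I : A} (hI : I ∈ unitSphere A) :
    Function.Injective (sl I) := by
  intro z w h
  have := norm_sl hA hI (z - w)
  rw [sl_sub, h, sub_self, norm_zero] at this
  exact sub_eq_zero.1 (norm_eq_zero.1 this.symm)

/-- The sphere through `sl J z₀` meets each half slice in exactly one point. -/
theorem mem_sphere_sl_iff (hA : AltNormed A) {J : A} (hJ : J ∈ unitSphere A) {z₀ : ℂ} {w : A} :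
    w ∈ sphere (sl J z₀) ↔ ∃ I ∈ unitSphere A, w = sl I z₀ := by
  constructor
  · rintro ⟨z, K, hK, I, hI, h1, rfl⟩
    rcases sl_eq_sl hA hJ hK h1 with ⟨rfl, -⟩ | ⟨rfl, -⟩
    · exact ⟨I, hI, rfl⟩
    · exact ⟨-I, neg_mem_unitSphere hI, (sl_neg I z₀).symm⟩
  · rintro ⟨I, hI, rfl⟩
    exact ⟨z₀, J, hJ, I, hI, rfl, rfl⟩

theorem sl_mem_sphere_iff (hA : AltNormed A) {J K : A} (hJ : J ∈ unitSphere A)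
    (hK : K ∈ unitSphere A) {z₀ z : ℂ} : sl K z ∈ sphere (sl J z₀) ↔ z = z₀ ∨ z = conj z₀ := by
  rw [mem_sphere_sl_iff hA hJ]
  constructor
  · rintro ⟨I, hI, h⟩
    rcases sl_eq_sl hA hI hK h.symm with ⟨h, -⟩ | ⟨h, -⟩
    · exact Or.inl h
    · exact Or.inr h
  · rintro (rfl | rfl)
    · exact ⟨K, hK, rfl⟩
    · exact ⟨-K, neg_mem_unitSphere hK, (sl_neg K z₀).symm⟩

theorem rePart_sl {I : A} (hI : I ∈ unitSphere A) (z : ℂ) : rePart (sl I z) = z.re • (1 : A) := by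
  have := tr_sl hI z
  rw [tr] at this
  rw [rePart, this, smul_smul]
  congr 1
  ring

theorem imPart_sl {I : A} (hI : I ∈ unitSphere A) (z : ℂ) : imPart (sl I z) = z.im • I := by
  rw [imPart, star_sl hI, ← sl_sub]
  simp only [sl, Complex.sub_re, Complex.conj_re, sub_self, zero_smul, zero_add, Complex.sub_im,
    Complex.conj_im, smul_smul]
  congr 1
  ring

theorem norm_imPart_sl (hA : AltNormed A) {I : A} (hI : I ∈ unitSphere A) (z : ℂ) :
    ‖imPart (sl I z)‖ = |z.im| := by
  rw [imPart_sl hI, norm_smul, norm_of_mem_unitSphere hA hI, mul_one, Real.norm_eq_abs]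

end Cone

/-! ### The complexified algebra as a complex vector space -/

section Coord

open ComplexConjugate

variable {A : Type*} [NormedNonAssocRing A] [NormedSpace ℝ A]

variable (A) in
/-- The complex vector space underlying `A_ℂ = A ⊕ ι A`, in coordinates with respect to a real basis
of `A`.  Coordinates provide a complex norm, which `A × A` does not carry. -/
abbrev Coord : Type := Fin (Module.finrank ℝ A) → ℂ

variable [FiniteDimensional ℝ A]

variable (A) in
/-- The identification of `A_ℂ` with its space of coordinates. -/
def toCoord : (A × A) ≃L[ℝ] Coord A :=
  LinearEquiv.toContinuousLinearEquiv
    { toFun := fun p i => ⟨(Module.finBasis ℝ A).equivFun p.1 i, (Module.finBasis ℝ A).equivFun p.2 i⟩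
      map_add' := fun p q => by
        funext i
        apply Complex.ext <;> simp
      map_smul' := fun r p => by
        funext i
        apply Complex.ext <;> simp
      invFun := fun e => ((Module.finBasis ℝ A).equivFun.symm fun i => (e i).re,
        (Module.finBasis ℝ A).equivFun.symm fun i => (e i).im)
      left_inv := fun p => by
        apply Prod.ext
        · exact (Module.finBasis ℝ A).equivFun.symm_apply_apply p.1
        · exact (Module.finBasis ℝ A).equivFun.symm_apply_apply p.2
      right_inv := fun e => by
        funext i
        apply Complex.ext <;> simp only [LinearEquiv.apply_symm_apply] }

theorem eq_zero_of_neg_eq_self {a : A} (h : -a = a) : a = 0 := by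
  have h2 : (2 : ℝ) • a = 0 := by
    rw [two_smul]
    nth_rewrite 1 [← h]
    exact neg_add_cancel a
  exact (smul_eq_zero.1 h2).resolve_left two_ne_zero

theorem toCoord_apply (p : A × A) (i : Fin (Module.finrank ℝ A)) :
    toCoord A p i = ⟨(Module.finBasis ℝ A).equivFun p.1 i, (Module.finBasis ℝ A).equivFun p.2 i⟩ :=
  rfl

theorem toCoord_conj (p : A × A) : toCoord A (p.1, -p.2) = star (toCoord A p) := by
  funext i
  rw [Pi.star_apply, toCoord_apply, toCoord_apply, map_neg]
  apply Complex.ext <;> simp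

variable [IsScalarTower ℝ A A] [SMulCommClass ℝ A A]

theorem cmul_ofC (w : ℂ) (p : A × A) :
    cmul (ofC w) p = (w.re • p.1 - w.im • p.2, w.re • p.2 + w.im • p.1) := by
  simp only [cmul, ofC, smul_mul_assoc, one_mul]

theorem toCoord_cmul_ofC (w : ℂ) (p : A × A) : toCoord A (cmul (ofC w) p) = w • toCoord A p := by
  funext i
  rw [cmul_ofC, Pi.smul_apply, toCoord_apply, toCoord_apply]
  apply Complex.ext
  · simp
  · simp

/-- Evaluation `p + ι q ↦ p + I q` in coordinates. -/
def evC (I : A) : Coord A →L[ℝ] A :=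
  LinearMap.toContinuousLinearMap
    ((LinearMap.fst ℝ A A + (LinearMap.mulLeft ℝ I).comp (LinearMap.snd ℝ A A)).comp
      (toCoord A).symm.toLinearEquiv.toLinearMap)

theorem evC_toCoord (I : A) (p : A × A) : evC I (toCoord A p) = ev I p := by
  have : evC I (toCoord A p) = ev I ((toCoord A).symm (toCoord A p)) := rfl
  rw [this, ContinuousLinearEquiv.symm_apply_apply]

/-- The real-linear map `a ↦ e a`, where `e = (1 - ι I) / 2` is the idempotent of `A_ℂ` whose image
is the complex subspace on which multiplication by `ι` is multiplication by `I`. -/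
def embC (I : A) : A →L[ℝ] Coord A :=
  LinearMap.toContinuousLinearMap
    ((toCoord A).toLinearEquiv.toLinearMap.comp
      (LinearMap.prod ((1 / 2 : ℝ) • LinearMap.id) (-(1 / 2 : ℝ) • LinearMap.mulLeft ℝ I)))

theorem embC_apply (I a : A) : embC I a = toCoord A ((1 / 2 : ℝ) • a, -(1 / 2 : ℝ) • (I * a)) := rfl

theorem evC_star (I : A) (e : Coord A) : evC I (star e) = evC (-I) e := by
  obtain ⟨p, rfl⟩ := (toCoord A).surjective e
  rw [← toCoord_conj, evC_toCoord, evC_toCoord]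
  simp [ev]

theorem evC_eq_of_star_eq {e : Coord A} (he : star e = e) (I K : A) : evC I e = evC K e := by
  obtain ⟨p, rfl⟩ := (toCoord A).surjective e
  rw [← toCoord_conj] at he
  have h := congrArg Prod.snd ((toCoord A).injective he)
  have h0 : p.2 = 0 := eq_zero_of_neg_eq_self h
  rw [evC_toCoord, evC_toCoord]
  simp [ev, h0]

theorem exists_toCoord_real {e : Coord A} (he : star e = e) : ∃ a : A, e = toCoord A (a, 0) := by
  obtain ⟨p, rfl⟩ := (toCoord A).surjective e
  rw [← toCoord_conj] at he
  have h := congrArg Prod.snd ((toCoord A).injective he)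
  have h0 : p.2 = 0 := eq_zero_of_neg_eq_self h
  exact ⟨p.1, by rw [← h0]⟩

variable [StarRing A]

theorem evC_smul (hA : AltNormed A) {I : A} (hI : I ∈ unitSphere A) (w : ℂ) (e : Coord A) :
    evC I (w • e) = sl I w * evC I e := by
  obtain ⟨p, rfl⟩ := (toCoord A).surjective e
  rw [← toCoord_cmul_ofC, evC_toCoord, evC_toCoord, cmul_ofC]
  simp only [ev, sl, mul_add, add_mul, smul_mul_assoc, mul_smul_comm, one_mul,
    mul_mul_self_of_mem_unitSphere hA hI]
  module

theorem evC_embC (hA : AltNormed A) {I : A} (hI : I ∈ unitSphere A) (a : A) :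
    evC I (embC I a) = a := by
  rw [embC_apply, evC_toCoord]
  simp only [ev, mul_smul_comm, mul_mul_self_of_mem_unitSphere hA hI]
  module

theorem embC_sl_mul (hA : AltNormed A) {I : A} (hI : I ∈ unitSphere A) (w : ℂ) (a : A) :
    embC I (sl I w * a) = w • embC I a := by
  rw [embC_apply, embC_apply, ← toCoord_cmul_ofC, cmul_ofC]
  congr 2
  · simp only [sl, add_mul, smul_mul_assoc, one_mul]
    module
  · simp only [sl, mul_add, add_mul, smul_mul_assoc, mul_smul_comm, one_mul,
      mul_mul_self_of_mem_unitSphere hA hI]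
    module

/-- The decomposition of `A_ℂ` under the complementary idempotents `(1 ∓ ι I) / 2`. -/
theorem embC_evC_add (hA : AltNormed A) {I : A} (hI : I ∈ unitSphere A) (e : Coord A) :
    embC I (evC I e) + embC (-I) (evC (-I) e) = e := by
  obtain ⟨p, rfl⟩ := (toCoord A).surjective e
  rw [evC_toCoord, evC_toCoord, embC_apply, embC_apply, ← map_add]
  congr 1
  apply Prod.ext
  · simp only [ev, neg_mul, Prod.fst_add]
    module
  · simp only [ev, mul_add, neg_mul, mul_neg, neg_neg, Prod.snd_add,
      mul_mul_self_of_mem_unitSphere hA hI]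
    module

theorem evC_eq_zero_iff (hA : AltNormed A) {I : A} (hI : I ∈ unitSphere A) (e : Coord A) :
    (evC I e = 0 ∧ evC (-I) e = 0) ↔ e = 0 := by
  constructor
  · rintro ⟨h1, h2⟩
    rw [← embC_evC_add hA hI e, h1, h2, map_zero, map_zero, add_zero]
  · rintro rfl
    simp

/-- The projection `e ↦ embC I (evC I e)` onto the image of the idempotent `(1 - ι I) / 2` is
complex-linear. -/
theorem exists_projection (hA : AltNormed A) {I : A} (hI : I ∈ unitSphere A) :
    ∃ L : Coord A →L[ℂ] Coord A, ∀ e, L e = embC I (evC I e) := by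
  refine ⟨LinearMap.toContinuousLinearMap
    { toFun := fun e => embC I (evC I e)
      map_add' := fun x y => by rw [map_add, map_add]
      map_smul' := fun w e => ?_ }, fun e => rfl⟩
  rw [evC_smul hA hI, embC_sl_mul hA hI, RingHom.id_apply]

/-- `evC I ∘ F` has at worst a pole of order `m` at `c`, for the complex structure of `A` given by
left multiplication by `I`. -/
def SlicePoleLE (F : ℂ → Coord A) (I : A) (c : ℂ) (m : ℕ) : Prop :=
  (fun z => evC I ((z - c) ^ m • F z)) =O[𝓝[≠] c] (fun _ => (1 : ℝ))

theorem slicePoleLE_iff (hA : AltNormed A) {I : A} (hI : I ∈ unitSphere A) {F : ℂ → Coord A} {c : ℂ}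
    {m : ℕ} : SlicePoleLE F I c m ↔ PoleLE (fun z => embC I (evC I (F z))) c m := by
  have e1 : ∀ z, (z - c) ^ m • embC I (evC I (F z)) = embC I (evC I ((z - c) ^ m • F z)) :=
    fun z => by rw [evC_smul hA hI, embC_sl_mul hA hI]
  unfold SlicePoleLE PoleLE
  constructor
  · intro h
    exact (((embC I).isBigO_comp _ _).trans h).congr_left fun z => (e1 z).symm
  · intro h
    refine (((evC I).isBigO_comp _ _).trans h).congr_left fun z => ?_
    rw [e1, evC_embC hA hI]

/-- The decomposition of `A_ℂ` by the idempotents `(1 ∓ ι I) / 2` splits the pole of `F` at `c` into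
the poles of `evC I ∘ F` and of `evC (-I) ∘ F`. -/
theorem poleLE_iff_slicePoleLE (hA : AltNormed A) {I : A} (hI : I ∈ unitSphere A)
    {F : ℂ → Coord A} {c : ℂ} {m : ℕ} :
    PoleLE F c m ↔ SlicePoleLE F I c m ∧ SlicePoleLE F (-I) c m := by
  constructor
  · intro h
    exact ⟨((evC I).isBigO_comp _ _).trans h, ((evC (-I)).isBigO_comp _ _).trans h⟩
  · rintro ⟨h1, h2⟩
    have := (((embC I).isBigO_comp _ _).trans h1).add (((embC (-I)).isBigO_comp _ _).trans h2)
    refine this.congr_left fun z => ?_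
    rw [embC_evC_add hA hI]

theorem SlicePoleLE.mono (hA : AltNormed A) {I : A} (hI : I ∈ unitSphere A) {F : ℂ → Coord A}
    {c : ℂ} {m n : ℕ} (h : SlicePoleLE F I c m) (hmn : m ≤ n) : SlicePoleLE F I c n :=
  (slicePoleLE_iff hA hI).2 (((slicePoleLE_iff hA hI).1 h).mono hmn)

end Coord

/-! ### Holomorphic stem functions and slice regular functions -/

section Stem

open ComplexConjugate

variable {A : Type*} [NormedNonAssocRing A] [NormedSpace ℝ A] [FiniteDimensional ℝ A]
  [IsScalarTower ℝ A A] [SMulCommClass ℝ A A] [StarRing A] [StarModule ℝ A] [Nontrivial A]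

/-- `F` is a holomorphic stem function on the open set `D`, in coordinates, and it induces `f`. -/
structure IsHolStem (D : Set ℂ) (F : ℂ → Coord A) (f : A → A) : Prop where
  isOpen : IsOpen D
  conj_mem : ConjInvariant D
  differentiableOn : DifferentiableOn ℂ F D
  map_conj : ∀ z ∈ D, F (conj z) = star (F z)
  induced : ∀ z ∈ D, ∀ I ∈ unitSphere A, f (sl I z) = evC I (F z)

theorem conj_mem_iff {D : Set ℂ} (hD : ConjInvariant D) {z : ℂ} : conj z ∈ D ↔ z ∈ D :=
  ⟨fun h => by simpa using hD _ h, hD z⟩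

theorem sl_mem_circularization_iff (hA : AltNormed A) {D : Set ℂ} (hD : ConjInvariant D) {I : A}
    (hI : I ∈ unitSphere A) {z : ℂ} : sl I z ∈ circularization (A := A) D ↔ z ∈ D := by
  constructor
  · rintro ⟨w, hw, K, hK, h⟩
    rcases sl_eq_sl hA hI hK h with ⟨rfl, -⟩ | ⟨rfl, -⟩
    · exact hw
    · exact (conj_mem_iff hD).1 hw
  · exact fun h => ⟨z, h, I, hI, rfl⟩

/-- A slice intersects an open circular set in an open subset of `ℂ`. -/
theorem isOpen_of_isOpenInCone (hA : AltNormed A) {D : Set ℂ} (hD : ConjInvariant D)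
    (hΩ : IsOpenInCone (circularization (A := A) D)) {I : A} (hI : I ∈ unitSphere A) : IsOpen D := by
  obtain ⟨U, hU, h⟩ := hΩ
  have : D = sl I ⁻¹' U := by
    ext z
    rw [← sl_mem_circularization_iff hA hD hI, h]
    exact ⟨fun h => h.1, fun h => ⟨h, sl_mem_quadraticCone hI z⟩⟩
  rw [this]
  exact hU.preimage (continuous_sl I)

/-- On an open set, the Cauchy-Riemann condition is holomorphy in the coordinates of `A_ℂ`. -/
theorem differentiableOn_toCoord_iff {D : Set ℂ} (hD : IsOpen D) (F : ℂ → A × A) :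
    (ContDiffOn ℝ 1 F D ∧ CauchyRiemannOn D F) ↔
      DifferentiableOn ℂ (fun z => toCoord A (F z)) D := by
  have hιmul : ∀ p : A × A, Complex.I • toCoord A p = toCoord A (-p.2, p.1) := fun p => by
    rw [← toCoord_cmul_ofC, cmul_ofC]
    simp
  have hfd : ∀ z v, DifferentiableAt ℝ F z →
      fderiv ℝ (fun z => toCoord A (F z)) z v = toCoord A (fderiv ℝ F z v) := by
    intro z v h
    have := ((toCoord A).hasFDerivAt.comp z h.hasFDerivAt).fderiv
    exact congrArg (fun L : ℂ →L[ℝ] Coord A => L v) this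
  constructor
  · rintro ⟨hF, hCR⟩ z hz
    have hd : DifferentiableAt ℝ F z :=
      ((hF.differentiableOn one_ne_zero) z hz).differentiableAt (hD.mem_nhds hz)
    refine (differentiableAt_complex_iff_differentiableAt_real.2
      ⟨(toCoord A).differentiableAt.comp z hd, ?_⟩).differentiableWithinAt
    change fderiv ℝ (fun z => toCoord A (F z)) z _ = _ • fderiv ℝ (fun z => toCoord A (F z)) z _
    rw [hfd z _ hd, hfd z _ hd, hιmul]
    congr 1
    obtain ⟨h1, h2⟩ := hCR z hz
    apply Prod.ext
    · simp [h2]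
    · simp [h1]
  · intro h
    have hreal : ContDiffOn ℝ 1 (fun z => toCoord A (F z)) D :=
      (h.contDiffOn hD).restrict_scalars ℝ
    have hF : ContDiffOn ℝ 1 F D := by
      have := (toCoord A).symm.contDiff.comp_contDiffOn hreal
      simpa [Function.comp_def] using this
    refine ⟨hF, fun z hz => ?_⟩
    have hd : DifferentiableAt ℝ F z :=
      ((hF.differentiableOn one_ne_zero) z hz).differentiableAt (hD.mem_nhds hz)
    have := (differentiableAt_complex_iff_differentiableAt_real.1
      ((h z hz).differentiableAt (hD.mem_nhds hz))).2
    rw [hfd z _ hd, hfd z _ hd, hιmul] at this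
    have := (toCoord A).injective this
    constructor
    · rw [this]
    · rw [this, neg_neg]

/-- The domain of the stem function is determined by the domain of the slice function. -/
theorem SliceRegularOn.exists_isHolStem (hA : AltNormed A) {Ω : Set A} {f : A → A}
    (hf : SliceRegularOn Ω f) {J : A} (hJ : J ∈ unitSphere A) :
    ∃ F : ℂ → Coord A, IsHolStem {z | sl J z ∈ Ω} F f := by
  obtain ⟨hΩ, D, -, hD, rfl, F, hst, hC, hCR, hind⟩ := hf
  have hDJ : {z | sl J z ∈ circularization (A := A) D} = D :=
    Set.ext fun z => sl_mem_circularization_iff hA hD hJ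
  have hopen := isOpen_of_isOpenInCone hA hD hΩ hJ
  rw [hDJ]
  refine ⟨fun z => toCoord A (F z), hopen, hD,
    (differentiableOn_toCoord_iff hopen F).1 ⟨hC, hCR⟩, fun z hz => ?_, fun z hz I hI => ?_⟩
  · obtain ⟨h1, h2⟩ := hst z hz
    rw [← toCoord_conj]
    congr 1
    exact Prod.ext h1 h2
  · rw [evC_toCoord]
    exact hind z hz I hI

theorem IsHolStem.sliceRegularOn {D : Set ℂ} {F : ℂ → Coord A} {f : A → A} (h : IsHolStem D F f)
    (hne : D.Nonempty) (hΩ : IsOpenInCone (circularization (A := A) D)) :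
    SliceRegularOn (circularization D) f := by
  refine ⟨hΩ, D, hne, h.conj_mem, rfl, fun z => (toCoord A).symm (F z), fun z hz => ?_, ?_⟩
  · have h1 : (toCoord A).symm (F (conj z)) =
        (((toCoord A).symm (F z)).1, -((toCoord A).symm (F z)).2) := by
      apply (toCoord A).injective
      rw [toCoord_conj, ContinuousLinearEquiv.apply_symm_apply,
        ContinuousLinearEquiv.apply_symm_apply, h.map_conj z hz]
    beta_reduce
    rw [h1]
    exact ⟨rfl, rfl⟩
  · have h2 := (differentiableOn_toCoord_iff h.isOpen (fun z => (toCoord A).symm (F z))).2 (by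
      simpa using h.differentiableOn)
    refine ⟨h2.1, h2.2, fun z hz I hI => ?_⟩
    rw [h.induced z hz I hI, ← evC_toCoord, ContinuousLinearEquiv.apply_symm_apply]

/-- Every function on `D` with the symmetry of a stem function induces a slice function. -/
theorem exists_induced (hA : AltNormed A) {D : Set ℂ} {G : ℂ → Coord A}
    (hG : ∀ z ∈ D, G (conj z) = star (G z)) :
    ∃ g : A → A, ∀ z ∈ D, ∀ I ∈ unitSphere A, g (sl I z) = evC I (G z) := by
  classical
  have hwd : ∀ z ∈ D, ∀ I ∈ unitSphere A, ∀ w, ∀ K ∈ unitSphere A, sl I z = sl K w →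
      evC K (G w) = evC I (G z) := by
    intro z hz I hI w K hK h
    rcases sl_eq_sl hA hI hK h with ⟨rfl, h2⟩ | ⟨rfl, h2⟩
    · by_cases him : w.im = 0
      · have hc : conj w = w := Complex.conj_eq_iff_im.2 him
        have := hG w hz
        rw [hc] at this
        exact evC_eq_of_star_eq this.symm K I
      · rw [h2 him]
    · by_cases him : z.im = 0
      · have hc : conj z = z := Complex.conj_eq_iff_im.2 him
        have := hG z hz
        rw [hc] at this ⊢
        exact evC_eq_of_star_eq this.symm K I
      · rw [h2 him, hG z hz, evC_star, neg_neg]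
  refine ⟨fun x => if h : ∃ p : ℂ × A, p.1 ∈ D ∧ p.2 ∈ unitSphere A ∧ x = sl p.2 p.1 then
    evC h.choose.2 (G h.choose.1) else 0, fun z hz I hI => ?_⟩
  have h : ∃ p : ℂ × A, p.1 ∈ D ∧ p.2 ∈ unitSphere A ∧ sl I z = sl p.2 p.1 := ⟨(z, I), hz, hI, rfl⟩
  refine (dif_pos h).trans ?_
  exact hwd z hz I hI _ _ h.choose_spec.2.1 h.choose_spec.2.2

end Stem

/-! ### Slice powers and shells -/

section Powers

open ComplexConjugate

variable {A : Type*} [NormedNonAssocRing A] [NormedSpace ℝ A] [FiniteDimensional ℝ A]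
  [IsScalarTower ℝ A A] [SMulCommClass ℝ A A] [StarRing A] [StarModule ℝ A] [Nontrivial A]

theorem cmul_sl {I : A} (hI : I ∈ unitSphere A) (a b c d : ℂ) :
    cmul (sl I a, sl I b) (sl I c, sl I d) = (sl I (a * c - b * d), sl I (a * d + b * c)) := by
  simp only [cmul, sl_sub, sl_add, sl_mul hI]

/-- Powers of an element `a + ι b` of `ℂ_I ⊗ ℂ ≅ ℂ × ℂ`, described through the two characters
`a + ι b ↦ a ± i b`. -/
theorem exists_cpow_sl {I : A} (hI : I ∈ unitSphere A) (a b : ℂ) (k : ℕ) :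
    ∃ c d : ℂ, cpow (sl I a, sl I b) k = (sl I c, sl I d) ∧
      c + Complex.I * d = (a + Complex.I * b) ^ k ∧
      c - Complex.I * d = (a - Complex.I * b) ^ k := by
  induction k with
  | zero => exact ⟨1, 0, by simp [cpow, sl_one, sl_zero], by simp, by simp⟩
  | succ k ih =>
    obtain ⟨c, d, h, h1, h2⟩ := ih
    refine ⟨a * c - b * d, a * d + b * c, by rw [cpow, h, cmul_sl hI], ?_, ?_⟩
    · rw [pow_succ', ← h1]
      linear_combination (-(b * d)) * Complex.I_sq
    · rw [pow_succ', ← h2]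
      linear_combination (-(b * d)) * Complex.I_sq

/-- The characters `c + ι d ↦ c ± i d` map the slice power `(x - y)^{• n}`, `y = α₀ + β₀ I`, to
`(z - z₀) ^ n` and to `(z̄ - z₀) ^ n`, also for negative `n`. -/
theorem exists_linPowStem_sl {I : A} (hI : I ∈ unitSphere A) {z₀ z : ℂ} (h1 : z ≠ z₀)
    (h2 : z ≠ conj z₀) (n : ℤ) :
    ∃ c d : ℂ, linPowStem (sl I z₀) z n = (sl I c, sl I d) ∧
      c + Complex.I * d = (z - z₀) ^ n ∧ c - Complex.I * d = (conj z - z₀) ^ n := by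
  have hlin : ∀ u : ℂ, linStem (sl I u) z = (sl I (z.re - u), sl I (z.im : ℂ)) := fun u => by
    rw [linStem, sl_sub, sl_ofReal, sl_ofReal]
  have hre : ∀ u : ℂ, (z.re - u) + Complex.I * z.im = z - u := fun u => by
    linear_combination Complex.re_add_im z
  have hconj : conj z = z.re - Complex.I * z.im := by
    apply Complex.ext <;> simp
  cases n with
  | ofNat k =>
    obtain ⟨c, d, h, e1, e2⟩ := exists_cpow_sl hI (z.re - z₀) (z.im : ℂ) k
    refine ⟨c, d, by rw [linPowStem, hlin, h], ?_, ?_⟩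
    · rw [e1, hre]; simp
    · rw [e2, hconj, Int.ofNat_eq_natCast, zpow_natCast]; ring
  | negSucc k =>
    set δ := (deltaStem (sl I z₀) z)⁻¹ with hδ
    have hδ1 : δ * (z - conj z₀) = (z - z₀)⁻¹ := by
      have := sub_ne_zero.2 h1
      have := sub_ne_zero.2 h2
      rw [hδ, deltaStem_sl hI]
      field_simp
    have hδ2 : conj δ * (conj z - conj z₀) = (conj z - z₀)⁻¹ := by
      have h3 : conj z - conj z₀ ≠ 0 := by
        rw [← map_sub]; exact (map_ne_zero _).2 (sub_ne_zero.2 h1)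
      have h4 : conj z - z₀ ≠ 0 := by
        have : conj z - z₀ = conj (z - conj z₀) := by simp
        rw [this]; exact (map_ne_zero _).2 (sub_ne_zero.2 h2)
      rw [hδ, deltaStem_sl hI]
      simp only [map_inv₀, map_mul, map_sub, Complex.conj_conj]
      field_simp
    have hinv : linInvStem (sl I z₀) z = (sl I (δ.re * (z.re - conj z₀) - δ.im * z.im),
        sl I (δ.re * z.im + δ.im * (z.re - conj z₀))) := by
      rw [linInvStem, star_sl hI, hlin, ofC, ← sl_ofReal I, ← sl_ofReal I, cmul_sl hI]
    obtain ⟨c, d, h, e1, e2⟩ := exists_cpow_sl hI (δ.re * (z.re - conj z₀) - δ.im * z.im)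
      (δ.re * z.im + δ.im * (z.re - conj z₀)) (k + 1)
    refine ⟨c, d, by rw [linPowStem, hinv, h], ?_, ?_⟩
    · have : (δ.re * (z.re - conj z₀) - δ.im * z.im : ℂ)
          + Complex.I * (δ.re * z.im + δ.im * (z.re - conj z₀)) = δ * (z - conj z₀) := by
        conv_rhs => rw [← hre (conj z₀), ← Complex.re_add_im δ]
        linear_combination (-(δ.im * z.im) : ℂ) * Complex.I_sq
      rw [e1, this, hδ1, zpow_negSucc, inv_pow]
    · have : (δ.re * (z.re - conj z₀) - δ.im * z.im : ℂ)
          - Complex.I * (δ.re * z.im + δ.im * (z.re - conj z₀))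
          = conj δ * (conj z - conj z₀) := by
        have hc : conj δ = δ.re - Complex.I * δ.im := by apply Complex.ext <;> simp
        rw [hc, hconj]
        linear_combination (-(δ.im * z.im) : ℂ) * Complex.I_sq
      rw [e2, this, hδ2, zpow_negSucc, inv_pow]

theorem ev_cmul_sl (hA : AltNormed A) {I : A} (hI : I ∈ unitSphere A) (c d : ℂ) (x : A) :
    ev I (cmul (sl I c, sl I d) (x, 0)) = sl I (c + Complex.I * d) * x := by
  have hI' : I = sl I Complex.I := by simp [sl]
  simp only [ev, cmul, mul_zero, sub_zero, zero_add, sl_add, add_mul]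
  nth_rewrite 2 [hI']
  rw [sl_mul_mul hA hI]

theorem ev_neg_cmul_sl (hA : AltNormed A) {I : A} (hI : I ∈ unitSphere A) (c d : ℂ) (x : A) :
    ev (-I) (cmul (sl I c, sl I d) (x, 0)) = sl I (c - Complex.I * d) * x := by
  have hI' : I = sl I Complex.I := by simp [sl]
  simp only [ev, cmul, mul_zero, sub_zero, zero_add, sl_sub, sub_mul, neg_mul]
  nth_rewrite 2 [hI']
  rw [sl_mul_mul hA hI, sub_eq_add_neg]

theorem ev_linPowStem (hA : AltNormed A) {I : A} (hI : I ∈ unitSphere A) {z₀ z : ℂ} (h1 : z ≠ z₀)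
    (h2 : z ≠ conj z₀) (n : ℤ) (x : A) :
    ev I (cmul (linPowStem (sl I z₀) z n) (x, 0)) = sl I ((z - z₀) ^ n) * x := by
  obtain ⟨c, d, h, e, -⟩ := exists_linPowStem_sl hI h1 h2 n
  rw [h, ev_cmul_sl hA hI, e]

theorem ev_neg_linPowStem (hA : AltNormed A) {I : A} (hI : I ∈ unitSphere A) {z₀ z : ℂ}
    (h1 : z ≠ z₀) (h2 : z ≠ conj z₀) (n : ℤ) (x : A) :
    ev (-I) (cmul (linPowStem (sl I z₀) z n) (x, 0)) = sl I ((conj z - z₀) ^ n) * x := by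
  obtain ⟨c, d, h, -, e⟩ := exists_linPowStem_sl hI h1 h2 n
  rw [h, ev_neg_cmul_sl hA hI, e]

theorem sl_mem_sigmaShell (hA : AltNormed A) {I : A} (hI : I ∈ unitSphere A) {z₀ z : ℂ} {R : ℝ}
    (h0 : 0 < ‖z - z₀‖) (hR : ‖z - z₀‖ < R) : sl I z ∈ sigmaShell (sl I z₀) 0 R := by
  have hs : SameSlice (sl I z) (sl I z₀) := ⟨I, hI, ⟨z, rfl⟩, ⟨z₀, rfl⟩⟩
  refine ⟨sl_mem_quadraticCone hI z, ?_, ?_⟩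
  · rwa [tauDist, if_pos hs, ← sl_sub, norm_sl hA hI]
  · rwa [sigmaDist, if_pos hs, ← sl_sub, norm_sl hA hI]

/-- A shell of radius at most the distance to the real line only meets the slice of its centre. -/
theorem exists_of_mem_sigmaShell (hA : AltNormed A) {I : A} (hI : I ∈ unitSphere A) {z₀ : ℂ} {R : ℝ}
    (him : z₀.im ≠ 0) (hR : R ≤ |z₀.im|) {x : A} (hx : x ∈ sigmaShell (sl I z₀) 0 R) :
    ∃ z, x = sl I z ∧ 0 < ‖z - z₀‖ ∧ ‖z - z₀‖ < R := by
  obtain ⟨-, h1, h2⟩ := hx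
  by_cases hs : SameSlice x (sl I z₀)
  · rw [tauDist, if_pos hs] at h1
    rw [sigmaDist, if_pos hs] at h2
    have : ∃ z, x = sl I z := by
      obtain ⟨K, hK, ⟨u, rfl⟩, ⟨v, hv⟩⟩ := hs
      rcases sl_eq_sl hA hI hK hv.symm with ⟨-, h⟩ | ⟨-, h⟩
      · exact ⟨u, by rw [h him]⟩
      · exact ⟨conj u, by rw [h him, sl_neg]⟩
    obtain ⟨z, rfl⟩ := this
    rw [← sl_sub, norm_sl hA hI] at h1 h2
    exact ⟨z, rfl, h1, h2⟩
  · rw [sigmaDist, if_neg hs, norm_imPart_sl hA hI] at h2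
    have h3 : |z₀.im| ≤ Real.sqrt (‖rePart x - rePart (sl I z₀)‖ ^ 2
        + (‖imPart x‖ + |z₀.im|) ^ 2) := by
      refine Real.le_sqrt_of_sq_le ?_
      have a := sq_nonneg ‖rePart x - rePart (sl I z₀)‖
      have b := norm_nonneg (imPart x)
      have c := abs_nonneg z₀.im
      nlinarith
    linarith

end Powers

/-! ### Isolated spheres of singularities -/

section Isolated

open ComplexConjugate

variable {A : Type*} [NormedNonAssocRing A] [NormedSpace ℝ A] [FiniteDimensional ℝ A]
  [IsScalarTower ℝ A A] [SMulCommClass ℝ A A] [StarRing A] [StarModule ℝ A] [Nontrivial A]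

/-- The function `f` on `Ω = Ω_{D \ {z₀, z̄₀}}` is induced by the holomorphic stem function `F`, and
`Ω_D` is a circular open set containing the sphere of `α₀ + β₀ J`, where `z₀ = α₀ + i β₀` is not
real. -/
structure IsIsolatedSphere (D : Set ℂ) (Ω : Set A) (f : A → A) (z₀ : ℂ) (F : ℂ → Coord A) :
    Prop where
  alt : AltNormed A
  nonempty : (unitSphere A).Nonempty
  im_ne : z₀.im ≠ 0
  mem : z₀ ∈ D
  isOpen : IsOpen D
  conj_mem : ConjInvariant D
  isOpenInCone : IsOpenInCone (circularization (A := A) D)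
  eq_circ : Ω = circularization (D \ {z₀, conj z₀})
  stem : IsHolStem (D \ {z₀, conj z₀}) F f

theorem conj_ne_self {z : ℂ} (h : z.im ≠ 0) : conj z ≠ z := fun h' =>
  h (Complex.conj_eq_iff_im.1 h')

theorem im_ne_zero_of_norm_sub_lt {z z₀ : ℂ} (h : ‖z - z₀‖ < |z₀.im|) : z.im ≠ 0 := by
  intro h0
  have := Complex.abs_im_le_norm (z - z₀)
  rw [Complex.sub_im, h0, zero_sub, abs_neg] at this
  linarith

namespace IsIsolatedSphere

variable {D : Set ℂ} {Ω : Set A} {f : A → A} {z₀ : ℂ} {F : ℂ → Coord A}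

theorem conj_center (h : IsIsolatedSphere D Ω f z₀ F) : IsIsolatedSphere D Ω f (conj z₀) F where
  alt := h.alt
  nonempty := h.nonempty
  im_ne := by simpa using h.im_ne
  mem := h.conj_mem _ h.mem
  isOpen := h.isOpen
  conj_mem := h.conj_mem
  isOpenInCone := h.isOpenInCone
  eq_circ := by
    rw [Complex.conj_conj, pair_comm]
    exact h.eq_circ
  stem := by
    rw [Complex.conj_conj, pair_comm]
    exact h.stem

theorem sl_mem_iff (h : IsIsolatedSphere D Ω f z₀ F) {I : A} (hI : I ∈ unitSphere A) {z : ℂ} :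
    sl I z ∈ Ω ↔ z ∈ D ∧ z ≠ z₀ ∧ z ≠ conj z₀ := by
  rw [h.eq_circ, sl_mem_circularization_iff h.alt h.stem.conj_mem hI]
  simp [not_or]

theorem eventually_mem (h : IsIsolatedSphere D Ω f z₀ F) :
    ∀ᶠ z in 𝓝[≠] z₀, z ∈ D \ {z₀, conj z₀} := by
  filter_upwards [mem_nhdsWithin_of_mem_nhds (h.isOpen.mem_nhds h.mem), self_mem_nhdsWithin,
    mem_nhdsWithin_of_mem_nhds (isOpen_ne.mem_nhds (conj_ne_self h.im_ne).symm)] with z h1 h2 h3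
  simp only [Set.mem_sdiff, mem_insert_iff, mem_singleton_iff, not_or]
  exact ⟨h1, h2, h3⟩

theorem eventually_differentiableAt (h : IsIsolatedSphere D Ω f z₀ F) :
    ∀ᶠ z in 𝓝[≠] z₀, DifferentiableAt ℂ F z := by
  filter_upwards [h.eventually_mem] with z hz
  exact h.stem.differentiableOn.differentiableAt (h.stem.isOpen.mem_nhds hz)

/-- The Laurent expansion of `f` at `α₀ + β₀ I` is the Laurent expansion at `z₀` of the restriction
of `f` to the slice of `I`. -/
theorem isLaurentExpansion_iff (h : IsIsolatedSphere D Ω f z₀ F) {I : A} (hI : I ∈ unitSphere A)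
    (a : ℤ → A) : IsLaurentExpansion Ω f (sl I z₀) a ↔
      ∀ᶠ z in 𝓝[≠] z₀, HasSum (fun n : ℤ => sl I ((z - z₀) ^ n) * a n) (evC I (F z)) := by
  constructor
  · rintro ⟨R, hR, hsub, hsum⟩
    have hRev : ∀ᶠ z in 𝓝[≠] z₀, 0 < ‖z - z₀‖ ∧ ‖z - z₀‖ < R :=
      eventually_nhdsNE_iff.2 ⟨R, hR, fun z h1 h2 => ⟨h1, h2⟩⟩
    filter_upwards [hRev, h.eventually_mem] with z hz hzD
    have hm := sl_mem_sigmaShell h.alt hI hz.1 hz.2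
    have h2 := (h.sl_mem_iff hI).1 (hsub hm)
    have := hsum I hI z hm
    simp only [ev_linPowStem h.alt hI h2.2.1 h2.2.2] at this
    rwa [h.stem.induced z hzD I hI] at this
  · intro hev
    obtain ⟨R, hR, hs⟩ := eventually_nhdsNE_iff.1 (hev.and h.eventually_mem)
    have him : 0 < |z₀.im| := abs_pos.2 h.im_ne
    have hshell : ∀ x ∈ sigmaShell (sl I z₀) 0 (min R |z₀.im|), ∃ z, x = sl I z ∧
        ‖z - z₀‖ < |z₀.im| ∧ z ∈ D \ {z₀, conj z₀} ∧
        HasSum (fun n : ℤ => sl I ((z - z₀) ^ n) * a n) (evC I (F z)) := by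
      intro x hx
      obtain ⟨z, rfl, h1, h2⟩ := exists_of_mem_sigmaShell h.alt hI h.im_ne (min_le_right _ _) hx
      have h3 := hs z h1 (h2.trans_le (min_le_left _ _))
      exact ⟨z, rfl, h2.trans_le (min_le_right _ _), h3.2, h3.1⟩
    refine ⟨min R |z₀.im|, lt_min hR him, fun x hx => ?_, fun K hK w hw => ?_⟩
    · obtain ⟨z, rfl, -, h1, -⟩ := hshell x hx
      rw [h.eq_circ]
      exact ⟨z, h1, I, hI, rfl⟩
    · obtain ⟨z, hz, h1, h2, h3⟩ := hshell _ hw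
      have hzim := im_ne_zero_of_norm_sub_lt h1
      have h2' := h2.2
      simp only [mem_insert_iff, mem_singleton_iff, not_or] at h2'
      rw [hz, h.stem.induced z h2 I hI]
      rcases sl_eq_sl h.alt hI hK hz.symm with ⟨rfl, hKI⟩ | ⟨rfl, hKI⟩
      · rw [hKI hzim]
        simpa only [ev_linPowStem h.alt hI h2'.1 h2'.2] using h3
      · rw [hKI hzim]
        have c1 : conj z ≠ z₀ := fun hc => h2'.2 (by rw [← hc, Complex.conj_conj])
        have c2 : conj z ≠ conj z₀ := fun hc =>
          h2'.1 ((starRingEnd ℂ).injective hc)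
        simpa only [ev_neg_linPowStem h.alt hI c1 c2, Complex.conj_conj] using h3

theorem isLaurentExpansion_iff_hasLaurentAt (h : IsIsolatedSphere D Ω f z₀ F) {I : A}
    (hI : I ∈ unitSphere A) (a : ℤ → A) : IsLaurentExpansion Ω f (sl I z₀) a ↔
      HasLaurentAt (fun z => embC I (evC I (F z))) z₀ fun n => embC I (a n) := by
  rw [h.isLaurentExpansion_iff hI]
  refine eventually_congr (Eventually.of_forall fun z => ?_)
  constructor
  · intro hs
    have := hs.mapL (embC I)
    simpa only [embC_sl_mul h.alt hI] using this
  · intro hs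
    have := hs.mapL (evC I)
    simpa only [evC_smul h.alt hI, evC_embC h.alt hI] using this

theorem existsUnique_isLaurentExpansion (h : IsIsolatedSphere D Ω f z₀ F) {I : A}
    (hI : I ∈ unitSphere A) : ∃! a : ℤ → A, IsLaurentExpansion Ω f (sl I z₀) a := by
  obtain ⟨a, ha⟩ := exists_hasLaurentAt h.eventually_differentiableAt
  refine ⟨fun n => evC I (a n), (h.isLaurentExpansion_iff hI _).2 ?_, fun b hb => ?_⟩
  · filter_upwards [ha] with z hz
    simpa only [evC_smul h.alt hI] using hz.mapL (evC I)
  · have h1 : HasLaurentAt (fun z => embC I (evC I (F z))) z₀ fun n => embC I (evC I (a n)) := by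
      filter_upwards [ha] with z hz
      simpa only [evC_smul h.alt hI, embC_sl_mul h.alt hI] using (hz.mapL (evC I)).mapL (embC I)
    have h2 := ((h.isLaurentExpansion_iff_hasLaurentAt hI b).1 hb).unique h1
    funext n
    have := congrArg (evC I) (congrFun h2 n)
    simpa only [evC_embC h.alt hI] using this

theorem isSingularity (h : IsIsolatedSphere D Ω f z₀ F) {I : A} (hI : I ∈ unitSphere A) :
    IsSingularity Ω (sl I z₀) := by
  obtain ⟨a, ⟨R, hR, hs, -⟩, -⟩ := h.existsUnique_isLaurentExpansion hI
  exact ⟨sl_mem_quadraticCone hI z₀, R, hR, hs⟩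

/-- The order of `f` at `α₀ + β₀ I` is the pole order at `z₀` of the restriction of `f` to the slice
of `I`. -/
theorem isPoleOfOrderLE_iff (h : IsIsolatedSphere D Ω f z₀ F) {I : A} (hI : I ∈ unitSphere A)
    (m : ℕ) : IsPoleOfOrderLE Ω f (sl I z₀) m ↔ SlicePoleLE F I z₀ m := by
  have hinj : ∀ x : A, embC I x = 0 ↔ x = 0 := fun x =>
    ⟨fun hx => by rw [← evC_embC h.alt hI x, hx, map_zero], fun hx => by rw [hx, map_zero]⟩
  obtain ⟨L, hL⟩ := exists_projection h.alt hI
  have hdiff : ∀ᶠ z in 𝓝[≠] z₀, DifferentiableAt ℂ (fun z => embC I (evC I (F z))) z := by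
    filter_upwards [h.eventually_differentiableAt] with z hz
    simp only [← hL]
    exact L.differentiableAt.comp z hz
  rw [slicePoleLE_iff h.alt hI]
  constructor
  · rintro ⟨a, ha, h0⟩
    refine (((h.isLaurentExpansion_iff_hasLaurentAt hI a).1 ha).poleLE_iff hdiff m).2
      fun k hk => (hinj _).2 (h0 k hk)
  · intro hp
    obtain ⟨a, ha, -⟩ := h.existsUnique_isLaurentExpansion hI
    exact ⟨a, ha, fun k hk => (hinj _).1
      ((((h.isLaurentExpansion_iff_hasLaurentAt hI a).1 ha).poleLE_iff hdiff m).1 hp k hk)⟩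

end IsIsolatedSphere

end Isolated

/-! ### The spherical expansion -/

section Cassini

open ComplexConjugate

/-- The polynomial `(z - z₀) (z - z̄₀)`, the restriction of `Δ_y` to a slice. -/
def conjPoly (z₀ z : ℂ) : ℂ := (z - z₀) * (z - conj z₀)

theorem conjPoly_conj (z₀ z : ℂ) : conjPoly z₀ (conj z) = conj (conjPoly z₀ z) := by
  simp only [conjPoly, map_mul, map_sub, Complex.conj_conj]
  ring

theorem conjPoly_center (z₀ z : ℂ) : conjPoly (conj z₀) z = conjPoly z₀ z := by
  simp only [conjPoly, Complex.conj_conj]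
  ring

theorem continuous_conjPoly (z₀ : ℂ) : Continuous (conjPoly z₀) := by
  unfold conjPoly
  fun_prop

theorem conjPoly_eq_zero_iff {z₀ z : ℂ} : conjPoly z₀ z = 0 ↔ z = z₀ ∨ z = conj z₀ := by
  rw [conjPoly, mul_eq_zero, sub_eq_zero, sub_eq_zero]

theorem conjPoly_eq_iff {z₀ z w : ℂ} :
    conjPoly z₀ z = conjPoly z₀ w ↔ z = w ∨ z = z₀ + conj z₀ - w := by
  have : conjPoly z₀ z - conjPoly z₀ w = (z - w) * (z - (z₀ + conj z₀ - w)) := by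
    simp only [conjPoly]
    ring
  rw [← sub_eq_zero, this, mul_eq_zero, sub_eq_zero, sub_eq_zero]

theorem tendsto_conjPoly {z₀ : ℂ} (h : z₀.im ≠ 0) :
    Tendsto (conjPoly z₀) (𝓝[≠] z₀) (𝓝[≠] 0) := by
  refine tendsto_nhdsWithin_iff.2 ⟨?_, ?_⟩
  · have := ((continuous_conjPoly z₀).tendsto z₀).mono_left
      (nhdsWithin_le_nhds (s := {z₀}ᶜ))
    rwa [conjPoly_eq_zero_iff.2 (Or.inl rfl)] at this
  · filter_upwards [self_mem_nhdsWithin,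
      mem_nhdsWithin_of_mem_nhds (isOpen_ne.mem_nhds (conj_ne_self h).symm)] with z h1 h2
    exact fun h0 => (conjPoly_eq_zero_iff.1 h0).elim h1 h2

/-- The roots `z` of `conjPoly z₀ z = ζ` are near `z₀` or near `z̄₀` when `ζ` is near `0`. -/
theorem eventually_of_conjPoly_eq {z₀ : ℂ} {p : ℂ → Prop} (h1 : ∀ᶠ z in 𝓝[≠] z₀, p z)
    (h2 : ∀ᶠ z in 𝓝[≠] (conj z₀), p z) : ∀ᶠ ζ in 𝓝[≠] 0, ∀ z, conjPoly z₀ z = ζ → p z := by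
  obtain ⟨R, hR, hp⟩ := eventually_nhdsNE_iff.1 h1
  obtain ⟨S, hS, hq⟩ := eventually_nhdsNE_iff.1 h2
  refine eventually_nhdsNE_iff.2 ⟨R * S, mul_pos hR hS, ?_⟩
  rintro _ h0 hlt z rfl
  rw [sub_zero, conjPoly, norm_mul] at h0 hlt
  have ha : 0 < ‖z - z₀‖ := pos_of_mul_pos_left h0 (norm_nonneg _)
  have hb : 0 < ‖z - conj z₀‖ := pos_of_mul_pos_right h0 (norm_nonneg _)
  by_cases hc : ‖z - z₀‖ < R
  · exact hp z ha hc
  · refine hq z hb ?_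
    by_contra hd
    exact absurd hlt (not_lt.2 (mul_le_mul (not_lt.1 hc) (not_lt.1 hd) hS.le ha.le))

/-- A holomorphic local inverse of `conjPoly z₀` at `z₀`. -/
theorem exists_branch {z₀ : ℂ} (h : z₀.im ≠ 0) :
    ∃ φ : ℂ → ℂ, φ 0 = z₀ ∧ ∀ᶠ ζ in 𝓝 0, DifferentiableAt ℂ φ ζ ∧ conjPoly z₀ (φ ζ) = ζ := by
  have hβ : (z₀.im : ℂ) ≠ 0 := Complex.ofReal_ne_zero.2 h
  set u : ℂ → ℂ := fun ζ => 1 - ζ / (z₀.im : ℂ) ^ 2 with hu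
  have hud : Differentiable ℂ u := by fun_prop
  refine ⟨fun ζ => z₀.re + Complex.I * z₀.im * u ζ ^ ((2 : ℂ)⁻¹), ?_, ?_⟩
  · simp only [hu, zero_div, sub_zero, Complex.one_cpow, mul_one]
    linear_combination Complex.re_add_im z₀
  · have hslit : ∀ᶠ ζ in 𝓝 0, u ζ ∈ Complex.slitPlane := by
      refine hud.continuous.continuousAt.eventually_mem (Complex.isOpen_slitPlane.mem_nhds ?_)
      simp [hu]
    filter_upwards [hslit] with ζ hζ
    refine ⟨?_, ?_⟩
    · exact (((hud ζ).cpow_const hζ).const_mul _).const_add _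
    · have hsq : (u ζ ^ ((2 : ℂ)⁻¹)) ^ 2 = u ζ := Complex.cpow_ofNat_inv_pow _ 2
      have hz : z₀ = z₀.re + Complex.I * z₀.im := by linear_combination -Complex.re_add_im z₀
      have hzc : conj z₀ = z₀.re - Complex.I * z₀.im := by apply Complex.ext <;> simp
      have huζ : (z₀.im : ℂ) ^ 2 * u ζ = (z₀.im : ℂ) ^ 2 - ζ := by
        rw [hu]
        field_simp
      rw [conjPoly, hzc]
      nth_rewrite 3 [hz]
      linear_combination (-(z₀.im : ℂ) ^ 2) * hsq - huζ
        + ((z₀.im : ℂ) ^ 2 * (u ζ ^ ((2 : ℂ)⁻¹)) ^ 2 - (z₀.im : ℂ) ^ 2) * Complex.I_sq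

theorem hasSum_int_even_add_odd {M : Type*} [AddCommMonoid M] [TopologicalSpace M]
    [ContinuousAdd M] {f : ℤ → M} {a b : M} (he : HasSum (fun k => f (2 * k)) a)
    (ho : HasSum (fun k => f (2 * k + 1)) b) : HasSum f (a + b) := by
  have h1 : Function.Injective fun k : ℤ => 2 * k := fun x y h => by simpa using h
  have h2 : Function.Injective fun k : ℤ => 2 * k + 1 := fun x y h => by simpa using h
  have he' := h1.hasSum_range_iff.2 he
  have ho' := h2.hasSum_range_iff.2 ho
  refine he'.add_isCompl ?_ ho'
  rw [isCompl_iff, disjoint_iff_inf_le, codisjoint_iff_le_sup]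
  refine ⟨?_, ?_⟩
  · rintro _ ⟨⟨k, rfl⟩, ⟨l, hl⟩⟩
    have hl' : 2 * l + 1 = 2 * k := hl
    omega
  · rintro n -
    rcases Int.even_or_odd' n with ⟨k, rfl | rfl⟩
    · exact Or.inl ⟨k, rfl⟩
    · exact Or.inr ⟨k, rfl⟩

theorem isBigO_one_smul {α E : Type*} [NormedAddCommGroup E] [NormedSpace ℂ E] {l : Filter α}
    {u : α → ℂ} {g : α → E} (hu : u =O[l] (fun _ => (1 : ℝ))) (hg : g =O[l] (fun _ => (1 : ℝ))) :
    (fun x => u x • g x) =O[l] (fun _ => (1 : ℝ)) :=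
  (hu.smul hg).congr_right fun _ => by simp

/-- An affine function of a complex variable is determined by its values at two points. -/
theorem eq_and_eq_of_add_smul_eq {E : Type*} [AddCommGroup E] [Module ℂ E] {z w : ℂ} (hzw : z ≠ w)
    {a b a' b' : E} (h1 : a + z • b = a' + z • b') (h2 : a + w • b = a' + w • b') :
    a = a' ∧ b = b' := by
  have h : (z - w) • (b - b') = 0 := by
    have := congrArg₂ (· - ·) h1 h2
    have e : (z - w) • (b - b') = (a + z • b - (a + w • b)) - (a' + z • b' - (a' + w • b')) := by
      module
    rw [e, this, sub_self]
  have hb : b = b' := sub_eq_zero.1 ((smul_eq_zero.1 h).resolve_left (sub_ne_zero.2 hzw))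
  rw [hb] at h1
  exact ⟨add_right_cancel h1, hb⟩

end Cassini

section Split

open ComplexConjugate

variable {A : Type*} [NormedNonAssocRing A] [NormedSpace ℝ A] [FiniteDimensional ℝ A]
  [IsScalarTower ℝ A A] [SMulCommClass ℝ A A] [StarRing A] [StarModule ℝ A] [Nontrivial A]

namespace IsIsolatedSphere

variable {D : Set ℂ} {Ω : Set A} {f : A → A} {z₀ : ℂ} {F : ℂ → Coord A}

theorem poleLE_conj_iff (h : IsIsolatedSphere D Ω f z₀ F) (m : ℕ) :
    PoleLE F (conj z₀) m ↔ PoleLE F z₀ m := by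
  have key : ∀ {z₀ : ℂ}, IsIsolatedSphere D Ω f z₀ F → PoleLE F z₀ m → PoleLE F (conj z₀) m := by
    intro z₀ h hp
    have ht : Tendsto (fun z : ℂ => conj z) (𝓝[≠] (conj z₀)) (𝓝[≠] z₀) := by
      refine tendsto_nhdsWithin_iff.2 ⟨?_, ?_⟩
      · have := (Complex.continuous_conj.tendsto (conj z₀)).mono_left
          (nhdsWithin_le_nhds (s := {conj z₀}ᶜ))
        rwa [Complex.conj_conj] at this
      · filter_upwards [self_mem_nhdsWithin] with z hz hc
        exact hz (by rw [mem_singleton_iff, ← (show conj z = z₀ from hc), Complex.conj_conj])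
    have h1 := hp.comp_tendsto ht
    refine (h1.norm_left.congr' ?_ EventuallyEq.rfl).of_norm_left
    filter_upwards [ht.eventually h.eventually_mem] with z hz
    have := h.stem.map_conj _ hz
    rw [Complex.conj_conj] at this
    simp only [Function.comp]
    rw [norm_smul, norm_smul, this, norm_star, norm_pow, norm_pow]
    congr 2
    rw [← Complex.norm_conj, map_sub, Complex.conj_conj]
  exact ⟨fun hp => by simpa using key h.conj_center hp, key h⟩

/-- The stem function is an affine function of `z` whose coefficients are holomorphic functions of
`ζ = (z - z₀) (z - z̄₀)`, in a punctured neighbourhood of `ζ = 0`. -/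
theorem exists_split (h : IsIsolatedSphere D Ω f z₀ F) :
    ∃ U V : ℂ → Coord A,
      (∀ᶠ ζ in 𝓝[≠] 0, DifferentiableAt ℂ U ζ) ∧ (∀ᶠ ζ in 𝓝[≠] 0, DifferentiableAt ℂ V ζ) ∧
      (∀ᶠ ζ in 𝓝[≠] 0, ∀ z, conjPoly z₀ z = ζ → F z = U ζ + z • V ζ) ∧
      (∀ᶠ ζ in 𝓝[≠] 0, U (conj ζ) = star (U ζ) ∧ V (conj ζ) = star (V ζ)) ∧
      (∀ᶠ ζ in 𝓝[≠] 0, ∃ z w, z ≠ w ∧ conjPoly z₀ z = ζ ∧ conjPoly z₀ w = ζ) ∧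
      ∀ m, (PoleLE U 0 m ∧ PoleLE V 0 m) ↔ PoleLE F z₀ m := by
  obtain ⟨φ, hφ0, hφ⟩ := exists_branch h.im_ne
  -- the two roots `φ ζ`, `ψ ζ` of `conjPoly z₀ z = ζ`, near `z₀` and near `z̄₀`
  set ψ : ℂ → ℂ := fun ζ => z₀ + conj z₀ - φ ζ with hψ
  have hφc : ContinuousAt φ 0 := hφ.self_of_nhds.1.continuousAt
  have hψc : ContinuousAt ψ 0 := continuousAt_const.sub hφc
  have hψ0 : ψ 0 = conj z₀ := by rw [hψ]; simp [hφ0]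
  have hψδ : ∀ᶠ ζ in 𝓝 0, conjPoly z₀ (ψ ζ) = ζ := by
    filter_upwards [hφ] with ζ hζ
    exact (conjPoly_eq_iff.2 (Or.inr rfl)).trans hζ.2
  have hne : ∀ᶠ ζ in 𝓝 0, φ ζ ≠ ψ ζ := by
    have h0 : φ 0 ≠ ψ 0 := by
      rw [hφ0, hψ0]
      exact (conj_ne_self h.im_ne).symm
    exact ((hφc.sub hψc).eventually_ne (sub_ne_zero.2 h0)).mono fun ζ hζ => sub_ne_zero.1 hζ
  have hD := eventually_of_conjPoly_eq h.eventually_mem (by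
    have := h.conj_center.eventually_mem
    rwa [Complex.conj_conj, pair_comm] at this)
  have hφt : Tendsto φ (𝓝[≠] 0) (𝓝[≠] z₀) := by
    refine tendsto_nhdsWithin_iff.2 ⟨hφ0 ▸ hφc.tendsto.mono_left nhdsWithin_le_nhds, ?_⟩
    filter_upwards [self_mem_nhdsWithin, hφ.filter_mono nhdsWithin_le_nhds] with ζ h1 h2 h3
    refine h1 ?_
    rw [mem_singleton_iff, ← h2.2]
    exact conjPoly_eq_zero_iff.2 (Or.inl h3)
  have hψt : Tendsto ψ (𝓝[≠] 0) (𝓝[≠] (conj z₀)) := by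
    refine tendsto_nhdsWithin_iff.2 ⟨hψ0 ▸ hψc.tendsto.mono_left nhdsWithin_le_nhds, ?_⟩
    filter_upwards [self_mem_nhdsWithin, hψδ.filter_mono nhdsWithin_le_nhds] with ζ h1 h2 h3
    refine h1 ?_
    rw [mem_singleton_iff, ← h2]
    exact conjPoly_eq_zero_iff.2 (Or.inr h3)
  -- `U ζ + z V ζ` interpolates the values of `F` at the two roots
  set V : ℂ → Coord A := fun ζ => (φ ζ - ψ ζ)⁻¹ • (F (φ ζ) - F (ψ ζ)) with hV
  set U : ℂ → Coord A := fun ζ => F (φ ζ) - φ ζ • V ζ with hU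
  have hFd : ∀ z ∈ D \ {z₀, conj z₀}, DifferentiableAt ℂ F z := fun z hz =>
    h.stem.differentiableOn.differentiableAt (h.stem.isOpen.mem_nhds hz)
  have hdiff : ∀ᶠ ζ in 𝓝[≠] 0, DifferentiableAt ℂ φ ζ ∧ DifferentiableAt ℂ (fun ζ => F (φ ζ)) ζ ∧
      DifferentiableAt ℂ V ζ := by
    filter_upwards [hD, hφ.filter_mono nhdsWithin_le_nhds, hψδ.filter_mono nhdsWithin_le_nhds,
      hne.filter_mono nhdsWithin_le_nhds] with ζ h1 h2 h3 h4
    have d1 : DifferentiableAt ℂ (fun ζ => F (φ ζ)) ζ := (hFd _ (h1 _ h2.2)).comp ζ h2.1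
    have dψ : DifferentiableAt ℂ ψ ζ := h2.1.const_sub _
    have d2 : DifferentiableAt ℂ (fun ζ => F (ψ ζ)) ζ := (hFd _ (h1 _ h3)).comp ζ dψ
    exact ⟨h2.1, d1, ((h2.1.sub dψ).inv (sub_ne_zero.2 h4)).smul (d1.sub d2)⟩
  have hsplit : ∀ᶠ ζ in 𝓝[≠] 0, ∀ z, conjPoly z₀ z = ζ → F z = U ζ + z • V ζ := by
    filter_upwards [hφ.filter_mono nhdsWithin_le_nhds, hne.filter_mono nhdsWithin_le_nhds]
      with ζ h2 h4 z hz
    rcases conjPoly_eq_iff.1 (hz.trans h2.2.symm) with rfl | h5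
    · rw [hU]
      simp
    · have h6 : z = ψ ζ := h5
      have h7 : (φ ζ - ψ ζ) • V ζ = F (φ ζ) - F (ψ ζ) := by
        rw [hV]
        exact smul_inv_smul₀ (sub_ne_zero.2 h4) _
      rw [h6, hU]
      have : F (φ ζ) - φ ζ • V ζ + ψ ζ • V ζ = F (φ ζ) - (φ ζ - ψ ζ) • V ζ := by module
      simp only
      rw [this, h7]
      abel
  have hroots : ∀ᶠ ζ in 𝓝[≠] 0, ∃ z w, z ≠ w ∧ conjPoly z₀ z = ζ ∧ conjPoly z₀ w = ζ := by
    filter_upwards [hφ.filter_mono nhdsWithin_le_nhds, hne.filter_mono nhdsWithin_le_nhds,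
      hψδ.filter_mono nhdsWithin_le_nhds] with ζ h2 h3 h4
    exact ⟨φ ζ, ψ ζ, h3, h2.2, h4⟩
  have hconj : Tendsto (fun ζ : ℂ => conj ζ) (𝓝[≠] 0) (𝓝[≠] 0) := by
    refine tendsto_nhdsWithin_iff.2 ⟨?_, ?_⟩
    · have := (Complex.continuous_conj.tendsto 0).mono_left (nhdsWithin_le_nhds (s := {0}ᶜ))
      rwa [map_zero] at this
    · filter_upwards [self_mem_nhdsWithin] with ζ hζ
      exact (map_ne_zero _).2 hζ
  refine ⟨U, V, ?_, ?_, hsplit, ?_, hroots, fun m => ⟨?_, fun hp => ?_⟩⟩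
  · filter_upwards [hdiff] with ζ hζ
    exact hζ.2.1.sub (hζ.1.smul hζ.2.2)
  · filter_upwards [hdiff] with ζ hζ
    exact hζ.2.2
  · filter_upwards [hsplit, hconj.eventually hsplit, hroots, hD] with ζ h1 h2 ⟨z, w, hzw, hz, hw⟩ h4
    have key : ∀ z, conjPoly z₀ z = ζ →
        U (conj ζ) + conj z • V (conj ζ) = star (U ζ) + conj z • star (V ζ) := by
      intro z hz
      rw [← h2 (conj z) (by rw [conjPoly_conj, hz]), h.stem.map_conj z (h4 z hz), h1 z hz, star_add,
        star_smul]
      rfl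
    exact eq_and_eq_of_add_smul_eq (fun hc => hzw ((starRingEnd ℂ).injective hc)) (key z hz)
      (key w hw)
  · rintro ⟨hpU, hpV⟩
    have t := tendsto_conjPoly h.im_ne
    have b1 : (fun z => (conjPoly z₀ z - 0) ^ m • U (conjPoly z₀ z)) =O[𝓝[≠] z₀]
        (fun _ => (1 : ℝ)) := hpU.comp_tendsto t
    have b2 : (fun z => (conjPoly z₀ z - 0) ^ m • V (conjPoly z₀ z)) =O[𝓝[≠] z₀]
        (fun _ => (1 : ℝ)) := hpV.comp_tendsto t
    have c1 : (fun z : ℂ => z) =O[𝓝[≠] z₀] (fun _ => (1 : ℝ)) :=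
      (continuousAt_id.tendsto.mono_left nhdsWithin_le_nhds).isBigO_one ℝ
    have c2 : (fun z : ℂ => ((z - conj z₀) ^ m)⁻¹) =O[𝓝[≠] z₀] (fun _ => (1 : ℝ)) := by
      have : ContinuousAt (fun z : ℂ => ((z - conj z₀) ^ m)⁻¹) z₀ :=
        ContinuousAt.inv₀ (by fun_prop)
          (pow_ne_zero _ (sub_ne_zero.2 (conj_ne_self h.im_ne).symm))
      exact (this.tendsto.mono_left nhdsWithin_le_nhds).isBigO_one ℝ
    refine (isBigO_one_smul c2 (b1.add (isBigO_one_smul c1 b2))).congr' ?_ EventuallyEq.rfl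
    filter_upwards [t.eventually hsplit, h.eventually_mem] with z hz hzD
    have hzc : (z - conj z₀) ^ m ≠ 0 := by
      refine pow_ne_zero _ (sub_ne_zero.2 ?_)
      rintro rfl
      exact hzD.2 (by simp)
    rw [hz z rfl]
    simp only [sub_zero]
    rw [smul_comm z, ← smul_add, smul_smul]
    congr 1
    rw [conjPoly, mul_pow]
    field_simp
  · have q1 : (fun ζ => ζ ^ m • F (φ ζ)) =O[𝓝[≠] 0] (fun _ => (1 : ℝ)) := by
      have b : (fun ζ => (φ ζ - z₀) ^ m • F (φ ζ)) =O[𝓝[≠] 0] (fun _ => (1 : ℝ)) :=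
        Asymptotics.IsBigO.comp_tendsto hp hφt
      have c : (fun ζ => (φ ζ - conj z₀) ^ m) =O[𝓝[≠] 0] (fun _ => (1 : ℝ)) := by
        have : ContinuousAt (fun ζ => (φ ζ - conj z₀) ^ m) 0 :=
          (hφc.sub continuousAt_const).pow m
        exact (this.tendsto.mono_left nhdsWithin_le_nhds).isBigO_one ℝ
      refine (isBigO_one_smul c b).congr' ?_ EventuallyEq.rfl
      filter_upwards [hφ.filter_mono nhdsWithin_le_nhds] with ζ hζ
      simp only [smul_smul]
      congr 1
      conv_rhs => rw [← hζ.2, conjPoly]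
      rw [mul_pow, mul_comm]
    have q2 : (fun ζ => ζ ^ m • F (ψ ζ)) =O[𝓝[≠] 0] (fun _ => (1 : ℝ)) := by
      have b : (fun ζ => (ψ ζ - conj z₀) ^ m • F (ψ ζ)) =O[𝓝[≠] 0] (fun _ => (1 : ℝ)) :=
        Asymptotics.IsBigO.comp_tendsto ((h.poleLE_conj_iff m).2 hp) hψt
      have c : (fun ζ => (ψ ζ - z₀) ^ m) =O[𝓝[≠] 0] (fun _ => (1 : ℝ)) := by
        have : ContinuousAt (fun ζ => (ψ ζ - z₀) ^ m) 0 :=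
          (hψc.sub continuousAt_const).pow m
        exact (this.tendsto.mono_left nhdsWithin_le_nhds).isBigO_one ℝ
      refine (isBigO_one_smul c b).congr' ?_ EventuallyEq.rfl
      filter_upwards [hψδ.filter_mono nhdsWithin_le_nhds] with ζ hζ
      simp only [smul_smul]
      congr 1
      conv_rhs => rw [← hζ, conjPoly]
      rw [mul_pow]
    have ci : (fun ζ => (φ ζ - ψ ζ)⁻¹) =O[𝓝[≠] 0] (fun _ => (1 : ℝ)) := by
      have : ContinuousAt (fun ζ => (φ ζ - ψ ζ)⁻¹) 0 :=
        (hφc.sub hψc).inv₀ (sub_ne_zero.2 hne.self_of_nhds)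
      exact (this.tendsto.mono_left nhdsWithin_le_nhds).isBigO_one ℝ
    have hpV : PoleLE V 0 m := by
      refine (ci.smul (q1.sub q2)).congr (fun ζ => ?_) fun ζ => by simp
      rw [hV, sub_zero]
      simp only
      rw [← smul_sub, smul_comm]
    refine ⟨?_, hpV⟩
    have cφ : φ =O[𝓝[≠] 0] (fun _ => (1 : ℝ)) :=
      (hφc.tendsto.mono_left nhdsWithin_le_nhds).isBigO_one ℝ
    refine (q1.sub (isBigO_one_smul cφ hpV)).congr_left fun ζ => ?_
    rw [hU, sub_zero]
    simp only
    rw [smul_comm (φ ζ), smul_sub]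

end IsIsolatedSphere

end Split

section Spherical

open ComplexConjugate

variable {A : Type*} [NormedNonAssocRing A] [NormedSpace ℝ A] [FiniteDimensional ℝ A]
  [IsScalarTower ℝ A A] [SMulCommClass ℝ A A] [StarRing A] [StarModule ℝ A] [Nontrivial A]

theorem toCoord_sphPowStem_even {J : A} (hJ : J ∈ unitSphere A) (z₀ z : ℂ) (k : ℤ) (x : A) :
    toCoord A (cmul (sphPowStem (sl J z₀) z (2 * k)) (x, 0)) =
      conjPoly z₀ z ^ k • toCoord A (x, 0) := by
  rw [sphPowStem, if_pos (even_two_mul k), toCoord_cmul_ofC, deltaStem_sl hJ,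
    Int.mul_ediv_cancel_left k two_ne_zero, conjPoly]

theorem toCoord_sphPowStem_odd {J : A} (hJ : J ∈ unitSphere A) (z₀ z : ℂ) (k : ℤ) (x : A) :
    toCoord A (cmul (sphPowStem (sl J z₀) z (2 * k + 1)) (x, 0)) =
      conjPoly z₀ z ^ k • (z • toCoord A (x, 0) - toCoord A (sl J z₀ * x, 0)) := by
  have hodd : ¬ Even (2 * k + 1) := by simp
  rw [sphPowStem, if_neg hodd, deltaStem_sl hJ, show (2 * k + 1) / 2 = k by omega, ← conjPoly,
    ← toCoord_cmul_ofC z, ← map_sub, ← toCoord_cmul_ofC]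
  congr 1
  rw [cmul_ofC, cmul_ofC, cmul_ofC]
  simp only [cmul, linStem, mul_zero, sub_zero, smul_zero, zero_add,
    Prod.fst_sub, Prod.snd_sub, sub_mul, add_mul, smul_mul_assoc, one_mul]

/-- Left multiplication by an element of `A`, as a complex-linear map of `A_ℂ`. -/
theorem exists_mulLeft_coord (a : A) :
    ∃ L : Coord A →L[ℂ] Coord A, ∀ x, L (toCoord A (x, 0)) = toCoord A (a * x, 0) := by
  have hM : ∃ M : Coord A → Coord A, ∀ p : A × A, M (toCoord A p) = toCoord A (a * p.1, a * p.2) :=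
    ⟨fun e => toCoord A (a * ((toCoord A).symm e).1, a * ((toCoord A).symm e).2), fun p => by
      simp⟩
  obtain ⟨M, hM⟩ := hM
  refine ⟨LinearMap.toContinuousLinearMap
    { toFun := M
      map_add' := fun x y => ?_
      map_smul' := fun w e => ?_ }, fun x => ?_⟩
  · obtain ⟨p, rfl⟩ := (toCoord A).surjective x
    obtain ⟨q, rfl⟩ := (toCoord A).surjective y
    rw [← map_add, hM, hM, hM, ← map_add]
    simp [mul_add]
  · obtain ⟨p, rfl⟩ := (toCoord A).surjective e
    rw [← toCoord_cmul_ofC, hM, hM, RingHom.id_apply, ← toCoord_cmul_ofC, cmul_ofC, cmul_ofC]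
    simp only [mul_add, mul_sub, mul_smul_comm]
  · change M _ = _
    rw [hM, mul_zero]

theorem cassini_sl (hA : AltNormed A) {I K : A} (hI : I ∈ unitSphere A) (hK : K ∈ unitSphere A)
    (z₀ z : ℂ) : cassini (sl K z) (sl I z₀) = Real.sqrt ‖conjPoly z₀ z‖ := by
  rw [cassini, Delta_sl hI hK, norm_sl hA hK, conjPoly]

/-- If the series `∑ S` and `∑ T` with even terms `p k` and odd terms `z q k - r k`,
respectively `w q k - r k`, converge to `a + z b` and to `a + w b`, then `∑ q = b` and
`∑ (p - r) = a`. -/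
theorem hasSum_of_hasSum_affine {E : Type*} [NormedAddCommGroup E] [NormedSpace ℂ E]
    [CompleteSpace E] {z w : ℂ} (hzw : z ≠ w) {a b : E} {S T : ℤ → E} {p q r : ℤ → E}
    (hS : HasSum S (a + z • b)) (hT : HasSum T (a + w • b))
    (hSe : ∀ k, S (2 * k) = p k) (hSo : ∀ k, S (2 * k + 1) = z • q k - r k)
    (hTe : ∀ k, T (2 * k) = p k) (hTo : ∀ k, T (2 * k + 1) = w • q k - r k) :
    HasSum q b ∧ HasSum (fun k => p k - r k) a := by
  have inj0 : Function.Injective fun k : ℤ => 2 * k := fun x y h => by simpa using h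
  have inj1 : Function.Injective fun k : ℤ => 2 * k + 1 := fun x y h => by simpa using h
  have key : ∀ (z : ℂ) (S : ℤ → E), HasSum S (a + z • b) → (∀ k, S (2 * k) = p k) →
      (∀ k, S (2 * k + 1) = z • q k - r k) →
      ∃ s, HasSum (fun k => z • q k - r k) s ∧ (∑' k, p k) + s = a + z • b ∧ Summable p := by
    intro z S hS he ho
    have h1 : Summable p := (hS.summable.comp_injective inj0).congr he
    have h2 : Summable fun k => z • q k - r k :=
      (hS.summable.comp_injective inj1).congr ho
    exact ⟨_, h2.hasSum, (hasSum_int_even_add_odd (h1.hasSum.congr_fun he)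
      (h2.hasSum.congr_fun ho)).unique hS, h1⟩
  obtain ⟨s, hs, es, hp⟩ := key z S hS hSe hSo
  obtain ⟨t, ht, et, -⟩ := key w T hT hTe hTo
  have hzw' : z - w ≠ 0 := sub_ne_zero.2 hzw
  have hq : HasSum q b := by
    have h3 := (hs.sub ht).const_smul (z - w)⁻¹
    have e : s - t = (z - w) • b := by
      have h4 := congrArg₂ (· - ·) es et
      simp only [add_sub_add_left_eq_sub] at h4
      rw [h4, sub_smul]
    rw [e, inv_smul_smul₀ hzw'] at h3
    refine h3.congr_fun fun k => ?_
    rw [sub_sub_sub_cancel_right, ← sub_smul, inv_smul_smul₀ hzw']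
  refine ⟨hq, ?_⟩
  have h4 := (hp.hasSum.add hs).sub (hq.const_smul z)
  rw [es, add_sub_cancel_right] at h4
  refine h4.congr_fun fun k => ?_
  abel

/-- A function commuting with conjugation has real Laurent coefficients at `0`. -/
theorem hasLaurentAt_star {g : ℂ → Coord A} {a : ℤ → Coord A}
    (hg : ∀ᶠ ζ in 𝓝[≠] 0, g (conj ζ) = star (g ζ)) (ha : HasLaurentAt g 0 a) (n : ℤ) :
    star (a n) = a n := by
  have hconj : Tendsto (fun ζ : ℂ => conj ζ) (𝓝[≠] 0) (𝓝[≠] 0) := by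
    refine tendsto_nhdsWithin_iff.2 ⟨?_, ?_⟩
    · have := (Complex.continuous_conj.tendsto 0).mono_left (nhdsWithin_le_nhds (s := {0}ᶜ))
      rwa [map_zero] at this
    · filter_upwards [self_mem_nhdsWithin] with ζ hζ
      exact (map_ne_zero _).2 hζ
  have hb : HasLaurentAt g 0 fun n => star (a n) := by
    filter_upwards [hconj.eventually ha, hg] with ζ h1 h2
    rw [h2] at h1
    have h3 := h1.star
    rw [star_star] at h3
    refine h3.congr_fun fun k => ?_
    rw [star_smul, sub_zero, sub_zero, star_zpow₀]
    congr 2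
    exact (star_star ζ).symm
  exact congrFun (hb.unique ha) n

namespace IsIsolatedSphere

variable {D : Set ℂ} {Ω : Set A} {f : A → A} {z₀ : ℂ} {F : ℂ → Coord A}

theorem eventually_mem_of_conjPoly_eq (h : IsIsolatedSphere D Ω f z₀ F) :
    ∀ᶠ ζ in 𝓝[≠] 0, ∀ z, conjPoly z₀ z = ζ → z ∈ D \ {z₀, conj z₀} :=
  eventually_of_conjPoly_eq h.eventually_mem (by
    have := h.conj_center.eventually_mem
    rwa [Complex.conj_conj, pair_comm] at this)

/-- The spherical expansion of `f` on all slices is one expansion of its stem function, since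
the evaluations at `J` and `-J` determine an element of `A_ℂ`. -/
theorem isSphericalExpansion_iff (h : IsIsolatedSphere D Ω f z₀ F) {J : A} (hJ : J ∈ unitSphere A)
    (c : ℤ → A) : IsSphericalExpansion Ω f (sl J z₀) c ↔
      ∀ᶠ ζ in 𝓝[≠] 0, ∀ z, conjPoly z₀ z = ζ →
        HasSum (fun n => toCoord A (cmul (sphPowStem (sl J z₀) z n) (c n, 0))) (F z) := by
  constructor
  · rintro ⟨r, hr, hsub, hs⟩
    refine eventually_nhdsNE_iff.2 ⟨r ^ 2, by positivity, ?_⟩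
    rintro _ h0 hlt z rfl
    rw [sub_zero] at h0 hlt
    have hmem : ∀ K ∈ unitSphere A, sl K z ∈ cassiniShell (sl J z₀) 0 r := fun K hK => by
      refine ⟨sl_mem_quadraticCone hK z, ?_, ?_⟩
      · rw [cassini_sl h.alt hJ hK]
        exact Real.sqrt_pos.2 h0
      · rw [cassini_sl h.alt hJ hK]
        exact (Real.sqrt_lt' hr).2 hlt
    have hz : z ∈ D \ {z₀, conj z₀} := by
      have := (h.sl_mem_iff hJ).1 (hsub (hmem J hJ))
      simpa [not_or] using this
    have key : ∀ K ∈ unitSphere A, HasSum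
        (fun n => evC K (toCoord A (cmul (sphPowStem (sl J z₀) z n) (c n, 0)))) (evC K (F z)) := by
      intro K hK
      have := hs K hK z (hmem K hK)
      rw [h.stem.induced z hz K hK] at this
      simpa only [evC_toCoord] using this
    have := ((key J hJ).mapL (embC J)).add
      ((key (-J) (neg_mem_unitSphere hJ)).mapL (embC (-J)))
    simpa only [embC_evC_add h.alt hJ] using this
  · intro hev
    obtain ⟨ρ, hρ, hs⟩ := eventually_nhdsNE_iff.1 (hev.and h.eventually_mem_of_conjPoly_eq)
    have hsq : ∀ K ∈ unitSphere A, ∀ z, sl K z ∈ cassiniShell (sl J z₀) 0 (Real.sqrt ρ) →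
        z ∈ D \ {z₀, conj z₀} ∧
          HasSum (fun n => toCoord A (cmul (sphPowStem (sl J z₀) z n) (c n, 0))) (F z) := by
      rintro K hK z ⟨-, h1, h2⟩
      rw [cassini_sl h.alt hJ hK] at h1 h2
      have h1' := Real.sqrt_pos.1 h1
      have h2' := (Real.sqrt_lt_sqrt_iff (norm_nonneg _)).1 h2
      have := hs (conjPoly z₀ z) (by rwa [sub_zero]) (by rwa [sub_zero])
      exact ⟨this.2 z rfl, this.1 z rfl⟩
    refine ⟨Real.sqrt ρ, Real.sqrt_pos.2 hρ, fun x hx => ?_, fun K hK z hz => ?_⟩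
    · obtain ⟨K, hK, z, rfl⟩ := exists_sl_of_mem_quadraticCone h.nonempty hx.1
      rw [h.eq_circ]
      exact ⟨z, (hsq K hK z hx).1, K, hK, rfl⟩
    · obtain ⟨h1, h2⟩ := hsq K hK z hz
      rw [h.stem.induced z h1 K hK]
      simpa only [evC_toCoord] using h2.mapL (evC K)

/-- The spherical expansion of `f` is equivalent to Laurent expansions at `0` of the two functions
`U` and `V` with `F z = U ζ + z V ζ`, where `ζ = (z - z₀) (z - z̄₀)`. -/
theorem isSphericalExpansion_iff_hasLaurentAt (h : IsIsolatedSphere D Ω f z₀ F) {J : A}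
    (hJ : J ∈ unitSphere A) {U V : ℂ → Coord A}
    (hUV : ∀ᶠ ζ in 𝓝[≠] 0, ∀ z, conjPoly z₀ z = ζ → F z = U ζ + z • V ζ)
    (hroots : ∀ᶠ ζ in 𝓝[≠] 0, ∃ z w, z ≠ w ∧ conjPoly z₀ z = ζ ∧ conjPoly z₀ w = ζ) (c : ℤ → A) :
    IsSphericalExpansion Ω f (sl J z₀) c ↔
      HasLaurentAt U 0 (fun k => toCoord A (c (2 * k) - sl J z₀ * c (2 * k + 1), 0)) ∧
      HasLaurentAt V 0 (fun k => toCoord A (c (2 * k + 1), 0)) := by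
  obtain ⟨L, hL⟩ := exists_mulLeft_coord (sl J z₀)
  have hsubC : ∀ a b : A, toCoord A (a - b, 0) = toCoord A (a, 0) - toCoord A (b, 0) := by
    intro a b
    rw [← map_sub]
    simp
  rw [h.isSphericalExpansion_iff hJ]
  constructor
  · intro hs
    rw [HasLaurentAt, HasLaurentAt, ← eventually_and]
    filter_upwards [hs, hUV, hroots] with ζ h1 h2 ⟨z, w, hzw, hz, hw⟩
    have hT : ∀ z, conjPoly z₀ z = ζ →
        (∀ k : ℤ, toCoord A (cmul (sphPowStem (sl J z₀) z (2 * k)) (c (2 * k), 0)) =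
          ζ ^ k • toCoord A (c (2 * k), 0)) ∧
        (∀ k : ℤ, toCoord A (cmul (sphPowStem (sl J z₀) z (2 * k + 1)) (c (2 * k + 1), 0)) =
          z • ζ ^ k • toCoord A (c (2 * k + 1), 0)
            - ζ ^ k • toCoord A (sl J z₀ * c (2 * k + 1), 0)) := fun z hz =>
      ⟨fun k => by rw [toCoord_sphPowStem_even hJ, hz],
        fun k => by rw [toCoord_sphPowStem_odd hJ, hz, smul_sub, smul_comm z]⟩
    obtain ⟨hV, hU⟩ := hasSum_of_hasSum_affine hzw (h2 z hz ▸ h1 z hz) (h2 w hw ▸ h1 w hw)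
      (hT z hz).1 (hT z hz).2 (hT w hw).1 (hT w hw).2
    simp only [sub_zero, hsubC, smul_sub]
    exact ⟨hU, hV⟩
  · rintro ⟨hU, hV⟩
    filter_upwards [hU, hV, hUV] with ζ h1 h2 h3 z hz
    simp only [sub_zero] at h1 h2
    rw [h3 z hz]
    have h2L := h2.mapL L
    simp only [map_smul, hL] at h2L
    have he := h1.add h2L
    have ho := (h2.const_smul z).sub h2L
    have hfin := hasSum_int_even_add_odd
      (f := fun n => toCoord A (cmul (sphPowStem (sl J z₀) z n) (c n, 0)))
      (a := U ζ + L (V ζ)) (b := z • V ζ - L (V ζ)) (he.congr_fun fun k => ?_)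
      (ho.congr_fun fun k => ?_)
    · convert hfin using 1
      abel
    · rw [toCoord_sphPowStem_even hJ, hz, hsubC]
      module
    · rw [toCoord_sphPowStem_odd hJ, hz]
      module

theorem existsUnique_isSphericalExpansion (h : IsIsolatedSphere D Ω f z₀ F) {J : A}
    (hJ : J ∈ unitSphere A) : ∃! c : ℤ → A, IsSphericalExpansion Ω f (sl J z₀) c := by
  obtain ⟨U, V, hU, hV, hUV, hst, hroots, -⟩ := h.exists_split
  obtain ⟨a, ha⟩ := exists_hasLaurentAt hU
  obtain ⟨b, hb⟩ := exists_hasLaurentAt hV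
  choose u hu using fun n => exists_toCoord_real
    (hasLaurentAt_star (hst.mono fun _ h => h.1) ha n)
  choose v hv using fun n => exists_toCoord_real
    (hasLaurentAt_star (hst.mono fun _ h => h.2) hb n)
  set c : ℤ → A := fun n => if Even n then u (n / 2) + sl J z₀ * v (n / 2) else v (n / 2) with hc
  have hce : ∀ k, c (2 * k) = u k + sl J z₀ * v k := fun k => by
    simp only [hc, if_pos (even_two_mul k), Int.mul_ediv_cancel_left k two_ne_zero]
  have hco : ∀ k, c (2 * k + 1) = v k := fun k => by
    have hodd : ¬ Even (2 * k + 1) := by simp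
    simp only [hc, if_neg hodd, show (2 * k + 1) / 2 = k by omega]
  refine ⟨c, ?_, fun d hd => ?_⟩
  · refine (h.isSphericalExpansion_iff_hasLaurentAt hJ hUV hroots c).2 ?_
    simp only [hce, hco, add_sub_cancel_right, ← hu, ← hv]
    exact ⟨ha, hb⟩
  · obtain ⟨h1, h2⟩ := (h.isSphericalExpansion_iff_hasLaurentAt hJ hUV hroots d).1 hd
    have e2 : ∀ k, d (2 * k + 1) = v k := fun k => by
      have := congrFun (h2.unique hb) k
      simp only [hv] at this
      exact congrArg Prod.fst ((toCoord A).injective this)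
    have e1 : ∀ k, d (2 * k) = u k + sl J z₀ * v k := fun k => by
      have := congrFun (h1.unique ha) k
      simp only [hu] at this
      have := congrArg Prod.fst ((toCoord A).injective this)
      simp only [e2] at this
      rw [← this, sub_add_cancel]
    funext n
    rcases Int.even_or_odd' n with ⟨k, rfl | rfl⟩
    · rw [e1, hce]
    · rw [e2, hco]

/-- The coefficients of the spherical expansion vanish below degree `-2m` exactly when the stem
function has at worst a pole of order `m`. -/
theorem exists_isSphericalExpansion_iff_poleLE (h : IsIsolatedSphere D Ω f z₀ F) {J : A}
    (hJ : J ∈ unitSphere A) (m : ℕ) :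
    (∃ c : ℤ → A, IsSphericalExpansion Ω f (sl J z₀) c ∧ ∀ n : ℤ, n < -(2 * m : ℤ) → c n = 0) ↔
      PoleLE F z₀ m := by
  obtain ⟨U, V, hU, hV, hUV, -, hroots, hpole⟩ := h.exists_split
  have hz0 : ∀ x : A, toCoord A (x, 0) = 0 ↔ x = 0 := fun x => by
    rw [map_eq_zero_iff _ (toCoord A).injective]
    simp
  rw [← hpole]
  constructor
  · rintro ⟨c, hc, h0⟩
    obtain ⟨h1, h2⟩ := (h.isSphericalExpansion_iff_hasLaurentAt hJ hUV hroots c).1 hc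
    refine ⟨(h1.poleLE_iff hU m).2 fun k hk => ?_, (h2.poleLE_iff hV m).2 fun k hk => ?_⟩
    · rw [hz0, h0 _ (by omega), h0 _ (by omega), mul_zero, sub_zero]
    · rw [hz0, h0 _ (by omega)]
  · rintro ⟨hpU, hpV⟩
    obtain ⟨c, hc, -⟩ := h.existsUnique_isSphericalExpansion hJ
    obtain ⟨h1, h2⟩ := (h.isSphericalExpansion_iff_hasLaurentAt hJ hUV hroots c).1 hc
    have h1' := (h1.poleLE_iff hU m).1 hpU
    have h2' := (h2.poleLE_iff hV m).1 hpV
    have ho : ∀ k : ℤ, k < -(m : ℤ) → c (2 * k + 1) = 0 := fun k hk => by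
      have := (hz0 _).1 (h2' k.natAbs (by omega))
      rwa [show -(k.natAbs : ℤ) = k by omega] at this
    refine ⟨c, hc, fun n hn => ?_⟩
    rcases Int.even_or_odd' n with ⟨k, rfl | rfl⟩
    · have hk : k < -(m : ℤ) := by omega
      have := (hz0 _).1 (h1' k.natAbs (by omega))
      rwa [show -(k.natAbs : ℤ) = k by omega, ho k hk, mul_zero, sub_zero] at this
    · exact ho k (by omega)

end IsIsolatedSphere

end Spherical

/-! ### Extension across the sphere and boundedness near the sphere -/

section Extension

open ComplexConjugate

variable {A : Type*} [NormedNonAssocRing A] [NormedSpace ℝ A] [FiniteDimensional ℝ A]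
  [IsScalarTower ℝ A A] [SMulCommClass ℝ A A] [StarRing A] [StarModule ℝ A] [Nontrivial A]

/-- The evaluations at imaginary units are uniformly bounded, as imaginary units have norm `1`. -/
theorem exists_norm_evC_le (hA : AltNormed A) :
    ∃ C : ℝ, 0 < C ∧ ∀ K ∈ unitSphere A, ∀ e : Coord A, ‖evC K e‖ ≤ C * ‖e‖ := by
  obtain ⟨C, hC, hmul⟩ := exists_norm_mul_le (A := A)
  set T : Coord A →L[ℝ] A × A := ((toCoord A).symm : Coord A →L[ℝ] A × A)
  refine ⟨(1 + C) * (‖T‖ + 1), by positivity, fun K hK e => ?_⟩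
  have h1 : evC K e = (T e).1 + K * (T e).2 := rfl
  have h2 : ‖(T e).1‖ ≤ ‖T e‖ := norm_fst_le _
  have h3 : ‖(T e).2‖ ≤ ‖T e‖ := norm_snd_le _
  have h4 : ‖T e‖ ≤ (‖T‖ + 1) * ‖e‖ := (T.le_opNorm e).trans (by gcongr; linarith)
  have h5 := hmul K (T e).2
  rw [norm_of_mem_unitSphere hA hK, mul_one] at h5
  calc ‖evC K e‖ ≤ ‖(T e).1‖ + ‖K * (T e).2‖ := by rw [h1]; exact norm_add_le _ _
    _ ≤ ‖T e‖ + C * ‖T e‖ := add_le_add h2 (h5.trans (by gcongr))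
    _ = (1 + C) * ‖T e‖ := by ring
    _ ≤ (1 + C) * ((‖T‖ + 1) * ‖e‖) := by gcongr
    _ = _ := by ring

theorem isBigO_evC_smul (hA : AltNormed A) {I : A} (hI : I ∈ unitSphere A) {l : Filter ℂ}
    {u : ℂ → ℂ} {X : ℂ → Coord A} (hu : u =O[l] (fun _ => (1 : ℝ)))
    (hX : (fun z => evC I (X z)) =O[l] (fun _ => (1 : ℝ))) :
    (fun z => evC I (u z • X z)) =O[l] (fun _ => (1 : ℝ)) := by
  have h1 := isBigO_one_smul hu (((embC I).isBigO_comp _ _).trans hX)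
  refine (((evC I).isBigO_comp _ _).trans h1).congr_left fun z => ?_
  rw [evC_smul hA hI, evC_embC hA hI, evC_smul hA hI]

theorem isBigO_one_of_continuousAt {X : Type*} [NormedAddCommGroup X] {u : ℂ → X} {c : ℂ}
    (hu : ContinuousAt u c) : u =O[𝓝[≠] c] (fun _ => (1 : ℝ)) :=
  (hu.tendsto.mono_left nhdsWithin_le_nhds).isBigO_one ℝ

theorem continuous_Delta (y : A) : Continuous fun x : A => Delta y x := by
  unfold Delta
  have e1 : Continuous fun x : A => x * x :=
    continuous_mul_of_finiteDimensional.comp (continuous_id.prodMk continuous_id)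
  have e2 : Continuous fun x : A => x * tr y :=
    continuous_mul_of_finiteDimensional.comp (continuous_id.prodMk continuous_const)
  exact (e1.sub e2).add continuous_const

theorem eq_of_forall_evC_eq (hA : AltNormed A) {I : A} (hI : I ∈ unitSphere A) {e e' : Coord A}
    (h : ∀ K ∈ unitSphere A, evC K e = evC K e') : e = e' := by
  have := (evC_eq_zero_iff hA hI (e - e')).1
    ⟨by rw [map_sub, h I hI, sub_self], by rw [map_sub, h _ (neg_mem_unitSphere hI), sub_self]⟩
  exact sub_eq_zero.1 this

theorem PoleLE.conjPoly_pow_isBigO {F : ℂ → Coord A} {z₀ : ℂ} {m : ℕ} (hp : PoleLE F z₀ m) :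
    (fun z => conjPoly z₀ z ^ m • F z) =O[𝓝[≠] z₀] (fun _ => (1 : ℝ)) := by
  have c : (fun z => (z - conj z₀) ^ m) =O[𝓝[≠] z₀] (fun _ => (1 : ℝ)) :=
    isBigO_one_of_continuousAt (by fun_prop)
  refine (isBigO_one_smul c hp).congr_left fun z => ?_
  rw [smul_smul, conjPoly, mul_pow, mul_comm]

namespace IsIsolatedSphere

variable {D : Set ℂ} {Ω : Set A} {f : A → A} {z₀ : ℂ} {F : ℂ → Coord A}

/-- The point `α₀ - β₀ I` of the slice of `I` has the coordinate `z̄₀` there, and `z₀` in the slice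
of `-I`. -/
theorem slicePoleLE_conj_iff (h : IsIsolatedSphere D Ω f z₀ F) {I : A} {m : ℕ} :
    SlicePoleLE F I (conj z₀) m ↔ SlicePoleLE F (-I) z₀ m := by
  have key : ∀ {z₀ : ℂ} {I : A}, IsIsolatedSphere D Ω f z₀ F → SlicePoleLE F (-I) z₀ m →
      SlicePoleLE F I (conj z₀) m := by
    intro z₀ I h hp
    have ht : Tendsto (fun z : ℂ => conj z) (𝓝[≠] (conj z₀)) (𝓝[≠] z₀) := by
      refine tendsto_nhdsWithin_iff.2 ⟨?_, ?_⟩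
      · have := (Complex.continuous_conj.tendsto (conj z₀)).mono_left
          (nhdsWithin_le_nhds (s := {conj z₀}ᶜ))
        rwa [Complex.conj_conj] at this
      · filter_upwards [self_mem_nhdsWithin] with z hz hc
        exact hz (by rw [mem_singleton_iff, ← (show conj z = z₀ from hc), Complex.conj_conj])
    refine (Asymptotics.IsBigO.comp_tendsto hp ht).congr' ?_ EventuallyEq.rfl
    filter_upwards [ht.eventually h.eventually_mem] with z hz
    have hF := h.stem.map_conj _ hz
    rw [Complex.conj_conj] at hF
    simp only [Function.comp]
    rw [← evC_star, star_smul, ← hF, star_pow, star_sub]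
    congr 3
    exact congrArg₂ (· - ·) (star_star z) rfl
  refine ⟨fun hp => ?_, key h⟩
  have := key (I := -I) h.conj_center (by rwa [neg_neg])
  rwa [Complex.conj_conj] at this

/-- The factor `z - z̄₀` is invertible near `z₀`. -/
theorem slicePoleLE_iff_conjPoly (h : IsIsolatedSphere D Ω f z₀ F) {I : A}
    (hI : I ∈ unitSphere A) {m : ℕ} :
    SlicePoleLE F I z₀ m ↔
      (fun z => evC I (conjPoly z₀ z ^ m • F z)) =O[𝓝[≠] z₀] (fun _ => (1 : ℝ)) := by
  constructor
  · intro hp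
    have c : (fun z => (z - conj z₀) ^ m) =O[𝓝[≠] z₀] (fun _ => (1 : ℝ)) :=
      isBigO_one_of_continuousAt (by fun_prop)
    refine (isBigO_evC_smul h.alt hI c hp).congr_left fun z => ?_
    rw [smul_smul, conjPoly, mul_pow, mul_comm]
  · intro hp
    have c : (fun z => ((z - conj z₀) ^ m)⁻¹) =O[𝓝[≠] z₀] (fun _ => (1 : ℝ)) :=
      isBigO_one_of_continuousAt (ContinuousAt.inv₀ (by fun_prop)
        (pow_ne_zero _ (sub_ne_zero.2 (conj_ne_self h.im_ne).symm)))
    refine (isBigO_evC_smul h.alt hI c hp).congr' ?_ EventuallyEq.rfl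
    filter_upwards [h.eventually_mem] with z hz
    have hzc : (z - conj z₀) ^ m ≠ 0 := by
      refine pow_ne_zero _ (sub_ne_zero.2 ?_)
      rintro rfl
      exact hz.2 (by simp)
    rw [smul_smul, conjPoly, mul_pow]
    congr 2
    field_simp

/-- If `F` has poles of order at most `m`, then `((z - z₀) (z - z̄₀)) ^ m F z` extends to a
holomorphic stem function on `D`. -/
theorem exists_extension (h : IsIsolatedSphere D Ω f z₀ F) {m : ℕ} (hp : PoleLE F z₀ m) :
    ∃ (G : ℂ → Coord A) (g : A → A), IsHolStem D G g ∧
      ∀ z ∈ D \ {z₀, conj z₀}, G z = conjPoly z₀ z ^ m • F z := by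
  set H : ℂ → Coord A := fun z => conjPoly z₀ z ^ m • F z with hH
  have hb0 : H =O[𝓝[≠] z₀] (fun _ => (1 : ℝ)) := hp.conjPoly_pow_isBigO
  have hb1 : H =O[𝓝[≠] (conj z₀)] (fun _ => (1 : ℝ)) := by
    have := ((h.poleLE_conj_iff m).2 hp).conjPoly_pow_isBigO
    simpa only [conjPoly_center] using this
  have hne := conj_ne_self h.im_ne
  have hHd : DifferentiableOn ℂ H (D \ {z₀, conj z₀}) := by
    have hc : Differentiable ℂ fun z => conjPoly z₀ z ^ m := by
      unfold conjPoly
      fun_prop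
    exact hc.differentiableOn.smul h.stem.differentiableOn
  have hs : D \ {conj z₀} ∈ 𝓝 z₀ :=
    (IsOpen.sdiff h.isOpen isClosed_singleton).mem_nhds ⟨h.mem, hne.symm⟩
  obtain ⟨G₁, hG₁, e₁⟩ := exists_differentiableOn_extension hs (hHd.mono fun z hz => by
    refine ⟨hz.1.1, ?_⟩
    rintro (rfl | hc)
    · exact hz.2 rfl
    · exact hz.1.2 hc) hb0
  have hb2 : G₁ =O[𝓝[≠] (conj z₀)] (fun _ => (1 : ℝ)) := by
    refine hb1.congr' ?_ EventuallyEq.rfl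
    filter_upwards [mem_nhdsWithin_of_mem_nhds (isOpen_ne.mem_nhds hne)] with z hz
    exact (e₁ z hz).symm
  obtain ⟨G, hG, e₂⟩ := exists_differentiableOn_extension
    (h.isOpen.mem_nhds (h.conj_mem _ h.mem)) hG₁ hb2
  have hGH : ∀ z ∈ D \ {z₀, conj z₀}, G z = H z := by
    rintro z ⟨-, hz⟩
    simp only [mem_insert_iff, mem_singleton_iff, not_or] at hz
    rw [e₂ z hz.2, e₁ z hz.1]
  have hGstar : ∀ z ∈ D \ {z₀, conj z₀}, G (conj z) = star (G z) := by
    intro z hz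
    rw [hGH z hz, hGH _ (h.stem.conj_mem z hz)]
    simp only [hH]
    rw [conjPoly_conj, h.stem.map_conj z hz, star_smul, ← map_pow]
    rfl
  have hG0 : G (conj z₀) = star (G z₀) := by
    have c1 : Tendsto (fun z => G (conj z)) (𝓝[≠] z₀) (𝓝 (G (conj z₀))) := by
      have hc : ContinuousAt G (conj z₀) :=
        (hG.differentiableAt (h.isOpen.mem_nhds (h.conj_mem _ h.mem))).continuousAt
      exact (ContinuousAt.comp (f := fun z : ℂ => conj z) hc
        Complex.continuous_conj.continuousAt).tendsto.mono_left nhdsWithin_le_nhds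
    have c2 : Tendsto (fun z => star (G z)) (𝓝[≠] z₀) (𝓝 (star (G z₀))) :=
      ((hG.differentiableAt (h.isOpen.mem_nhds h.mem)).continuousAt.tendsto.mono_left
        nhdsWithin_le_nhds).star
    refine tendsto_nhds_unique_of_eventuallyEq c1 c2 ?_
    filter_upwards [h.eventually_mem] with z hz using hGstar z hz
  have hstem : ∀ z ∈ D, G (conj z) = star (G z) := by
    intro z hz
    by_cases h1 : z = z₀
    · rw [h1, hG0]
    by_cases h2 : z = conj z₀
    · rw [h2, Complex.conj_conj, hG0, star_star]
    · exact hGstar z ⟨hz, by simp [h1, h2]⟩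
  obtain ⟨g, hg⟩ := exists_induced h.alt hstem
  exact ⟨G, g, ⟨h.isOpen, h.conj_mem, hG, hstem, hg⟩, hGH⟩

/-- A point of the sphere is removable exactly when `F` is bounded near `z₀`. This does not depend
on the point, because the domain of an extension is circular. -/
theorem isRemovable_iff (h : IsIsolatedSphere D Ω f z₀ F) {I : A} (hI : I ∈ unitSphere A) :
    IsRemovable Ω f (sl I z₀) ↔ PoleLE F z₀ 0 := by
  constructor
  · rintro ⟨-, Ω', g, -, -, hmem, hsub, hg, heq⟩
    obtain ⟨G, hG⟩ := hg.exists_isHolStem h.alt hI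
    have hGc : ContinuousAt G z₀ :=
      (hG.differentiableOn.differentiableAt (hG.isOpen.mem_nhds hmem)).continuousAt
    refine (isBigO_one_of_continuousAt hGc).congr' ?_ EventuallyEq.rfl
    filter_upwards [h.eventually_mem] with z hz
    rw [pow_zero, one_smul]
    refine eq_of_forall_evC_eq h.alt hI fun K hK => ?_
    have hmemΩ : ∀ K ∈ unitSphere A, sl K z ∈ Ω := fun K hK => by
      rw [h.eq_circ]
      exact ⟨z, hz, K, hK, rfl⟩
    rw [← h.stem.induced z hz K hK, ← hG.induced z (hsub (hmemΩ I hI)) K hK]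
    exact heq (hmemΩ K hK)
  · intro hp
    obtain ⟨G, g, hG, hGF⟩ := h.exists_extension hp
    refine ⟨h.isSingularity hI, circularization D, g, ⟨D, rfl⟩, h.isOpenInCone,
      ⟨z₀, h.mem, I, hI, rfl⟩, ?_, hG.sliceRegularOn ⟨z₀, h.mem⟩ h.isOpenInCone, ?_⟩
    · rw [h.eq_circ]
      rintro _ ⟨z, hz, K, hK, rfl⟩
      exact ⟨z, hz.1, K, hK, rfl⟩
    · rw [h.eq_circ]
      rintro _ ⟨z, hz, K, hK, rfl⟩
      rw [hG.induced z hz.1 K hK, h.stem.induced z hz K hK, hGF z hz, pow_zero, one_smul]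

/-- The sets `‖Δ_y‖ < ρ` are neighbourhoods of the sphere, and their points other than those of the
sphere have coordinates near `z₀` or near `z̄₀`. -/
theorem exists_isNhdIn_sphere (h : IsIsolatedSphere D Ω f z₀ F) {J : A} (hJ : J ∈ unitSphere A)
    {p : ℂ → Prop} (h1 : ∀ᶠ z in 𝓝[≠] z₀, p z) (h2 : ∀ᶠ z in 𝓝[≠] (conj z₀), p z) :
    ∃ U : Set A, IsNhdIn (circularization D) (sphere (sl J z₀)) U ∧
      ∀ x ∈ U \ sphere (sl J z₀), ∃ K ∈ unitSphere A, ∃ z ∈ D \ {z₀, conj z₀}, x = sl K z ∧ p z := by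
  obtain ⟨ρ, hρ, hp⟩ := eventually_nhdsNE_iff.1 (eventually_of_conjPoly_eq h1 h2)
  have hcont : Continuous fun x : A => Delta (sl J z₀) x := continuous_Delta _
  refine ⟨{x | ‖Delta (sl J z₀) x‖ < ρ} ∩ circularization D, ⟨inter_subset_right,
    {x | ‖Delta (sl J z₀) x‖ < ρ}, isOpen_lt hcont.norm continuous_const, fun x hx => ?_,
    subset_rfl⟩, ?_⟩
  · obtain ⟨K, hK, rfl⟩ := (mem_sphere_sl_iff h.alt hJ).1 hx
    have : Delta (sl J z₀) (sl K z₀) = 0 := by rw [Delta_sl hJ hK, sub_self, zero_mul, sl_zero]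
    rw [mem_ofPred_eq, this, norm_zero]
    exact hρ
  · rintro _ ⟨⟨hx, z, hz, K, hK, rfl⟩, hns⟩
    rw [sl_mem_sphere_iff h.alt hJ hK] at hns
    rw [mem_ofPred_eq, Delta_sl hJ hK, norm_sl h.alt hK] at hx
    have h0 : conjPoly z₀ z ≠ 0 := fun hc => hns (conjPoly_eq_zero_iff.1 hc)
    exact ⟨K, hK, z, ⟨hz, hns⟩, rfl, hp (conjPoly z₀ z) (by
      rw [sub_zero]; exact norm_pos_iff.2 h0) (by rw [sub_zero]; exact hx) z rfl⟩

theorem eventually_sl_mem_of_isNhdIn (h : IsIsolatedSphere D Ω f z₀ F) {K : A} {X S U : Set A}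
    (hU : IsNhdIn X S U) (hS : sl K z₀ ∈ S) (hX : ∀ z ∈ D, sl K z ∈ X) :
    ∀ᶠ z in 𝓝[≠] z₀, sl K z ∈ U ∧ z ∈ D \ {z₀, conj z₀} := by
  obtain ⟨-, V, hV, hSV, hVU⟩ := hU
  have h1 : ∀ᶠ z in 𝓝[≠] z₀, sl K z ∈ V :=
    (((continuous_sl K).continuousAt).eventually_mem (hV.mem_nhds (hSV hS))).filter_mono
      nhdsWithin_le_nhds
  filter_upwards [h1, h.eventually_mem] with z hz hzD
  exact ⟨hVU ⟨hz, hX z hzD.1⟩, hzD⟩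

theorem exists_isNhdIn_slice (h : IsIsolatedSphere D Ω f z₀ F) {J : A} (hJ : J ∈ unitSphere A)
    {p : ℂ → Prop} (h1 : ∀ᶠ z in 𝓝[≠] z₀, p z) :
    ∃ U : Set A, IsNhdIn (circularization D ∩ slice J) {sl J z₀} U ∧ sl J (conj z₀) ∉ U ∧
      ∀ x ∈ U \ {sl J z₀}, ∃ z ∈ D \ {z₀, conj z₀}, x = sl J z ∧ p z := by
  obtain ⟨R, hR, hp⟩ := eventually_nhdsNE_iff.1 (h1.and h.eventually_mem)
  have hy' : sl J (conj z₀) ≠ sl J z₀ := fun hc =>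
    conj_ne_self h.im_ne (sl_injective h.alt hJ hc)
  refine ⟨(Metric.ball (sl J z₀) R \ {sl J (conj z₀)}) ∩ (circularization D ∩ slice J),
    ⟨inter_subset_right, _, Metric.isOpen_ball.sdiff isClosed_singleton, ?_, subset_rfl⟩,
    fun hc => hc.1.2 rfl, ?_⟩
  · rintro _ rfl
    exact ⟨Metric.mem_ball_self hR, hy'.symm⟩
  · rintro _ ⟨⟨⟨hb, hne⟩, -, z, rfl⟩, hne'⟩
    rw [Metric.mem_ball, dist_eq_norm, ← sl_sub, norm_sl h.alt hJ] at hb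
    have hz0 : z ≠ z₀ := fun hc => hne' (by rw [hc]; rfl)
    obtain ⟨h2, h3⟩ := hp z (norm_pos_iff.2 (sub_ne_zero.2 hz0)) hb
    exact ⟨z, h3, rfl, h2⟩

end IsIsolatedSphere

end Extension

/-! ### Orders and the three types of spheres -/

section Order

open ComplexConjugate

theorem iInf_nat_le_iff {p : ℕ → Prop} {m : ℕ} :
    (⨅ (n : ℕ) (_ : p n), (n : ℕ∞)) ≤ m ↔ ∃ n ≤ m, p n := by
  classical
  constructor
  · intro h
    by_contra! hc
    have : ((m + 1 : ℕ) : ℕ∞) ≤ ⨅ (n : ℕ) (_ : p n), (n : ℕ∞) :=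
      le_iInf₂ fun n hn => by
        rw [Nat.cast_le]
        by_contra hlt
        exact hc n (by omega) hn
    have h2 := this.trans h
    rw [Nat.cast_le] at h2
    omega
  · rintro ⟨n, hn, hp⟩
    exact (iInf₂_le n hp).trans (by rwa [Nat.cast_le])

theorem iInf_nat_eq_top_iff {p : ℕ → Prop} :
    (⨅ (n : ℕ) (_ : p n), (n : ℕ∞)) = ⊤ ↔ ∀ n, ¬ p n := by
  simp only [iInf_eq_top]
  exact forall_congr' fun n => ⟨fun h hp => ENat.natCast_ne_top n (h hp), fun h hp => absurd hp h⟩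

variable {A : Type*} [NormedNonAssocRing A] [NormedSpace ℝ A] [FiniteDimensional ℝ A]
  [IsScalarTower ℝ A A] [SMulCommClass ℝ A A] [StarRing A] [StarModule ℝ A] [Nontrivial A]

namespace IsIsolatedSphere

variable {D : Set ℂ} {Ω : Set A} {f : A → A} {z₀ : ℂ} {F : ℂ → Coord A}

theorem ord_le_iff (h : IsIsolatedSphere D Ω f z₀ F) {I : A} (hI : I ∈ unitSphere A) {m : ℕ} :
    ord Ω f (sl I z₀) ≤ m ↔ SlicePoleLE F I z₀ m := by
  rw [ord, iInf_nat_le_iff]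
  simp only [h.isPoleOfOrderLE_iff hI]
  exact ⟨fun ⟨n, hn, hp⟩ => hp.mono h.alt hI hn, fun hp => ⟨m, le_rfl, hp⟩⟩

theorem ord_eq_top_iff (h : IsIsolatedSphere D Ω f z₀ F) {I : A} (hI : I ∈ unitSphere A) :
    ord Ω f (sl I z₀) = ⊤ ↔ ∀ m, ¬ SlicePoleLE F I z₀ m := by
  rw [ord, iInf_nat_eq_top_iff]
  simp only [h.isPoleOfOrderLE_iff hI]

theorem sphericalOrd_le_iff (h : IsIsolatedSphere D Ω f z₀ F) {J : A} (hJ : J ∈ unitSphere A)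
    {m : ℕ} : sphericalOrd Ω f (sl J z₀) ≤ (2 * m : ℕ) ↔ PoleLE F z₀ m := by
  rw [sphericalOrd, iInf_nat_le_iff]
  constructor
  · rintro ⟨n, hn, hev, hc⟩
    obtain ⟨k, rfl⟩ := hev.two_dvd
    refine ((h.exists_isSphericalExpansion_iff_poleLE hJ k).1 ?_).mono (by omega)
    simpa using hc
  · intro hp
    refine ⟨2 * m, le_rfl, even_two_mul m, ?_⟩
    simpa using (h.exists_isSphericalExpansion_iff_poleLE hJ m).2 hp

theorem sphericalOrd_eq_top_iff (h : IsIsolatedSphere D Ω f z₀ F) {J : A}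
    (hJ : J ∈ unitSphere A) : sphericalOrd Ω f (sl J z₀) = ⊤ ↔ ∀ m, ¬ PoleLE F z₀ m := by
  constructor
  · intro ht m hp
    have := (h.sphericalOrd_le_iff hJ).2 hp
    rw [ht, top_le_iff] at this
    exact ENat.natCast_ne_top _ this
  · intro hp
    by_contra hne
    obtain ⟨n, hn⟩ := ENat.ne_top_iff_exists.1 hne
    refine hp n ((h.sphericalOrd_le_iff hJ).1 ?_)
    rw [← hn, Nat.cast_le]
    omega

theorem sphericalOrd_eq (h : IsIsolatedSphere D Ω f z₀ F) {J : A} (hJ : J ∈ unitSphere A) {k : ℕ}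
    (hk : PoleLE F z₀ k) (hmin : ∀ m, PoleLE F z₀ m → k ≤ m) :
    sphericalOrd Ω f (sl J z₀) = 2 * (k : ℕ∞) := by
  refine le_antisymm (by exact_mod_cast (h.sphericalOrd_le_iff hJ).2 hk) ?_
  refine le_iInf₂ ?_
  rintro n ⟨hev, hc⟩
  obtain ⟨j, rfl⟩ := hev.two_dvd
  have := hmin j ((h.exists_isSphericalExpansion_iff_poleLE hJ j).1 (by simpa using hc))
  exact_mod_cast Nat.mul_le_mul_left 2 this

theorem ord_eq (h : IsIsolatedSphere D Ω f z₀ F) {I : A} (hI : I ∈ unitSphere A) {k : ℕ}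
    (hk : SlicePoleLE F I z₀ k) (hmin : ∀ m, SlicePoleLE F I z₀ m → k ≤ m) :
    ord Ω f (sl I z₀) = (k : ℕ∞) := by
  refine le_antisymm ((h.ord_le_iff hI).2 hk) (le_iInf₂ fun n hn => ?_)
  exact_mod_cast hmin n ((h.isPoleOfOrderLE_iff hI n).1 hn)

theorem allRemovable_iff (h : IsIsolatedSphere D Ω f z₀ F) {J : A} (hJ : J ∈ unitSphere A) :
    AllRemovable Ω f (sl J z₀) ↔ PoleLE F z₀ 0 := by
  constructor
  · intro hall
    exact (h.isRemovable_iff hJ).1 (hall _ ((mem_sphere_sl_iff h.alt hJ).2 ⟨J, hJ, rfl⟩))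
  · intro hp w hw
    obtain ⟨I, hI, rfl⟩ := (mem_sphere_sl_iff h.alt hJ).1 hw
    exact (h.isRemovable_iff hI).2 hp

theorem isPole_iff (h : IsIsolatedSphere D Ω f z₀ F) {I : A} (hI : I ∈ unitSphere A) :
    IsPole Ω f (sl I z₀) ↔ ∃ m, SlicePoleLE F I z₀ m := by
  simp only [IsPole, h.isPoleOfOrderLE_iff hI]

theorem exists_poleLE_iff (h : IsIsolatedSphere D Ω f z₀ F) {I : A} (hI : I ∈ unitSphere A) :
    (∃ m, PoleLE F z₀ m) ↔ (∃ m, SlicePoleLE F I z₀ m) ∧ ∃ m, SlicePoleLE F (-I) z₀ m := by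
  constructor
  · rintro ⟨m, hm⟩
    have := (poleLE_iff_slicePoleLE h.alt hI).1 hm
    exact ⟨⟨m, this.1⟩, ⟨m, this.2⟩⟩
  · rintro ⟨⟨m, hm⟩, ⟨n, hn⟩⟩
    exact ⟨max m n, (poleLE_iff_slicePoleLE h.alt hI).2 ⟨hm.mono h.alt hI (le_max_left _ _),
      hn.mono h.alt (neg_mem_unitSphere hI) (le_max_right _ _)⟩⟩

theorem allNonremovablePoles_iff (h : IsIsolatedSphere D Ω f z₀ F) {J : A}
    (hJ : J ∈ unitSphere A) :
    AllNonremovablePoles Ω f (sl J z₀) ↔ (∃ m, PoleLE F z₀ m) ∧ ¬ PoleLE F z₀ 0 := by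
  constructor
  · intro hall
    have h1 := hall _ ((mem_sphere_sl_iff h.alt hJ).2 ⟨J, hJ, rfl⟩)
    have h2 := hall _ ((mem_sphere_sl_iff h.alt hJ).2 ⟨-J, neg_mem_unitSphere hJ, rfl⟩)
    exact ⟨(h.exists_poleLE_iff hJ).2
      ⟨(h.isPole_iff hJ).1 h1.1, (h.isPole_iff (neg_mem_unitSphere hJ)).1 h2.1⟩,
      fun hp => h1.2 ((h.isRemovable_iff hJ).2 hp)⟩
  · rintro ⟨hm, h0⟩ w hw
    obtain ⟨I, hI, rfl⟩ := (mem_sphere_sl_iff h.alt hJ).1 hw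
    exact ⟨(h.isPole_iff hI).2 ((h.exists_poleLE_iff hI).1 hm).1,
      fun hr => h0 ((h.isRemovable_iff hI).1 hr)⟩

theorem essentialInEverySlice_iff (h : IsIsolatedSphere D Ω f z₀ F) {J : A}
    (hJ : J ∈ unitSphere A) :
    EssentialInEverySlice Ω f (sl J z₀) ↔ ∀ m, ¬ PoleLE F z₀ m := by
  have hess : ∀ I ∈ unitSphere A, (¬ ∃ m, SlicePoleLE F I z₀ m) → IsEssential Ω f (sl I z₀) :=
    fun I hI hn => ⟨h.isSingularity hI, (h.existsUnique_isLaurentExpansion hI).exists,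
      fun hp => hn ((h.isPole_iff hI).1 hp)⟩
  constructor
  · intro hall m hp
    obtain ⟨w, ⟨hw, -⟩, -, -, hnp⟩ := hall J hJ
    obtain ⟨I, hI, rfl⟩ := (mem_sphere_sl_iff h.alt hJ).1 hw
    exact hnp ((h.isPole_iff hI).2 ((h.exists_poleLE_iff hI).1 ⟨m, hp⟩).1)
  · intro hn I hI
    have hI' := neg_mem_unitSphere hI
    by_cases h1 : ∃ m, SlicePoleLE F I z₀ m
    · by_cases h2 : ∃ m, SlicePoleLE F (-I) z₀ m
      · obtain ⟨m, hm⟩ := (h.exists_poleLE_iff hI).2 ⟨h1, h2⟩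
        exact absurd hm (hn m)
      · exact ⟨sl (-I) z₀, ⟨(mem_sphere_sl_iff h.alt hJ).2 ⟨-I, hI', rfl⟩,
          ⟨conj z₀, (sl_neg I z₀).symm⟩⟩, hess _ hI' h2⟩
    · exact ⟨sl I z₀, ⟨(mem_sphere_sl_iff h.alt hJ).2 ⟨I, hI, rfl⟩, ⟨z₀, rfl⟩⟩, hess _ hI h1⟩

end IsIsolatedSphere

end Order

/-! ### Boundedness near the sphere and behaviour of extensions -/

section Characterizations

open ComplexConjugate

variable {A : Type*} [NormedNonAssocRing A] [NormedSpace ℝ A] [FiniteDimensional ℝ A]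
  [IsScalarTower ℝ A A] [SMulCommClass ℝ A A] [StarRing A] [StarModule ℝ A] [Nontrivial A]

namespace IsIsolatedSphere

variable {D : Set ℂ} {Ω : Set A} {f : A → A} {z₀ : ℂ} {F : ℂ → Coord A}

theorem apow_sub_mul_eq (h : IsIsolatedSphere D Ω f z₀ F) {J : A} (hJ : J ∈ unitSphere A) {z : ℂ}
    (hz : z ∈ D \ {z₀, conj z₀}) (k : ℕ) :
    apow (sl J z - sl J z₀) k * f (sl J z) = evC J ((z - z₀) ^ k • F z) := by
  rw [← sl_sub, apow_sl hJ, h.stem.induced z hz J hJ, evC_smul h.alt hJ]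

theorem apow_Delta_mul_eq (h : IsIsolatedSphere D Ω f z₀ F) {J K : A} (hJ : J ∈ unitSphere A)
    (hK : K ∈ unitSphere A) {z : ℂ} (hz : z ∈ D \ {z₀, conj z₀}) (k : ℕ) :
    apow (Delta (sl J z₀) (sl K z)) k * f (sl K z) = evC K (conjPoly z₀ z ^ k • F z) := by
  rw [Delta_sl hJ hK, ← conjPoly, apow_sl hK, h.stem.induced z hz K hK, evC_smul h.alt hK]

theorem apow_mul_apow_mul_eq (h : IsIsolatedSphere D Ω f z₀ F) {J : A} (hJ : J ∈ unitSphere A)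
    {z : ℂ} (hz : z ∈ D \ {z₀, conj z₀}) (k : ℕ) :
    (apow (sl J z - sl J z₀) k * apow (sl J z - star (sl J z₀)) k) * f (sl J z) =
      evC J (conjPoly z₀ z ^ k • F z) := by
  rw [star_sl hJ, ← sl_sub, ← sl_sub, apow_sl hJ, apow_sl hJ, ← sl_mul hJ, ← mul_pow, ← conjPoly,
    h.stem.induced z hz J hJ, evC_smul h.alt hJ]

/-- Boundedness of `Δ_y ^ k f` near the sphere bounds the pole order of the stem function by `k`. -/
theorem exists_bound_sphere_iff (h : IsIsolatedSphere D Ω f z₀ F) {J : A} (hJ : J ∈ unitSphere A)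
    (k : ℕ) :
    (∃ U : Set A, IsNhdIn (circularization D) (sphere (sl J z₀)) U ∧
      ∃ M : ℝ, ∀ x ∈ U \ sphere (sl J z₀), ‖apow (Delta (sl J z₀) x) k * f x‖ ≤ M) ↔
      PoleLE F z₀ k := by
  constructor
  · rintro ⟨U, hU, M, hM⟩
    have key : ∀ K ∈ unitSphere A, SlicePoleLE F K z₀ k := by
      intro K hK
      rw [h.slicePoleLE_iff_conjPoly hK]
      refine Asymptotics.IsBigO.of_bound M ?_
      filter_upwards [h.eventually_sl_mem_of_isNhdIn hU ((mem_sphere_sl_iff h.alt hJ).2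
        ⟨K, hK, rfl⟩) fun z hz => ⟨z, hz, K, hK, rfl⟩] with z ⟨hzU, hzD⟩
      rw [norm_one, mul_one, ← h.apow_Delta_mul_eq hJ hK hzD]
      exact hM _ ⟨hzU, fun hc => hzD.2 ((sl_mem_sphere_iff h.alt hJ hK).1 hc)⟩
    exact (poleLE_iff_slicePoleLE h.alt hJ).2 ⟨key J hJ, key (-J) (neg_mem_unitSphere hJ)⟩
  · intro hp
    obtain ⟨C, hC, hev⟩ := exists_norm_evC_le h.alt
    obtain ⟨M, hM⟩ := hp.conjPoly_pow_isBigO.bound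
    obtain ⟨M', hM'⟩ := ((h.poleLE_conj_iff k).2 hp).conjPoly_pow_isBigO.bound
    simp only [norm_one, mul_one, conjPoly_center] at hM hM'
    obtain ⟨U, hU, hb⟩ := h.exists_isNhdIn_sphere hJ
      (p := fun z => ‖conjPoly z₀ z ^ k • F z‖ ≤ max M M')
      (hM.mono fun z hz => hz.trans (le_max_left _ _))
      (hM'.mono fun z hz => hz.trans (le_max_right _ _))
    refine ⟨U, hU, C * max M M', fun x hx => ?_⟩
    obtain ⟨K, hK, z, hz, rfl, hz'⟩ := hb x hx
    rw [h.apow_Delta_mul_eq hJ hK hz]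
    exact (hev K hK _).trans (by gcongr)

theorem exists_bound_slice_iff (h : IsIsolatedSphere D Ω f z₀ F) {J : A} (hJ : J ∈ unitSphere A) :
    (∃ U : Set A, IsNhdIn (circularization D ∩ slice J) {sl J z₀, star (sl J z₀)} U ∧
      ∃ M : ℝ, ∀ z ∈ U \ {sl J z₀, star (sl J z₀)}, ‖f z‖ ≤ M) ↔ PoleLE F z₀ 0 := by
  rw [star_sl hJ]
  constructor
  · rintro ⟨U, hU, M, hM⟩
    have key : ∀ {z₁}, IsIsolatedSphere D Ω f z₁ F → (z₁ = z₀ ∨ z₁ = conj z₀) →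
        SlicePoleLE F J z₁ 0 := by
      intro z₁ h₁ hz₁
      refine Asymptotics.IsBigO.of_bound M ?_
      filter_upwards [h₁.eventually_sl_mem_of_isNhdIn (K := J) hU
        (by rcases hz₁ with rfl | rfl <;> simp)
        fun z hz => ⟨⟨z, hz, J, hJ, rfl⟩, ⟨z, rfl⟩⟩, h₁.eventually_mem] with z ⟨hzU, hzD⟩ _
      rw [norm_one, mul_one, pow_zero, one_smul, ← h₁.stem.induced z hzD J hJ]
      refine hM _ ⟨hzU, ?_⟩
      have hinj := sl_injective h.alt hJ
      rintro (hc | hc)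
      · rcases hz₁ with rfl | rfl
        · exact hzD.2 (Or.inl (hinj hc))
        · exact hzD.2 (Or.inr (by rw [Complex.conj_conj]; exact hinj hc))
      · rcases hz₁ with rfl | rfl
        · exact hzD.2 (Or.inr (hinj hc))
        · exact hzD.2 (Or.inl (hinj hc))
    exact (poleLE_iff_slicePoleLE h.alt hJ).2 ⟨key h (Or.inl rfl),
      h.slicePoleLE_conj_iff.1 (key h.conj_center (Or.inr rfl))⟩
  · intro hp
    obtain ⟨U, ⟨hUX, V, hV, hSV, hVU⟩, M, hM⟩ := (h.exists_bound_sphere_iff hJ 0).2 hp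
    refine ⟨U ∩ slice J, ⟨inter_subset_inter_left _ hUX, V, hV, ?_, ?_⟩, M, ?_⟩
    · rintro x (rfl | rfl)
      · exact hSV ((sl_mem_sphere_iff h.alt hJ hJ).2 (Or.inl rfl))
      · exact hSV ((sl_mem_sphere_iff h.alt hJ hJ).2 (Or.inr rfl))
    · exact fun x hx => ⟨hVU ⟨hx.1, hx.2.1⟩, hx.2.2⟩
    · rintro _ ⟨⟨hzU, z, rfl⟩, hne⟩
      have := hM (sl J z) ⟨hzU, fun hc => hne ?_⟩
      · rwa [apow, one_mul] at this
      · rcases (sl_mem_sphere_iff h.alt hJ hJ).1 hc with rfl | rfl <;> simp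

theorem forall_not_bddAbove_slice_iff (h : IsIsolatedSphere D Ω f z₀ F) {J : A}
    (hJ : J ∈ unitSphere A) :
    (∀ U : Set A, IsNhdIn (circularization D ∩ slice J) {sl J z₀} U → sl J (conj z₀) ∉ U →
      ∀ k : ℕ, ¬ BddAbove ((fun z => ‖apow (z - sl J z₀) k * f z‖) '' (U \ {sl J z₀}))) ↔
      ¬ ∃ m, SlicePoleLE F J z₀ m := by
  constructor
  · rintro hall ⟨m, hm⟩
    obtain ⟨M, hM⟩ := hm.bound
    obtain ⟨U, hU, hnU, hb⟩ := h.exists_isNhdIn_slice hJ hM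
    refine hall U hU hnU m ⟨M, ?_⟩
    rintro _ ⟨x, hx, rfl⟩
    obtain ⟨z, hz, rfl, hz'⟩ := hb x hx
    simp only
    rw [h.apow_sub_mul_eq hJ hz]
    simpa using hz'
  · rintro hn U hU - k ⟨M, hM⟩
    refine hn ⟨k, Asymptotics.IsBigO.of_bound M ?_⟩
    filter_upwards [h.eventually_sl_mem_of_isNhdIn (K := J) hU rfl
      fun z hz => ⟨⟨z, hz, J, hJ, rfl⟩, ⟨z, rfl⟩⟩] with z ⟨hzU, hzD⟩
    rw [norm_one, mul_one, ← h.apow_sub_mul_eq hJ hzD]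
    exact hM ⟨sl J z, ⟨hzU, fun hc => hzD.2 (Or.inl (sl_injective h.alt hJ hc))⟩, rfl⟩

/-- If `((z - z₀) (z - z̄₀)) ^ k F z`, evaluated at `I`, has a non-zero limit at `z₀`, then the pole
order of `F` on the slice of `I` is at least `k`. -/
theorem le_of_slicePoleLE (h : IsIsolatedSphere D Ω f z₀ F) {I : A} (hI : I ∈ unitSphere A) {k : ℕ}
    {a : A} (ha : a ≠ 0)
    (ht : Tendsto (fun z => evC I (conjPoly z₀ z ^ k • F z)) (𝓝[≠] z₀) (𝓝 a)) {m : ℕ}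
    (hm : SlicePoleLE F I z₀ m) : k ≤ m := by
  by_contra hlt
  obtain ⟨j, hj⟩ := Nat.exists_eq_add_of_lt (not_le.1 hlt)
  have h1 := (h.slicePoleLE_iff_conjPoly hI).1 hm
  have h2 := ((embC I).isBigO_comp _ _).trans h1
  have h3 : Tendsto (fun z => conjPoly z₀ z ^ (j + 1)) (𝓝[≠] z₀) (𝓝 0) := by
    have hc : Continuous fun z => conjPoly z₀ z ^ (j + 1) := (continuous_conjPoly z₀).pow (j + 1)
    refine (hc.tendsto' z₀ 0 ?_).mono_left nhdsWithin_le_nhds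
    rw [conjPoly_eq_zero_iff.2 (Or.inl rfl), zero_pow (Nat.succ_ne_zero j)]
  have h4 : Tendsto (fun z => conjPoly z₀ z ^ (j + 1) • embC I (evC I (conjPoly z₀ z ^ m • F z)))
      (𝓝[≠] z₀) (𝓝 0) := by
    have h5 := ((Asymptotics.isLittleO_one_iff ℝ).2 h3).smul_isBigO h2
    exact (Asymptotics.isLittleO_one_iff ℝ).1 (h5.congr_right fun z => by simp)
  have h6 := ((evC I).continuous.tendsto 0).comp h4
  rw [map_zero] at h6
  refine ha (tendsto_nhds_unique ht (h6.congr fun z => ?_))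
  simp only [Function.comp]
  rw [evC_smul h.alt hI, evC_embC h.alt hI, ← evC_smul h.alt hI, smul_smul, ← pow_add, hj]
  congr 3
  ring

/-- If an extension `G` of `((z - z₀) (z - z̄₀)) ^ k F z` evaluates to `0` at the point `α₀ + β₀ I`,
one factor `z - z₀` can be cancelled there, so the pole order at this point is less than `k`. -/
theorem slicePoleLE_pred (h : IsIsolatedSphere D Ω f z₀ F) {I : A} (hI : I ∈ unitSphere A) {k : ℕ}
    (hk : k ≠ 0) {G : ℂ → Coord A} (hG : DifferentiableAt ℂ G z₀)
    (hGF : ∀ z ∈ D \ {z₀, conj z₀}, G z = conjPoly z₀ z ^ k • F z) (h0 : evC I (G z₀) = 0) :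
    SlicePoleLE F I z₀ (k - 1) := by
  obtain ⟨j, rfl⟩ := Nat.exists_eq_succ_of_ne_zero hk
  obtain ⟨L, hL⟩ := exists_projection h.alt hI
  have hd : DifferentiableAt ℂ (fun z => L (G z)) z₀ := L.differentiableAt.comp z₀ hG
  have hO := hd.isBigO_sub.mono (nhdsWithin_le_nhds (s := {z₀}ᶜ))
  simp only [hL, h0, map_zero, sub_zero] at hO
  have hinv : (fun z : ℂ => (z - z₀)⁻¹) =O[𝓝[≠] z₀] (fun z => (z - z₀)⁻¹) :=
    Asymptotics.isBigO_refl _ _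
  have h1 : (fun z => (z - z₀)⁻¹ • embC I (evC I (G z))) =O[𝓝[≠] z₀] (fun _ => (1 : ℝ)) := by
    refine (hinv.smul hO).trans (Asymptotics.IsBigO.of_bound 1 ?_)
    filter_upwards [self_mem_nhdsWithin] with z hz
    rw [smul_eq_mul, inv_mul_cancel₀ (sub_ne_zero.2 hz)]
    simp
  have c : (fun z => ((z - conj z₀) ^ (j + 1))⁻¹) =O[𝓝[≠] z₀] (fun _ => (1 : ℝ)) :=
    isBigO_one_of_continuousAt (ContinuousAt.inv₀ (by fun_prop)
      (pow_ne_zero _ (sub_ne_zero.2 (conj_ne_self h.im_ne).symm)))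
  rw [slicePoleLE_iff h.alt hI]
  refine (isBigO_one_smul c h1).congr' ?_ EventuallyEq.rfl
  filter_upwards [h.eventually_mem] with z hz
  have hz' := hz.2
  simp only [mem_insert_iff, mem_singleton_iff, not_or] at hz'
  have hz1 := sub_ne_zero.2 hz'.1
  have hz2 := sub_ne_zero.2 hz'.2
  rw [hGF z hz, evC_smul h.alt hI, embC_sl_mul h.alt hI, smul_smul, smul_smul]
  congr 1
  rw [conjPoly, mul_pow, Nat.succ_eq_add_one, Nat.add_sub_cancel, pow_succ (z - z₀)]
  field_simp

end IsIsolatedSphere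

/-- A slice function with continuous stem function is continuous away from the real line. -/
theorem IsHolStem.continuousWithinAt (hA : AltNormed A) {D : Set ℂ} {G : ℂ → Coord A} {g : A → A}
    (hG : IsHolStem D G g) {I : A} (hI : I ∈ unitSphere A) {z₀ : ℂ} (hz₀ : z₀ ∈ D)
    (him : z₀.im ≠ 0) : ContinuousWithinAt g (circularization D) (sl I z₀) := by
  -- `sl (-I) (conj z₀)` is the same point as `sl I z₀`
  wlog hpos : 0 < z₀.im generalizing I z₀
  · have := this (neg_mem_unitSphere hI) (hG.conj_mem _ hz₀) (by simpa using him)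
      (by simpa using lt_of_le_of_ne (not_lt.1 hpos) him)
    rwa [sl_neg, Complex.conj_conj] at this
  obtain ⟨ℓ, hℓ⟩ := SeparatingDual.exists_eq_one (R := ℝ) (one_ne_zero (α := A))
  have hstar : Continuous fun x : A => star x :=
    (starLinearEquiv ℝ (A := A)).toLinearMap.continuous_of_finiteDimensional
  have hre : Continuous fun x : A => rePart x := (continuous_id.add hstar).const_smul _
  have him' : Continuous fun x : A => imPart x := (continuous_id.sub hstar).const_smul _
  -- the coordinates `Z x` and `N x` of a point `x = α + β I` with `β > 0`
  set Z : A → ℂ := fun x => (ℓ (rePart x) : ℂ) + (‖imPart x‖ : ℂ) * Complex.I with hZ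
  set N : A → A := fun x => ‖imPart x‖⁻¹ • imPart x with hN
  have hcoord : ∀ K ∈ unitSphere A, ∀ z : ℂ, 0 < z.im → Z (sl K z) = z ∧ N (sl K z) = K := by
    intro K hK z hz
    have e1 : ‖imPart (sl K z)‖ = z.im := by rw [norm_imPart_sl hA hK, abs_of_pos hz]
    constructor
    · simp only [hZ, e1, rePart_sl hK, map_smul, hℓ, smul_eq_mul, mul_one, Complex.re_add_im]
    · simp only [hN]
      rw [e1, imPart_sl hK, inv_smul_smul₀ hz.ne']
  have hZc : Continuous Z := by
    have h1 : Continuous fun x => ℓ (rePart x) := ℓ.continuous.comp hre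
    have h2 : Continuous fun x : A => ‖imPart x‖ := him'.norm
    exact (Complex.continuous_ofReal.comp h1).add
      ((Complex.continuous_ofReal.comp h2).mul continuous_const)
  have hn0 : ‖imPart (sl I z₀)‖ ≠ 0 := by
    rw [norm_imPart_sl hA hI]
    exact abs_ne_zero.2 him
  have hNc : ContinuousAt N (sl I z₀) :=
    (him'.norm.continuousAt.inv₀ hn0).smul him'.continuousAt
  set T : Coord A →L[ℝ] A × A := ((toCoord A).symm : Coord A →L[ℝ] A × A) with hT
  have hev : ∀ (K : A) (e : Coord A), evC K e = (T e).1 + K * (T e).2 := fun _ _ => rfl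
  have hGZ : ContinuousAt (fun x => T (G (Z x))) (sl I z₀) := by
    have hGc : ContinuousAt G (Z (sl I z₀)) := by
      rw [(hcoord I hI z₀ hpos).1]
      exact (hG.differentiableOn.differentiableAt (hG.isOpen.mem_nhds hz₀)).continuousAt
    exact T.continuous.continuousAt.comp (hGc.comp hZc.continuousAt)
  have hΦ : ContinuousAt (fun x => (T (G (Z x))).1 + N x * (T (G (Z x))).2) (sl I z₀) := by
    have hm : ContinuousAt (fun x => N x * (T (G (Z x))).2) (sl I z₀) :=
      (continuous_mul_of_finiteDimensional (A := A)).continuousAt.comp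
        (f := fun x => (N x, (T (G (Z x))).2)) (hNc.prodMk hGZ.snd)
    exact hGZ.fst.add hm
  have hpt : ∀ K ∈ unitSphere A, ∀ z ∈ D, 0 < z.im →
      g (sl K z) = (T (G (Z (sl K z)))).1 + N (sl K z) * (T (G (Z (sl K z)))).2 := by
    intro K hK z hz hzim
    rw [(hcoord K hK z hzim).1, (hcoord K hK z hzim).2, ← hev, hG.induced z hz K hK]
  refine hΦ.continuousWithinAt.congr_of_eventuallyEq ?_ (hpt I hI z₀ hz₀ hpos)
  have hne : ∀ᶠ x in 𝓝[circularization D] (sl I z₀), ‖imPart x‖ ≠ 0 :=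
    ((him'.norm.continuousAt).eventually_ne hn0).filter_mono nhdsWithin_le_nhds
  filter_upwards [hne, self_mem_nhdsWithin] with x hx hxD
  obtain ⟨z, hz, K, hK, rfl⟩ := hxD
  rw [norm_imPart_sl hA hK, abs_ne_zero] at hx
  rcases lt_or_gt_of_ne hx with hlt | hgt
  · have := hpt (-K) (neg_mem_unitSphere hK) (conj z) (hG.conj_mem _ hz) (by simpa using hlt)
    rwa [sl_neg, Complex.conj_conj] at this
  · exact hpt K hK z hz hgt

theorem continuous_apow {X : Type*} [TopologicalSpace X] {u : X → A} (hu : Continuous u) (k : ℕ) :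
    Continuous fun x => apow (u x) k := by
  induction k with
  | zero => exact continuous_const
  | succ k ih => exact continuous_mul_of_finiteDimensional.comp (hu.prodMk ih)

/-- If `u f` has a non-zero limit and `u` tends to `0`, then `‖f‖` tends to `+∞`. The norm of `A`
need not be submultiplicative; the product is bounded for it by finite dimension. -/
theorem tendsto_norm_atTop_of_tendsto_mul {l : Filter A} {u f g : A → A} {b : A} (hb : b ≠ 0)
    (hg : Tendsto g l (𝓝 b)) (hu : Tendsto u l (𝓝 0)) (hgu : ∀ᶠ x in l, g x = u x * f x) :
    Tendsto (fun x => ‖f x‖) l atTop := by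
  obtain ⟨C, hC, hmul⟩ := exists_norm_mul_le (A := A)
  have hb' : 0 < ‖b‖ := norm_pos_iff.2 hb
  rw [tendsto_atTop]
  intro B
  have h1 : ∀ᶠ x in l, ‖b‖ / 2 < ‖g x‖ := hg.norm.eventually (lt_mem_nhds (by linarith))
  have h2 : ∀ᶠ x in l, ‖u x‖ < ‖b‖ / 2 / (C * (|B| + 1)) := by
    have := hu.norm
    rw [norm_zero] at this
    exact this.eventually (gt_mem_nhds (by positivity))
  filter_upwards [h1, h2, hgu] with x hx1 hx2 hx3
  by_contra hlt
  have h3 : ‖f x‖ ≤ |B| + 1 := by linarith [le_abs_self B, not_le.1 hlt]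
  have h4 : C * ‖u x‖ * ‖f x‖ ≤ ‖u x‖ * (C * (|B| + 1)) := by
    calc C * ‖u x‖ * ‖f x‖ ≤ C * ‖u x‖ * (|B| + 1) := by gcongr
      _ = ‖u x‖ * (C * (|B| + 1)) := by ring
  -- hence `‖g x‖ < ‖b‖ / 2`, against the choice of `x`
  have h5 : ‖u x‖ * (C * (|B| + 1)) < ‖b‖ / 2 := (lt_div_iff₀ (by positivity)).1 hx2
  have h6 := hmul (u x) (f x)
  rw [← hx3] at h6
  linarith

end Characterizations

/-! ### Extensions of the product with a power of the characteristic polynomial -/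

section PoleExtension

open ComplexConjugate

variable {A : Type*} [NormedNonAssocRing A] [NormedSpace ℝ A] [FiniteDimensional ℝ A]
  [IsScalarTower ℝ A A] [SMulCommClass ℝ A A] [StarRing A] [StarModule ℝ A] [Nontrivial A]

theorem isometry_sl (hA : AltNormed A) {J : A} (hJ : J ∈ unitSphere A) : Isometry (sl J) :=
  Isometry.of_dist_eq fun z w => by rw [dist_eq_norm, dist_eq_norm, ← sl_sub, norm_sl hA hJ]

theorem circularization_inter_slice (hA : AltNormed A) {D : Set ℂ} (hD : ConjInvariant D) {J : A}
    (hJ : J ∈ unitSphere A) : circularization D ∩ slice J = sl J '' D := by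
  ext x
  constructor
  · rintro ⟨hx, z, rfl⟩
    exact ⟨z, (sl_mem_circularization_iff hA hD hJ).1 hx, rfl⟩
  · rintro ⟨z, hz, rfl⟩
    exact ⟨⟨z, hz, J, hJ, rfl⟩, ⟨z, rfl⟩⟩

theorem IsHolStem.continuousOn_slice (hA : AltNormed A) {D : Set ℂ} {G : ℂ → Coord A} {g : A → A}
    (hG : IsHolStem D G g) {J : A} (hJ : J ∈ unitSphere A) :
    ContinuousOn g (circularization D ∩ slice J) := by
  rw [circularization_inter_slice hA hG.conj_mem hJ,
    (isometry_sl hA hJ).isEmbedding.isInducing.continuousOn_image_iff]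
  exact ((evC J).continuous.comp_continuousOn hG.differentiableOn.continuousOn).congr
    fun z hz => hG.induced z hz J hJ

namespace IsIsolatedSphere

variable {D : Set ℂ} {Ω : Set A} {f : A → A} {z₀ : ℂ} {F : ℂ → Coord A}

theorem mem_sdiff_sphere_iff (h : IsIsolatedSphere D Ω f z₀ F) {J K : A} (hJ : J ∈ unitSphere A)
    (hK : K ∈ unitSphere A) {z : ℂ} :
    sl K z ∈ circularization D \ sphere (sl J z₀) ↔ z ∈ D \ {z₀, conj z₀} := by
  rw [Set.mem_sdiff, sl_mem_circularization_iff h.alt h.conj_mem hK, sl_mem_sphere_iff h.alt hJ hK]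
  rfl

/-- The limit at a point of the sphere of an extension that is continuous on one slice. -/
theorem tendsto_evC_of_continuousOn (h : IsIsolatedSphere D Ω f z₀ F) {J : A}
    (hJ : J ∈ unitSphere A) {g : A → A} {k : ℕ}
    (hc : ContinuousOn g (circularization D ∩ slice J))
    (hg : ∀ z ∈ D \ {z₀, conj z₀}, g (sl J z) = evC J (conjPoly z₀ z ^ k • F z)) :
    Tendsto (fun z => evC J (conjPoly z₀ z ^ k • F z)) (𝓝[≠] z₀) (𝓝 (g (sl J z₀))) := by
  have h1 := hc (sl J z₀) ⟨⟨z₀, h.mem, J, hJ, rfl⟩, ⟨z₀, rfl⟩⟩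
  have h2 : Tendsto (sl J) (𝓝[≠] z₀) (𝓝[circularization D ∩ slice J] (sl J z₀)) := by
    refine tendsto_nhdsWithin_iff.2
      ⟨((continuous_sl J).tendsto z₀).mono_left nhdsWithin_le_nhds, ?_⟩
    filter_upwards [h.eventually_mem] with z hz using ⟨⟨z, hz.1, J, hJ, rfl⟩, ⟨z, rfl⟩⟩
  refine (h1.tendsto.comp h2).congr' ?_
  filter_upwards [h.eventually_mem] with z hz using hg z hz

theorem tendsto_evC_of_extension (h : IsIsolatedSphere D Ω f z₀ F) {G : ℂ → Coord A} {k : ℕ}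
    (hG : DifferentiableAt ℂ G z₀)
    (hGF : ∀ z ∈ D \ {z₀, conj z₀}, G z = conjPoly z₀ z ^ k • F z) (I : A) :
    Tendsto (fun z => evC I (conjPoly z₀ z ^ k • F z)) (𝓝[≠] z₀) (𝓝 (evC I (G z₀))) := by
  have h1 := (((evC I).continuous.tendsto _).comp hG.continuousAt.tendsto).mono_left
    (nhdsWithin_le_nhds (s := {z₀}ᶜ))
  refine h1.congr' ?_
  filter_upwards [h.eventually_mem] with z hz
  rw [Function.comp_apply, hGF z hz]

theorem poleLE_of_extension (h : IsIsolatedSphere D Ω f z₀ F) {G : ℂ → Coord A} {k : ℕ}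
    (hG : DifferentiableAt ℂ G z₀)
    (hGF : ∀ z ∈ D \ {z₀, conj z₀}, G z = conjPoly z₀ z ^ k • F z) : PoleLE F z₀ k := by
  obtain ⟨J, hJ⟩ := h.nonempty
  have hO : ∀ I ∈ unitSphere A, SlicePoleLE F I z₀ k := fun I hI =>
    (h.slicePoleLE_iff_conjPoly hI).2 ((h.tendsto_evC_of_extension hG hGF I).isBigO_one ℝ)
  exact (poleLE_iff_slicePoleLE h.alt hJ).2 ⟨hO J hJ, hO _ (neg_mem_unitSphere hJ)⟩

/-- If an extension `G` of `((z - z₀) (z - z̄₀)) ^ k F z` is non-zero at `z₀`, it is so at one of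
the points of the sphere in a given slice, where the pole order is then at least `k`. -/
theorem le_of_poleLE_of_extension (h : IsIsolatedSphere D Ω f z₀ F) {G : ℂ → Coord A} {k m : ℕ}
    (hG : DifferentiableAt ℂ G z₀)
    (hGF : ∀ z ∈ D \ {z₀, conj z₀}, G z = conjPoly z₀ z ^ k • F z) (h0 : G z₀ ≠ 0)
    (hm : PoleLE F z₀ m) : k ≤ m := by
  obtain ⟨J, hJ⟩ := h.nonempty
  obtain ⟨h1, h2⟩ := (poleLE_iff_slicePoleLE h.alt hJ).1 hm
  by_cases hz : evC J (G z₀) = 0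
  · have hz' : evC (-J) (G z₀) ≠ 0 := fun hc => h0 ((evC_eq_zero_iff h.alt hJ _).1 ⟨hz, hc⟩)
    exact h.le_of_slicePoleLE (neg_mem_unitSphere hJ) hz' (h.tendsto_evC_of_extension hG hGF _) h2
  · exact h.le_of_slicePoleLE hJ hz (h.tendsto_evC_of_extension hG hGF _) h1

/-- At a sphere of poles that is not removable, multiplication by the power of the characteristic
polynomial given by the exact pole order yields a holomorphic stem function which does not
vanish at `z₀`. -/
theorem exists_ne_zero_extension (h : IsIsolatedSphere D Ω f z₀ F) (hp : ∃ m, PoleLE F z₀ m)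
    (h0 : ¬ PoleLE F z₀ 0) :
    ∃ k : ℕ, k ≠ 0 ∧ ∃ (G : ℂ → Coord A) (g : A → A), IsHolStem D G g ∧
      (∀ z ∈ D \ {z₀, conj z₀}, G z = conjPoly z₀ z ^ k • F z) ∧ G z₀ ≠ 0 := by
  classical
  obtain ⟨J, hJ⟩ := h.nonempty
  set k := Nat.find hp with hk
  have hk0 : k ≠ 0 := fun hc => h0 (by
    have := Nat.find_spec hp
    rwa [← hk, hc] at this)
  obtain ⟨G, g, hG, hGF⟩ := h.exists_extension (Nat.find_spec hp)
  refine ⟨k, hk0, G, g, hG, hGF, fun hc => ?_⟩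
  have hd := hG.differentiableOn.differentiableAt (hG.isOpen.mem_nhds h.mem)
  have hpred : ∀ I ∈ unitSphere A, SlicePoleLE F I z₀ (k - 1) := fun I hI =>
    h.slicePoleLE_pred hI hk0 hd hGF (by rw [hc, map_zero])
  exact Nat.find_min hp (m := k - 1) (by omega)
    ((poleLE_iff_slicePoleLE h.alt hJ).2 ⟨hpred J hJ, hpred _ (neg_mem_unitSphere hJ)⟩)

theorem isContinuousExtension (h : IsIsolatedSphere D Ω f z₀ F) {J : A} (hJ : J ∈ unitSphere A)
    {G : ℂ → Coord A} {g : A → A} {k : ℕ} (hG : IsHolStem D G g)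
    (hGF : ∀ z ∈ D \ {z₀, conj z₀}, G z = conjPoly z₀ z ^ k • F z) :
    IsContinuousExtension (circularization D ∩ slice J) f (sl J z₀) k g := by
  refine ⟨hG.continuousOn_slice h.alt hJ, ?_⟩
  rintro _ ⟨⟨hx, z, rfl⟩, hs⟩
  have hz := (h.mem_sdiff_sphere_iff hJ hJ).1 ⟨hx, hs⟩
  rw [h.apow_mul_apow_mul_eq hJ hz, ← hGF z hz, hG.induced z hz.1 J hJ]

theorem isRegularExtension (h : IsIsolatedSphere D Ω f z₀ F) {J : A} (hJ : J ∈ unitSphere A)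
    {G : ℂ → Coord A} {g : A → A} {k : ℕ} (hG : IsHolStem D G g)
    (hGF : ∀ z ∈ D \ {z₀, conj z₀}, G z = conjPoly z₀ z ^ k • F z) (h0 : G z₀ ≠ 0) :
    IsRegularExtension (circularization D) f (sl J z₀) k g := by
  refine ⟨hG.sliceRegularOn ⟨z₀, h.mem⟩ h.isOpenInCone, ?_, ?_⟩
  · rintro _ ⟨⟨z, hz, K, hK, rfl⟩, hs⟩
    have hz' := (h.mem_sdiff_sphere_iff hJ hK).1 ⟨⟨z, hz, K, hK, rfl⟩, hs⟩
    rw [h.apow_Delta_mul_eq hJ hK hz', ← hGF z hz', hG.induced z hz K hK]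
  · by_contra! hc
    refine h0 ((evC_eq_zero_iff h.alt hJ _).1 ⟨?_, ?_⟩)
    · rw [← hG.induced z₀ h.mem J hJ]
      exact hc _ ((mem_sphere_sl_iff h.alt hJ).2 ⟨J, hJ, rfl⟩)
    · rw [← hG.induced z₀ h.mem _ (neg_mem_unitSphere hJ)]
      exact hc _ ((mem_sphere_sl_iff h.alt hJ).2 ⟨-J, neg_mem_unitSphere hJ, rfl⟩)

theorem exists_stem_of_isRegularExtension (h : IsIsolatedSphere D Ω f z₀ F) {J : A}
    (hJ : J ∈ unitSphere A) {g : A → A} {k : ℕ}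
    (hg : IsRegularExtension (circularization D) f (sl J z₀) k g) :
    ∃ G : ℂ → Coord A, IsHolStem D G g ∧
      (∀ z ∈ D \ {z₀, conj z₀}, G z = conjPoly z₀ z ^ k • F z) ∧ G z₀ ≠ 0 := by
  obtain ⟨hreg, heq, w, hw, hgw⟩ := hg
  obtain ⟨G, hG⟩ := hreg.exists_isHolStem h.alt hJ
  have hD : {z | sl J z ∈ circularization (A := A) D} = D :=
    Set.ext fun z => sl_mem_circularization_iff h.alt h.conj_mem hJ
  rw [hD] at hG
  refine ⟨G, hG, fun z hz => eq_of_forall_evC_eq h.alt hJ fun K hK => ?_, fun hc => hgw ?_⟩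
  · rw [← hG.induced z hz.1 K hK, heq _ ((h.mem_sdiff_sphere_iff hJ hK).2 hz),
      h.apow_Delta_mul_eq hJ hK hz]
  · obtain ⟨I, hI, rfl⟩ := (mem_sphere_sl_iff h.alt hJ).1 hw
    rw [hG.induced z₀ h.mem I hI, hc, map_zero]

theorem sdiff_conj_center (z₀ : ℂ) (D : Set ℂ) :
    D \ {conj z₀, conj (conj z₀)} = D \ {z₀, conj z₀} := by
  rw [Complex.conj_conj, pair_comm]

/-- A continuous extension on one slice that is non-zero at `y` or at `y^c` forces the stem function
to have a pole of order exactly `k`. -/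
theorem poleLE_of_isContinuousExtension (h : IsIsolatedSphere D Ω f z₀ F) {J : A}
    (hJ : J ∈ unitSphere A) {g : A → A} {k : ℕ}
    (hg : IsContinuousExtension (circularization D ∩ slice J) f (sl J z₀) k g)
    (h0 : g (sl J z₀) ≠ 0 ∨ g (star (sl J z₀)) ≠ 0) :
    PoleLE F z₀ k ∧ ∀ m, PoleLE F z₀ m → k ≤ m := by
  obtain ⟨hc, hgf⟩ := hg
  have hgF : ∀ z ∈ D \ {z₀, conj z₀}, g (sl J z) = evC J (conjPoly z₀ z ^ k • F z) := by
    intro z hz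
    have hz' := (h.mem_sdiff_sphere_iff hJ hJ).2 hz
    rw [hgf _ ⟨⟨hz'.1, ⟨z, rfl⟩⟩, hz'.2⟩, h.apow_mul_apow_mul_eq hJ hz]
  have t1 := h.tendsto_evC_of_continuousOn hJ hc hgF
  have t2 := h.conj_center.tendsto_evC_of_continuousOn (k := k) hJ hc (fun z hz => by
    rw [sdiff_conj_center] at hz
    rw [conjPoly_center, hgF z hz])
  have p1 := (h.slicePoleLE_iff_conjPoly hJ).2 (t1.isBigO_one ℝ)
  have p2 := (h.conj_center.slicePoleLE_iff_conjPoly hJ).2 (t2.isBigO_one ℝ)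
  refine ⟨(poleLE_iff_slicePoleLE h.alt hJ).2 ⟨p1, h.slicePoleLE_conj_iff.1 p2⟩, fun m hm => ?_⟩
  obtain ⟨m1, m2⟩ := (poleLE_iff_slicePoleLE h.alt hJ).1 hm
  rw [star_sl hJ] at h0
  rcases h0 with h0 | h0
  · exact h.le_of_slicePoleLE hJ h0 t1 m1
  · exact h.conj_center.le_of_slicePoleLE hJ h0 t2 (h.slicePoleLE_conj_iff.2 m2)

end IsIsolatedSphere

end PoleExtension

/-! ### The classification of spheres -/

section Classification

open ComplexConjugate

variable {A : Type*} [NormedNonAssocRing A] [NormedSpace ℝ A] [FiniteDimensional ℝ A]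
  [IsScalarTower ℝ A A] [SMulCommClass ℝ A A] [StarRing A] [StarModule ℝ A] [Nontrivial A]

namespace IsIsolatedSphere

variable {D : Set ℂ} {Ω : Set A} {f : A → A} {z₀ : ℂ} {F : ℂ → Coord A}

theorem star_center_eq {J : A} (hJ : J ∈ unitSphere A) : star (sl J z₀) = sl (-J) z₀ := by
  rw [star_sl hJ, sl_neg]

theorem ord_ne_top_iff (h : IsIsolatedSphere D Ω f z₀ F) {J : A} (hJ : J ∈ unitSphere A) :
    (ord Ω f (sl J z₀) ≠ ⊤ ∧ ord Ω f (star (sl J z₀)) ≠ ⊤) ↔ ∃ m, PoleLE F z₀ m := by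
  rw [star_center_eq hJ, h.exists_poleLE_iff hJ, Ne, Ne, h.ord_eq_top_iff hJ,
    h.ord_eq_top_iff (neg_mem_unitSphere hJ)]
  push Not
  rfl

theorem ord_eq_zero_iff (h : IsIsolatedSphere D Ω f z₀ F) {J : A} (hJ : J ∈ unitSphere A) :
    (ord Ω f (sl J z₀) = 0 ∧ ord Ω f (star (sl J z₀)) = 0) ↔ PoleLE F z₀ 0 := by
  have e : ∀ I ∈ unitSphere A, ord Ω f (sl I z₀) = 0 ↔ SlicePoleLE F I z₀ 0 := fun I hI => by
    rw [← h.ord_le_iff hI, Nat.cast_zero, nonpos_iff_eq_zero]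
  rw [star_center_eq hJ, poleLE_iff_slicePoleLE h.alt hJ, e J hJ, e _ (neg_mem_unitSphere hJ)]

theorem sphericalOrd_eq_zero_iff (h : IsIsolatedSphere D Ω f z₀ F) {J : A}
    (hJ : J ∈ unitSphere A) : sphericalOrd Ω f (sl J z₀) = 0 ↔ PoleLE F z₀ 0 := by
  rw [← h.sphericalOrd_le_iff hJ, mul_zero, Nat.cast_zero, nonpos_iff_eq_zero]

/-- All conditions say that the stem function is bounded near `z₀`. -/
theorem removable_tfae (h : IsIsolatedSphere D Ω f z₀ F) {J : A} (hJ : J ∈ unitSphere A) :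
    List.TFAE [
      AllRemovable Ω f (sl J z₀),
      sphericalOrd Ω f (sl J z₀) = 0,
      ord Ω f (sl J z₀) = 0 ∧ ord Ω f (star (sl J z₀)) = 0,
      ∃ U : Set A, IsNhdIn (circularization D ∩ slice J) {sl J z₀, star (sl J z₀)} U ∧
        ∃ M : ℝ, ∀ z ∈ U \ {sl J z₀, star (sl J z₀)}, ‖f z‖ ≤ M,
      ∃ U : Set A, IsNhdIn (circularization D) (sphere (sl J z₀)) U ∧
        ∃ M : ℝ, ∀ x ∈ U \ sphere (sl J z₀), ‖f x‖ ≤ M] := by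
  refine List.tfae_of_forall (PoleLE F z₀ 0) _ ?_
  simp only [List.mem_cons, List.not_mem_nil, or_false]
  rintro _ (rfl | rfl | rfl | rfl | rfl)
  · exact h.allRemovable_iff hJ
  · exact h.sphericalOrd_eq_zero_iff hJ
  · exact h.ord_eq_zero_iff hJ
  · exact h.exists_bound_slice_iff hJ
  · simpa only [apow, one_mul] using h.exists_bound_sphere_iff hJ 0

/-- All conditions say that the stem function has a pole at `z₀`, of positive order. -/
theorem nonremovable_tfae (h : IsIsolatedSphere D Ω f z₀ F) {J : A} (hJ : J ∈ unitSphere A) :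
    List.TFAE [
      AllNonremovablePoles Ω f (sl J z₀),
      sphericalOrd Ω f (sl J z₀) ≠ ⊤ ∧ 0 < sphericalOrd Ω f (sl J z₀),
      (ord Ω f (sl J z₀) ≠ ⊤ ∧ ord Ω f (star (sl J z₀)) ≠ ⊤) ∧
        (0 < ord Ω f (sl J z₀) ∨ 0 < ord Ω f (star (sl J z₀))),
      ∃ k : ℕ, k ≠ 0 ∧ ∃ g : A → A,
        IsContinuousExtension (circularization D ∩ slice J) f (sl J z₀) k g ∧
        (g (sl J z₀) ≠ 0 ∨ g (star (sl J z₀)) ≠ 0),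
      ∃ k : ℕ, k ≠ 0 ∧ ∃ g : A → A, IsRegularExtension (circularization D) f (sl J z₀) k g] := by
  refine List.tfae_of_forall ((∃ m, PoleLE F z₀ m) ∧ ¬ PoleLE F z₀ 0) _ ?_
  simp only [List.mem_cons, List.not_mem_nil, or_false]
  rintro _ (rfl | rfl | rfl | rfl | rfl)
  · exact h.allNonremovablePoles_iff hJ
  · rw [Ne, h.sphericalOrd_eq_top_iff hJ, pos_iff_ne_zero, Ne, h.sphericalOrd_eq_zero_iff hJ]
    push Not
    rfl
  · rw [h.ord_ne_top_iff hJ, pos_iff_ne_zero, pos_iff_ne_zero, ← not_and_or, h.ord_eq_zero_iff hJ]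
  · constructor
    · rintro ⟨k, hk, g, hg, h0⟩
      obtain ⟨h1, h2⟩ := h.poleLE_of_isContinuousExtension hJ hg h0
      exact ⟨⟨k, h1⟩, fun hc => hk (Nat.le_zero.1 (h2 0 hc))⟩
    · rintro ⟨hp, h0⟩
      obtain ⟨k, hk, G, g, hG, hGF, hG0⟩ := h.exists_ne_zero_extension hp h0
      refine ⟨k, hk, g, h.isContinuousExtension hJ hG hGF, ?_⟩
      by_contra! hc
      rw [star_center_eq hJ, hG.induced z₀ h.mem J hJ,
        hG.induced z₀ h.mem _ (neg_mem_unitSphere hJ)] at hc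
      exact hG0 ((evC_eq_zero_iff h.alt hJ _).1 hc)
  · constructor
    · rintro ⟨k, hk, g, hg⟩
      obtain ⟨G, hG, hGF, hG0⟩ := h.exists_stem_of_isRegularExtension hJ hg
      have hd := hG.differentiableOn.differentiableAt (hG.isOpen.mem_nhds h.mem)
      exact ⟨⟨k, h.poleLE_of_extension hd hGF⟩, fun hc =>
        hk (Nat.le_zero.1 (h.le_of_poleLE_of_extension hd hGF hG0 hc))⟩
    · rintro ⟨hp, h0⟩
      obtain ⟨k, hk, G, g, hG, hGF, hG0⟩ := h.exists_ne_zero_extension hp h0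
      exact ⟨k, hk, g, h.isRegularExtension hJ hG hGF hG0⟩

/-- All conditions say that the stem function has an essential singularity at `z₀`. -/
theorem essential_tfae (h : IsIsolatedSphere D Ω f z₀ F) {J : A} (hJ : J ∈ unitSphere A) :
    List.TFAE [
      EssentialInEverySlice Ω f (sl J z₀),
      sphericalOrd Ω f (sl J z₀) = ⊤,
      ¬ (ord Ω f (sl J z₀) ≠ ⊤ ∧ ord Ω f (star (sl J z₀)) ≠ ⊤),
      (∀ U : Set A, IsNhdIn (circularization D ∩ slice J) {sl J z₀} U → star (sl J z₀) ∉ U →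
        ∀ k : ℕ, ¬ BddAbove ((fun z => ‖apow (z - sl J z₀) k * f z‖) '' (U \ {sl J z₀}))) ∨
        (∀ U : Set A, IsNhdIn (circularization D ∩ slice J) {star (sl J z₀)} U → sl J z₀ ∉ U →
          ∀ k : ℕ, ¬ BddAbove
            ((fun z => ‖apow (z - star (sl J z₀)) k * f z‖) '' (U \ {star (sl J z₀)}))),
      ∀ U : Set A, IsNhdIn (circularization D) (sphere (sl J z₀)) U → ∀ k : ℕ,
        ¬ BddAbove ((fun x => ‖apow (Delta (sl J z₀) x) k * f x‖) '' (U \ sphere (sl J z₀)))] := by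
  refine List.tfae_of_forall (∀ m, ¬ PoleLE F z₀ m) _ ?_
  simp only [List.mem_cons, List.not_mem_nil, or_false]
  rintro _ (rfl | rfl | rfl | rfl | rfl)
  · exact h.essentialInEverySlice_iff hJ
  · exact h.sphericalOrd_eq_top_iff hJ
  · rw [h.ord_ne_top_iff hJ, not_exists]
  · have e2 := h.conj_center.forall_not_bddAbove_slice_iff hJ
    rw [Complex.conj_conj] at e2
    rw [star_sl hJ, h.forall_not_bddAbove_slice_iff hJ, e2, ← not_and_or, ← not_exists,
      h.exists_poleLE_iff hJ]
    simp only [h.slicePoleLE_conj_iff]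
  · constructor
    · intro hall m hm
      obtain ⟨U, hU, M, hM⟩ := (h.exists_bound_sphere_iff hJ m).2 hm
      refine hall U hU m ⟨M, ?_⟩
      rintro _ ⟨x, hx, rfl⟩
      exact hM x hx
    · rintro hn U hU k ⟨M, hM⟩
      exact hn k ((h.exists_bound_sphere_iff hJ k).1 ⟨U, hU, M, fun x hx => hM ⟨x, hx, rfl⟩⟩)

theorem trichotomy (h : IsIsolatedSphere D Ω f z₀ F) {J : A} (hJ : J ∈ unitSphere A) :
    (AllRemovable Ω f (sl J z₀) ∨ AllNonremovablePoles Ω f (sl J z₀) ∨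
      EssentialInEverySlice Ω f (sl J z₀)) ∧
      ¬ (AllRemovable Ω f (sl J z₀) ∧ AllNonremovablePoles Ω f (sl J z₀)) ∧
      ¬ (AllRemovable Ω f (sl J z₀) ∧ EssentialInEverySlice Ω f (sl J z₀)) ∧
      ¬ (AllNonremovablePoles Ω f (sl J z₀) ∧ EssentialInEverySlice Ω f (sl J z₀)) := by
  rw [h.allRemovable_iff hJ, h.allNonremovablePoles_iff hJ, h.essentialInEverySlice_iff hJ,
    ← not_exists]
  have : PoleLE F z₀ 0 → ∃ m, PoleLE F z₀ m := fun h0 => ⟨0, h0⟩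
  tauto

theorem tendsto_norm_of_isContinuousExtension (h : IsIsolatedSphere D Ω f z₀ F) {J : A}
    (hJ : J ∈ unitSphere A) {k : ℕ} (hk : k ≠ 0) {g : A → A}
    (hg : IsContinuousExtension (circularization D ∩ slice J) f (sl J z₀) k g) {w : A}
    (hw : w = sl J z₀ ∨ w = star (sl J z₀)) (h0 : g w ≠ 0) :
    Tendsto (fun x => ‖f x‖) (𝓝[Ω ∩ slice J] w) atTop := by
  have hsub : Ω ∩ slice J ⊆ (circularization D ∩ slice J) \ sphere (sl J z₀) := by
    rintro _ ⟨hx, z, rfl⟩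
    obtain ⟨h1, h2, h3⟩ := (h.sl_mem_iff hJ).1 hx
    have := (h.mem_sdiff_sphere_iff hJ hJ).2 (⟨h1, by simp [h2, h3]⟩ : z ∈ D \ {z₀, conj z₀})
    exact ⟨⟨this.1, z, rfl⟩, this.2⟩
  have hwX : w ∈ circularization D ∩ slice J := by
    rcases hw with rfl | rfl
    · exact ⟨⟨z₀, h.mem, J, hJ, rfl⟩, ⟨z₀, rfl⟩⟩
    · rw [star_sl hJ]
      exact ⟨⟨conj z₀, h.conj_mem _ h.mem, J, hJ, rfl⟩, ⟨conj z₀, rfl⟩⟩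
  set u : A → A := fun x => apow (x - sl J z₀) k * apow (x - star (sl J z₀)) k with hu
  have huc : Continuous u := continuous_mul_of_finiteDimensional.comp
    ((continuous_apow (continuous_id.sub continuous_const) k).prodMk
      (continuous_apow (continuous_id.sub continuous_const) k))
  have hap : apow (0 : A) k = 0 := by
    obtain ⟨j, rfl⟩ := Nat.exists_eq_succ_of_ne_zero hk
    exact zero_mul _
  have hu0 : u w = 0 := by
    rcases hw with rfl | rfl
    · simp only [hu, sub_self, hap, zero_mul]
    · simp only [hu, sub_self, hap, mul_zero]
  refine tendsto_norm_atTop_of_tendsto_mul h0 ((hg.1 w hwX).tendsto.mono_left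
    (nhdsWithin_mono _ fun x hx => (hsub hx).1))
    ((huc.tendsto' w 0 hu0).mono_left nhdsWithin_le_nhds) ?_
  filter_upwards [self_mem_nhdsWithin] with x hx using hg.2 x (hsub hx)

theorem isRegularExtension_ne_zero (h : IsIsolatedSphere D Ω f z₀ F) {J : A}
    (hJ : J ∈ unitSphere A) {k : ℕ} (hk : k ≠ 0) {g : A → A}
    (hg : IsRegularExtension (circularization D) f (sl J z₀) k g) {w : A}
    (hw : w ∈ sphere (sl J z₀)) (h0 : g w ≠ 0) :
    sphericalOrd Ω f (sl J z₀) = 2 * (k : ℕ∞) ∧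
      sphericalOrd Ω f (sl J z₀) = 2 * ord Ω f w ∧ Tendsto (fun x => ‖f x‖) (𝓝[Ω] w) atTop := by
  obtain ⟨G, hG, hGF, hG0⟩ := h.exists_stem_of_isRegularExtension hJ hg
  obtain ⟨I, hI, rfl⟩ := (mem_sphere_sl_iff h.alt hJ).1 hw
  have hd := hG.differentiableOn.differentiableAt (hG.isOpen.mem_nhds h.mem)
  have hp := h.poleLE_of_extension hd hGF
  have hI0 : evC I (G z₀) ≠ 0 := by rwa [← hG.induced z₀ h.mem I hI]
  have e1 := h.sphericalOrd_eq hJ hp fun m hm => h.le_of_poleLE_of_extension hd hGF hG0 hm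
  have e2 := h.ord_eq hI ((poleLE_iff_slicePoleLE h.alt hI).1 hp).1 fun m hm =>
    h.le_of_slicePoleLE hI hI0 (h.tendsto_evC_of_extension hd hGF I) hm
  refine ⟨e1, by rw [e1, e2], ?_⟩
  have hsub : Ω ⊆ circularization D \ sphere (sl J z₀) := by
    rw [h.eq_circ]
    rintro _ ⟨z, hz, K, hK, rfl⟩
    exact (h.mem_sdiff_sphere_iff hJ hK).2 hz
  have hu : Continuous fun x : A => apow (Delta (sl J z₀) x) k :=
    continuous_apow (continuous_Delta _) k
  have hu0 : apow (Delta (sl J z₀) (sl I z₀)) k = 0 := by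
    rw [Delta_sl hJ hI, sub_self, zero_mul, sl_zero]
    obtain ⟨j, rfl⟩ := Nat.exists_eq_succ_of_ne_zero hk
    exact zero_mul _
  refine tendsto_norm_atTop_of_tendsto_mul h0
    ((hG.continuousWithinAt h.alt hI h.mem h.im_ne).tendsto.mono_left
      (nhdsWithin_mono _ fun x hx => (hsub hx).1))
    ((hu.tendsto' _ 0 hu0).mono_left nhdsWithin_le_nhds) ?_
  filter_upwards [self_mem_nhdsWithin] with x hx using hg.2.1 x (hsub hx)

theorem ord_lt_of_isRegularExtension (h : IsIsolatedSphere D Ω f z₀ F) {J : A}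
    (hJ : J ∈ unitSphere A) {k : ℕ} (hk : k ≠ 0) {g : A → A}
    (hg : IsRegularExtension (circularization D) f (sl J z₀) k g) {w : A}
    (hw : w ∈ sphere (sl J z₀)) (h0 : g w = 0) : ord Ω f w < (k : ℕ∞) := by
  obtain ⟨G, hG, hGF, -⟩ := h.exists_stem_of_isRegularExtension hJ hg
  obtain ⟨I, hI, rfl⟩ := (mem_sphere_sl_iff h.alt hJ).1 hw
  have hd := hG.differentiableOn.differentiableAt (hG.isOpen.mem_nhds h.mem)
  rw [hG.induced z₀ h.mem I hI] at h0
  refine ((h.ord_le_iff hI).2 (h.slicePoleLE_pred hI hk hd hGF h0)).trans_lt ?_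
  rw [Nat.cast_lt]
  omega

end IsIsolatedSphere

/-- A slice regular function on the complement of the sphere of a non-real point in a circular open
set, in terms of its stem function. -/
theorem exists_isIsolatedSphere (hA : AltNormed A) {Ωt : Set A} (circular : IsCircular Ωt)
    (isOpen : IsOpenInCone Ωt) {J : A} (hJ : J ∈ unitSphere A) {z₀ : ℂ} (hz₀ : z₀.im ≠ 0)
    (hy : sl J z₀ ∈ Ωt) {f : A → A} (hf : SliceRegularOn (Ωt \ sphere (sl J z₀)) f) :
    ∃ (D : Set ℂ) (F : ℂ → Coord A), Ωt = circularization D ∧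
      IsIsolatedSphere D (Ωt \ sphere (sl J z₀)) f z₀ F := by
  obtain ⟨E, rfl⟩ := circular
  -- `E` itself need not be invariant under conjugation
  set D : Set ℂ := {z | z ∈ E ∨ conj z ∈ E} with hD
  have hconj : ConjInvariant D := fun z hz => by
    rcases hz with hz | hz
    · exact Or.inr (by rwa [Complex.conj_conj])
    · exact Or.inl hz
  have hED : circularization (A := A) E = circularization D := by
    ext x
    constructor
    · rintro ⟨z, hz, K, hK, rfl⟩
      exact ⟨z, Or.inl hz, K, hK, rfl⟩
    · rintro ⟨z, hz | hz, K, hK, rfl⟩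
      · exact ⟨z, hz, K, hK, rfl⟩
      · exact ⟨conj z, hz, -K, neg_mem_unitSphere hK, by rw [sl_neg, Complex.conj_conj]⟩
  rw [hED] at isOpen hy hf ⊢
  have hmem : ∀ K ∈ unitSphere A, ∀ z,
      sl K z ∈ circularization D \ sphere (sl J z₀) ↔ z ∈ D \ {z₀, conj z₀} := by
    intro K hK z
    rw [Set.mem_sdiff, sl_mem_circularization_iff hA hconj hK, sl_mem_sphere_iff hA hJ hK]
    rfl
  obtain ⟨F, hF⟩ := hf.exists_isHolStem hA hJ
  have hset : {z | sl J z ∈ circularization D \ sphere (sl J z₀)} = D \ {z₀, conj z₀} :=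
    Set.ext fun z => hmem J hJ z
  rw [hset] at hF
  refine ⟨D, F, rfl, ⟨hA, ⟨J, hJ⟩, hz₀, (sl_mem_circularization_iff hA hconj hJ).1 hy,
    isOpen_of_isOpenInCone hA hconj isOpen hJ, hconj, isOpen, ?_, hF⟩⟩
  ext x
  constructor
  · rintro ⟨⟨z, hz, K, hK, rfl⟩, hs⟩
    exact ⟨z, (hmem K hK z).1 ⟨⟨z, hz, K, hK, rfl⟩, hs⟩, K, hK, rfl⟩
  · rintro ⟨z, hz, K, hK, rfl⟩
    exact (hmem K hK z).2 hz

end Classification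

end

end SliceAlg

theorem mainTheorem1 {A : Type*} [NormedNonAssocRing A] [NormedSpace ℝ A]
    [IsScalarTower ℝ A A] [SMulCommClass ℝ A A] [StarRing A] [StarModule ℝ A]
    [Nontrivial A] [FiniteDimensional ℝ A]
    (left_alt : ∀ x y : A, (x * x) * y = x * (x * y))
    (right_alt : ∀ x y : A, (y * x) * x = y * (x * x))
    (sphere_nonempty : (unitSphere A).Nonempty)
    (norm_sq : ∀ x ∈ quadraticCone A, nm x = (‖x‖ ^ 2) • (1 : A))
    (Ωt : Set A) (circular : IsCircular Ωt) (isOpen : IsOpenInCone Ωt)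
    (y : A) (hy : y ∈ Ωt) (Ω : Set A) (hΩ : Ω = Ωt \ sphere y)
    (f : A → A) (hf : SliceRegularOn Ω f)
    (J : A) (hJ : J ∈ unitSphere A) (hyJ : y ∈ slice J \ realLine A) :
    -- the expansions defining the orders exist and are unique
    ((∀ w ∈ sphere y, IsSingularity Ω w ∧ ∃! a : ℤ → A, IsLaurentExpansion Ω f w a) ∧
      ∃! c : ℤ → A, IsSphericalExpansion Ω f y c) ∧
    -- exactly one of the three cases holds
    ((AllRemovable Ω f y ∨ AllNonremovablePoles Ω f y ∨ EssentialInEverySlice Ω f y) ∧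
      ¬ (AllRemovable Ω f y ∧ AllNonremovablePoles Ω f y) ∧
      ¬ (AllRemovable Ω f y ∧ EssentialInEverySlice Ω f y) ∧
      ¬ (AllNonremovablePoles Ω f y ∧ EssentialInEverySlice Ω f y)) ∧
    -- case 1
    List.TFAE [
      AllRemovable Ω f y,
      sphericalOrd Ω f y = 0,
      ord Ω f y = 0 ∧ ord Ω f (star y) = 0,
      ∃ U : Set A, IsNhdIn (Ωt ∩ slice J) {y, star y} U ∧
        ∃ M : ℝ, ∀ z ∈ U \ {y, star y}, ‖f z‖ ≤ M,
      ∃ U : Set A, IsNhdIn Ωt (sphere y) U ∧ ∃ M : ℝ, ∀ x ∈ U \ sphere y, ‖f x‖ ≤ M] ∧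
    -- case 2
    List.TFAE [
      AllNonremovablePoles Ω f y,
      sphericalOrd Ω f y ≠ ⊤ ∧ 0 < sphericalOrd Ω f y,
      (ord Ω f y ≠ ⊤ ∧ ord Ω f (star y) ≠ ⊤) ∧ (0 < ord Ω f y ∨ 0 < ord Ω f (star y)),
      ∃ k : ℕ, k ≠ 0 ∧ ∃ g : A → A, IsContinuousExtension (Ωt ∩ slice J) f y k g ∧
        (g y ≠ 0 ∨ g (star y) ≠ 0),
      ∃ k : ℕ, k ≠ 0 ∧ ∃ g : A → A, IsRegularExtension Ωt f y k g] ∧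
    -- complements to the fourth condition of case 2
    (∀ k : ℕ, k ≠ 0 → ∀ g : A → A, IsContinuousExtension (Ωt ∩ slice J) f y k g →
      (g y ≠ 0 → Tendsto (fun x => ‖f x‖) (𝓝[Ω ∩ slice J] y) atTop) ∧
      (g (star y) ≠ 0 → Tendsto (fun x => ‖f x‖) (𝓝[Ω ∩ slice J] (star y)) atTop)) ∧
    -- complements to the fifth condition of case 2
    (∀ k : ℕ, k ≠ 0 → ∀ g : A → A, IsRegularExtension Ωt f y k g →
      (∀ w ∈ sphere y, g w ≠ 0 →
        sphericalOrd Ω f y = 2 * (k : ℕ∞) ∧ sphericalOrd Ω f y = 2 * ord Ω f w ∧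
          Tendsto (fun x => ‖f x‖) (𝓝[Ω] w) atTop) ∧
      (∀ w ∈ sphere y, g w = 0 → ord Ω f w < (k : ℕ∞))) ∧
    -- case 3
    List.TFAE [
      EssentialInEverySlice Ω f y,
      sphericalOrd Ω f y = ⊤,
      ¬ (ord Ω f y ≠ ⊤ ∧ ord Ω f (star y) ≠ ⊤),
      (∀ U : Set A, IsNhdIn (Ωt ∩ slice J) {y} U → star y ∉ U → ∀ k : ℕ,
          ¬ BddAbove ((fun z => ‖apow (z - y) k * f z‖) '' (U \ {y}))) ∨
        (∀ U : Set A, IsNhdIn (Ωt ∩ slice J) {star y} U → y ∉ U → ∀ k : ℕ,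
          ¬ BddAbove ((fun z => ‖apow (z - star y) k * f z‖) '' (U \ {star y}))),
      ∀ U : Set A, IsNhdIn Ωt (sphere y) U → ∀ k : ℕ,
        ¬ BddAbove ((fun x => ‖apow (Delta y x) k * f x‖) '' (U \ sphere y))] := by
  have hA : AltNormed A := ⟨left_alt, norm_sq⟩
  obtain ⟨⟨z₀, rfl⟩, hreal⟩ := hyJ
  have hz₀ : z₀.im ≠ 0 := fun hc => hreal ⟨z₀.re, by rw [sl, hc, zero_smul, add_zero]⟩
  subst hΩ
  obtain ⟨D, F, rfl, h⟩ := exists_isIsolatedSphere hA circular isOpen hJ hz₀ hy hf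
  refine ⟨⟨fun w hw => ?_, h.existsUnique_isSphericalExpansion hJ⟩, h.trichotomy hJ,
    h.removable_tfae hJ, h.nonremovable_tfae hJ, fun k hk g hg =>
      ⟨h.tendsto_norm_of_isContinuousExtension hJ hk hg (Or.inl rfl),
        h.tendsto_norm_of_isContinuousExtension hJ hk hg (Or.inr rfl)⟩,
    fun k hk g hg => ⟨fun w => h.isRegularExtension_ne_zero hJ hk hg,
      fun w => h.ord_lt_of_isRegularExtension hJ hk hg⟩, h.essential_tfae hJ⟩
  obtain ⟨I, hI, rfl⟩ := (mem_sphere_sl_iff hA hJ).1 hw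
  exact ⟨h.isSingularity hI, h.existsUnique_isLaurentExpansion hI⟩
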